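/- **Setting.** Let $\lambda$ be the security parameter and let $G:\{0,1\}^\lambda\to\{0,1\}^{2\lambda+2}$ be a pseudorandom generator (polynomial-time computable, secure against non-uniform polynomial-time distinguishers). Finite abelian groups $\mathbb G$ are given by descriptions from which $|\mathbb G|$ and the group operations can be computed in polynomial time, where a group element is represented by the $\lceil\log_2|\mathbb G|\rceil$-bit binary expansion of its number in an enumeration of $\mathbb G$. Let $\sigma=\sigma(\lambda)$ be a polynomial-time computable slack parameter with $2^{-\sigma(\lambda)}$ negligible (for instance $\sigma=\lambda$); put $\mathsf{slack}(\mathbb G)=0$ if $|\mathbb G|$ is a power of two and $\mathsf{slack}(\mathbb G)=\sigma$ otherwise. **Convert.** $\mathsf{Convert}_{\mathbb G}:\{0,1\}^\lambda\to\{0,1\}^\lambda\times\mathbb G$ is computed as follows: stretch the seed to $(k+1)\lambda$ bits by $k=\lceil(\log_2|\mathbb G|+\mathsf{slack}(\mathbb G))/\lambda\rceil$ successive evaluations of $G$ (each replaces the current seed $s$ by the first seed part $s^L$ of $G(s)=s^L\|t^L\|s^R\|t^R$ and emits the second seed part $s^R$); output the last seed and the group element whose number is the integer formed by the $k\lambda$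 emitted bits, reduced modulo $|\mathbb G|$. **Gen.** On input $1^\lambda$ and $(\alpha,(\mathbb G_1,\beta_1),\dots,(\mathbb G_n,\beta_n))$ with $\alpha\in\{0,1\}^n$, $\beta_\ell\in\mathbb G_\ell$: sample $s_0,s_1\in\{0,1\}^\lambda$ uniformly, let $k_b=s_b$, $t_0=0$, $t_1=1$. For $\ell=1,\dots,n$: let $G(s_b)=s_b^L\|t_b^L\|s_b^R\|t_b^R$; let $(\mathsf{Keep},\mathsf{Lose})=(L,R)$ if $\alpha_\ell=0$ and $(R,L)$ otherwise; $s_{CW}=s_0^{\mathsf{Lose}}\oplus s_1^{\mathsf{Lose}}$, $t_{CW}^L=t_0^L\oplus t_1^L\oplus\alpha_\ell\oplus1$, $t_{CW}^R=t_0^R\oplus t_1^R\oplus\alpha_\ell$; replace $t_b$ by $t_b'=t_b^{\mathsf{Keep}}\oplus t_b\, t_{CW}^{\mathsf{Keep}}$ and $s_b$ by $s_b'$, where $(s_b',W_b)=\mathsf{Convert}_{\mathbb G_\ell}(s_b^{\mathsf{Keep}}\oplus t_b\, s_{CW})$; $W_{CW}=(-1)^{t_1'}[\beta_\ell-W_0+W_1]$;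 $CW^{(\ell)}=s_{CW}\|t_{CW}^L\|t_{CW}^R\|W_{CW}$. Output $(k_0,k_1,\mathsf{pp}=(CW^{(1)},\dots,CW^{(n)}))$; the values $\lambda,n,\mathbb G_1,\dots,\mathbb G_n$ are public. **EvalNext.** On input $b$, a state $s\|t$, $CW^{(\ell)}$ and a bit $x_\ell$: put $D=L$ if $x_\ell=0$ and $D=R$ otherwise; let $G(s)=s^L\|t^L\|s^R\|t^R$, $t'=t^D\oplus t\,t_{CW}^D$, $(s',W)=\mathsf{Convert}_{\mathbb G_\ell}(s^D\oplus t\,s_{CW})$; output the state $s'\|t'$ and the share $(-1)^b[W+t'W_{CW}]$. **EvalPrefix** starts in the state $k_b\|b$, applies EvalNext to $x_1,\dots,x_\ell$ and returns the last share. **Proposition.** This is a secure incremental DPF, that is: 1. (Efficiency) Gen is probabilistic polynomial time; EvalNext and EvalPrefix are polynomial time. 2. (Correctness) For all $\lambda$, all $(\alpha,(\mathbb G_1,\beta_1),\dots,(\mathbb G_n,\beta_n))$, all $1\le\ell\le n$ and all $x\in\{0,1\}^\ell$, with probability $1$ over Gen the output shares of the two servers on $x$ add up to $\beta_\ell$ if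 $x=(\alpha_1,\dots,\alpha_\ell)$ and to $0$ otherwise, both for the iteration of EvalNext and for EvalPrefix. 3. (Security) For each $b\in\{0,1\}$ there is a probabilistic polynomial-time simulator $\mathsf{Sim}_b$ such that for every sequence $(\alpha,(\mathbb G_1,\beta_1),\dots,(\mathbb G_n,\beta_n))_\lambda$ of polynomial size, the pair $(k_b,\mathsf{pp})$ produced by Gen is computationally indistinguishable (by non-uniform polynomial-time distinguishers) from $\mathsf{Sim}_b(1^\lambda,(n,\mathbb G_1,\dots,\mathbb G_n))$. Moreover: * each key $(k_b,\mathsf{pp})$ has exactly $\lambda+(\lambda+2)n+\sum_{j=1}^n\lceil\log_2|\mathbb G_j|\rceil$ bits (not counting the public values $\lambda,n,\mathbb G_1,\dots,\mathbb G_n$); * for $\lambda\ge1$, with $\mathsf{cost}(\ell)=1+\lceil(\log_2|\mathbb G_\ell|+\mathsf{slack}(\mathbb G_\ell))/\lambda\rceil$ (so $1+\lceil\log_2|\mathbb G_\ell|/\lambda\rceil$ if $|\mathbb G_\ell|$ is a power of two), Gen makes exactly $2\sum_{\ell=1}^n\mathsf{cost}(\ell)$ evaluations of $G$, and the evaluation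 of a prefix $x$ makes exactly $\sum_{\ell=1}^{|x|}\mathsf{cost}(\ell)$ evaluations of $G$. -/

import Mathlib

namespace IncDPF

/-! ### A machine model with a step count

Programs act on binary trees (S-expressions over the single atom `nil`). Executing an instruction on
an input `x` costs `1 + size x` on top of the cost of its sub-programs, so that copying data is paid
for, and the model is polynomially equivalent to Turing machines. -/

/-- Binary trees, the data of the machine model. -/
inductive Data : Type
  | nil : Data
  | cons : Data → Data → Data

namespace Data

/-- The number of nodes of a tree. -/
def size : Data → ℕ
  | nil => 1
  | cons a b => a.size + b.size + 1

/-- The left component (`nil` for `nil`). -/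
def fst : Data → Data
  | nil => nil
  | cons a _ => a

/-- The right component (`nil` for `nil`). -/
def snd : Data → Data
  | nil => nil
  | cons _ b => b

/-- The list `[a₁, …, a_k]` as the tree `cons a₁ (cons a₂ (… nil))`. -/
def list : List Data → Data
  | [] => nil
  | a :: l => cons a (list l)

/-- A bit: `nil` is false, `cons nil nil` is true. -/
def bool : Bool → Data
  | false => nil
  | true => cons nil nil

/-- A bit string. -/
def bits (l : List Bool) : Data := list (l.map bool)

/-- A natural number in unary, `1ᵏ`. -/
def unary (k : ℕ) : Data := bits (List.replicate k true)

/-- A natural number in binary, least significant bit first. -/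
def binary (k : ℕ) : Data := bits k.bits

end Data

/-- The programs of the machine model. -/
inductive Prog : Type
  | nil : Prog
  | id : Prog
  | fst : Prog
  | snd : Prog
  | pair : Prog → Prog → Prog
  | comp : Prog → Prog → Prog
  | ite : Prog → Prog → Prog → Prog
  | while : Prog → Prog → Prog

/-- `Runs p x y t`: program `p` started on input `x` halts with output `y` after `t` steps.
`comp q p` runs `p` first; `ite c p q` runs `p` if `c` returns something other than `nil`, and `q`
otherwise; `while c p` replaces its input `x` by the output of `p` on `x` as long as `c` does not
return `nil` on it. -/
inductive Runs : Prog → Data → Data → ℕ → Prop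
  | nil (x : Data) : Runs .nil x .nil (x.size + 1)
  | id (x : Data) : Runs .id x x (x.size + 1)
  | fst (x : Data) : Runs .fst x x.fst (x.size + 1)
  | snd (x : Data) : Runs .snd x x.snd (x.size + 1)
  | pair {p q : Prog} {x y z : Data} {t s : ℕ} (hp : Runs p x y t) (hq : Runs q x z s) :
      Runs (.pair p q) x (.cons y z) (t + s + x.size + 1)
  | comp {p q : Prog} {x y z : Data} {t s : ℕ} (hp : Runs p x y t) (hq : Runs q y z s) :
      Runs (.comp q p) x z (t + s + x.size + 1)
  | ite_true {c p q : Prog} {x a b y : Data} {t s : ℕ} (hc : Runs c x (.cons a b) t)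
      (hp : Runs p x y s) : Runs (.ite c p q) x y (t + s + x.size + 1)
  | ite_false {c p q : Prog} {x y : Data} {t s : ℕ} (hc : Runs c x .nil t)
      (hq : Runs q x y s) : Runs (.ite c p q) x y (t + s + x.size + 1)
  | while_stop {c p : Prog} {x : Data} {t : ℕ} (hc : Runs c x .nil t) :
      Runs (.while c p) x x (t + x.size + 1)
  | while_step {c p : Prog} {x a b y z : Data} {t s r : ℕ} (hc : Runs c x (.cons a b) t)
      (hp : Runs p x y s) (hw : Runs (.while c p) y z r) :
      Runs (.while c p) x z (t + s + r + x.size + 1)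

/-- `k`-bit strings. -/
abbrev Bits (k : ℕ) : Type := Fin k → Bool

/-- A `k`-bit string as machine data. -/
def Bits.enc {k : ℕ} (s : Bits k) : Data := Data.bits (List.ofFn s)

/-- The function that sends the input encoded by `inp a` to the output encoded by `out a`, for all
`a : A`, is computed by a program in time polynomial in the size of the input. -/
def PolyTime {A : Type} (inp out : A → Data) : Prop :=
  ∃ (p : Prog) (q : Polynomial ℕ), ∀ a : A,
    ∃ t : ℕ, t ≤ q.eval (inp a).size ∧ Runs p (inp a) (out a) t

/-- A probabilistic algorithm with output distribution `D a` on input `inp a` runs in polynomial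
time: it is a deterministic polynomial-time algorithm `f` that is given the input and a string of
`r a` independent uniform bits, where the number `r a` of coins can be computed (in unary) in
polynomial time. -/
def IsPPT {A : Type} {B : A → Type} (inp : A → Data) (enc : ∀ a, B a → Data)
    (D : ∀ a, PMF (B a)) : Prop :=
  ∃ (r : A → ℕ) (f : ∀ a, Bits (r a) → B a),
    PolyTime inp (fun a => Data.unary (r a)) ∧
    PolyTime (fun x : (Σ a, Bits (r a)) => Data.cons (inp x.1) x.2.enc)
      (fun x => enc x.1 (f x.1 x.2)) ∧
    ∀ a, D a = (PMF.uniformOfFintype (Bits (r a))).map (f a)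

/-- The family `D` of tests is computed by a non-uniform polynomial-time algorithm: a program with an
advice string of polynomial length for each value `κ` of the security parameter. -/
def NonuniformPolyTime {B : ℕ → Type} (enc : ∀ κ, B κ → Data) (D : ∀ κ, B κ → Bool) : Prop :=
  ∃ (p : Prog) (advice : ℕ → Data) (q : Polynomial ℕ), ∀ κ : ℕ,
    (advice κ).size ≤ q.eval κ ∧
    ∀ x : B κ, ∃ t : ℕ, t ≤ q.eval (κ + (enc κ x).size) ∧
      Runs p (Data.list [Data.unary κ, advice κ, enc κ x]) (Data.bool (D κ x)) t

/-- A negligible function: it tends to `0` faster than the inverse of every polynomial. -/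
def Negligible (ε : ℕ → ℝ) : Prop :=
  Asymptotics.SuperpolynomialDecay Filter.atTop (fun κ : ℕ => (κ : ℝ)) ε

/-- Computational indistinguishability of two families of distributions: every non-uniform
polynomial-time distinguisher has negligible advantage. -/
def CompIndist {B : ℕ → Type} (enc : ∀ κ, B κ → Data) (X Y : ∀ κ, PMF (B κ)) : Prop :=
  ∀ D : (∀ κ, B κ → Bool), NonuniformPolyTime enc D →
    Negligible fun κ =>
      |(((X κ).map (D κ)) true).toReal - (((Y κ).map (D κ)) true).toReal|

/-- `G : {0,1}^κ → {0,1}^(2κ+2)` is a pseudorandom generator: it is computable in polynomial time,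
and its output on a uniform seed is indistinguishable from a uniform string. -/
def IsPRG (G : ∀ κ, Bits κ → Bits (2 * κ + 2)) : Prop :=
  PolyTime (fun s : (Σ κ, Bits κ) => s.2.enc) (fun s => (G s.1 s.2).enc) ∧
  CompIndist (B := fun κ => Bits (2 * κ + 2)) (fun _ y => y.enc)
    (fun κ => (PMF.uniformOfFintype (Bits κ)).map (G κ))
    (fun κ => PMF.uniformOfFintype (Bits (2 * κ + 2)))

/-! ### Descriptions of groups and all-prefix point functions -/

/-- The `m` low-order bits of `v`, least significant bit first. -/
def lowBits (m v : ℕ) : List Bool := List.ofFn fun j : Fin m => v.testBit j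

/-- The natural number with the given binary digits, least significant bit first. -/
def ofBits : List Bool → ℕ
  | [] => 0
  | b :: l => b.toNat + 2 * ofBits l

/-- A system of descriptions of finite abelian groups. A description `d` stands for the group
`El d`, whose elements are numbered `0, …, |El d| - 1` and are represented by the
`⌈log₂ |El d|⌉`-bit binary expansion of their number; the order of the group and the group
operations are computable in polynomial time from the description. -/
structure GroupSystem where
  /-- the descriptions -/
  Desc : Type
  /-- a description as machine data -/
  encDesc : Desc → Data
  /-- the group that is described -/
  El : Desc → Type
  [group : ∀ d, AddCommGroup (El d)]
  [fintype : ∀ d, Fintype (El d)]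
  /-- the numbering of the elements -/
  index : ∀ d, El d ≃ Fin (Fintype.card (El d))
  order_polyTime : PolyTime encDesc (fun d => Data.binary (Fintype.card (El d)))
  add_polyTime : PolyTime
    (fun a : (Σ d, El d × El d) => Data.list [encDesc a.1,
      Data.bits (lowBits (Nat.clog 2 (Fintype.card (El a.1))) (index a.1 a.2.1)),
      Data.bits (lowBits (Nat.clog 2 (Fintype.card (El a.1))) (index a.1 a.2.2))])
    (fun a => Data.bits
      (lowBits (Nat.clog 2 (Fintype.card (El a.1))) (index a.1 (a.2.1 + a.2.2))))
  neg_polyTime : PolyTime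
    (fun a : (Σ d, El d) => Data.list [encDesc a.1,
      Data.bits (lowBits (Nat.clog 2 (Fintype.card (El a.1))) (index a.1 a.2))])
    (fun a => Data.bits (lowBits (Nat.clog 2 (Fintype.card (El a.1))) (index a.1 (-a.2))))

attribute [instance] GroupSystem.group GroupSystem.fintype

namespace GroupSystem

variable (Γ : GroupSystem)

/-- The order of the group described by `d`. -/
def order (d : Γ.Desc) : ℕ := Fintype.card (Γ.El d)

/-- The representation of a group element by `⌈log₂ |El d|⌉` bits. -/
def elBits {d : Γ.Desc} (x : Γ.El d) : List Bool :=
  lowBits (Nat.clog 2 (Γ.order d)) (Γ.index d x)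

theorem order_pos (d : Γ.Desc) : 0 < Γ.order d := Fintype.card_pos

/-- The group element with number `v mod |El d|`. -/
def elOfNat (d : Γ.Desc) (v : ℕ) : Γ.El d :=
  (Γ.index d).symm ⟨v % Γ.order d, Nat.mod_lt _ (Γ.order_pos d)⟩

end GroupSystem

/-- The public shape `(n, 𝔾₁, …, 𝔾ₙ)` of an all-prefix point function. -/
structure Shape (Γ : GroupSystem) where
  n : ℕ
  grp : Fin n → Γ.Desc

/-- An all-prefix point function `(α, (𝔾₁, β₁), …, (𝔾ₙ, βₙ))`. -/
structure PointFn (Γ : GroupSystem) extends Shape Γ where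
  α : Fin n → Bool
  β : ∀ ℓ, Γ.El (grp ℓ)

/-- The value of the all-prefix point function on the prefix `x`; levels are numbered from `0`, so
that the level `ℓ : Fin n` belongs to the prefixes of length `ℓ + 1`. -/
def PointFn.eval {Γ : GroupSystem} (F : PointFn Γ) (ℓ : Fin F.n) (x : Bits (ℓ + 1)) :
    Γ.El (F.grp ℓ) :=
  if ∀ j : Fin (ℓ + 1), x j = F.α (j.castLE ℓ.isLt) then F.β ℓ else 0

/-- The description `(𝔾₁, …, 𝔾ₙ)` as machine data. -/
def Shape.enc {Γ : GroupSystem} (S : Shape Γ) : Data :=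
  Data.list (List.ofFn fun ℓ => Γ.encDesc (S.grp ℓ))

/-- The description `(α, (𝔾₁, β₁), …, (𝔾ₙ, βₙ))` as machine data. -/
def PointFn.enc {Γ : GroupSystem} (F : PointFn Γ) : Data :=
  Data.list (List.ofFn fun ℓ =>
    Data.list [Data.bool (F.α ℓ), Γ.encDesc (F.grp ℓ), Data.bits (Γ.elBits (F.β ℓ))])

/-! ### Incremental distributed point functions -/

/-- The syntax of an incremental DPF. The public values `κ`, `n`, `𝔾₁, …, 𝔾ₙ` are passed along with
the public parameters. -/
structure Scheme (Γ : GroupSystem) where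
  /-- the private keys `k_b` -/
  Key : ℕ → Type
  /-- the states of the incremental evaluation -/
  State : ℕ → Type
  /-- the public parameters of one level -/
  PubParam : ℕ → Γ.Desc → Type
  gen : ∀ (κ : ℕ) (F : PointFn Γ), PMF (Key κ × Key κ × (∀ ℓ, PubParam κ (F.grp ℓ)))
  /-- the state of server `b` before the first bit -/
  init : ∀ (κ : ℕ), Bool → Key κ → State κ
  evalNext : ∀ (κ : ℕ), Bool → State κ → ∀ d : Γ.Desc, PubParam κ d → Bool → State κ × Γ.El d
  evalPrefix : ∀ (κ : ℕ), Bool → Key κ → ∀ S : Shape Γ, (∀ ℓ, PubParam κ (S.grp ℓ)) →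
    ∀ ℓ : Fin S.n, Bits (ℓ + 1) → Γ.El (S.grp ℓ)
  keyBits : ∀ {κ : ℕ}, Key κ → List Bool
  stateBits : ∀ {κ : ℕ}, State κ → List Bool
  ppBits : ∀ {κ : ℕ} {d : Γ.Desc}, PubParam κ d → List Bool
  keyBits_injective : ∀ κ, Function.Injective (keyBits (κ := κ))
  stateBits_injective : ∀ κ, Function.Injective (stateBits (κ := κ))
  ppBits_injective : ∀ κ d, Function.Injective (ppBits (κ := κ) (d := d))

namespace Scheme

variable {Γ : GroupSystem} (P : Scheme Γ)

/-- The part `(k_b, pp)` of the output of `gen` that server `b` receives. -/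
abbrev View (κ : ℕ) (S : Shape Γ) : Type := P.Key κ × (∀ ℓ, P.PubParam κ (S.grp ℓ))

/-- The key `(k_b, pp)` of a server as one bit string. -/
def viewBits {κ : ℕ} {S : Shape Γ} (v : P.View κ S) : List Bool :=
  P.keyBits v.1 ++ (List.ofFn fun ℓ => P.ppBits (v.2 ℓ)).flatten

/-- Public parameters as machine data, including the public values `κ`, `n`, `𝔾₁, …, 𝔾ₙ`. -/
def encPP {κ : ℕ} {S : Shape Γ} (pp : ∀ ℓ, P.PubParam κ (S.grp ℓ)) : Data :=
  Data.list [Data.unary κ, S.enc, Data.list (List.ofFn fun ℓ => Data.bits (P.ppBits (pp ℓ)))]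

/-- The key `(k_b, pp)` of a server as machine data. -/
def encView {κ : ℕ} {S : Shape Γ} (v : P.View κ S) : Data :=
  Data.cons (Data.bits (P.keyBits v.1)) (P.encPP v.2)

/-- `gen` is probabilistic polynomial time; `evalNext` and `evalPrefix` are polynomial time. -/
def IsEfficient : Prop :=
  IsPPT (A := ℕ × PointFn Γ)
    (B := fun a => P.Key a.1 × P.Key a.1 × (∀ ℓ, P.PubParam a.1 (a.2.grp ℓ)))
    (fun a => Data.list [Data.unary a.1, a.2.enc])
    (fun _ o => Data.list [Data.bits (P.keyBits o.1), Data.bits (P.keyBits o.2.1), P.encPP o.2.2])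
    (fun a => P.gen a.1 a.2) ∧
  PolyTime (A := Σ κ, Bool × P.State κ × (Σ d, P.PubParam κ d) × Bool)
    (fun a => Data.list [Data.unary a.1, Data.bool a.2.1, Data.bits (P.stateBits a.2.2.1),
      Γ.encDesc a.2.2.2.1.1, Data.bits (P.ppBits a.2.2.2.1.2), Data.bool a.2.2.2.2])
    (fun a =>
      let o := P.evalNext a.1 a.2.1 a.2.2.1 a.2.2.2.1.1 a.2.2.2.1.2 a.2.2.2.2
      Data.list [Data.bits (P.stateBits o.1), Data.bits (Γ.elBits o.2)]) ∧
  PolyTime (A := Σ (κ : ℕ) (S : Shape Γ), Bool × P.View κ S × (Σ ℓ : Fin S.n, Bits (ℓ + 1)))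
    (fun a => Data.list [Data.bool a.2.2.1, P.encView a.2.2.2.1, a.2.2.2.2.2.enc])
    (fun a => Data.bits (Γ.elBits
      (P.evalPrefix a.1 a.2.2.1 a.2.2.2.1.1 a.2.1 a.2.2.2.1.2 a.2.2.2.2.1 a.2.2.2.2.2)))

/-- The loop `(st_j, y_j) ← evalNext (b, st_(j-1), pp_j, x_j)`, started in the state `st` and run
through the levels `0, …, ℓ`; it returns the last output share. -/
def iterNext (κ : ℕ) (b : Bool) : ∀ (n : ℕ) (grp : Fin n → Γ.Desc)
    (_ : ∀ ℓ, P.PubParam κ (grp ℓ)) (_ : P.State κ) (ℓ : Fin n) (_ : Bits (ℓ + 1)), Γ.El (grp ℓ)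
  | _ + 1, grp, pp, st, ⟨0, h⟩, x => (P.evalNext κ b st (grp ⟨0, h⟩) (pp ⟨0, h⟩) (x 0)).2
  | n + 1, grp, pp, st, ⟨ℓ + 1, h⟩, x =>
      iterNext κ b n (fun j => grp j.succ) (fun j => pp j.succ)
        (P.evalNext κ b st (grp 0) (pp 0) (x 0)).1 ⟨ℓ, Nat.lt_of_succ_lt_succ h⟩
        (fun j => x j.succ)

/-- Correctness: with probability one the two output shares add up to the value of the function,
both for the iteration of `evalNext` and for `evalPrefix`. -/
def IsCorrect : Prop :=
  ∀ (κ : ℕ) (F : PointFn Γ) (ℓ : Fin F.n) (x : Bits (ℓ + 1)),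
    ∀ o ∈ (P.gen κ F).support,
      P.iterNext κ false F.n F.grp o.2.2 (P.init κ false o.1) ℓ x
        + P.iterNext κ true F.n F.grp o.2.2 (P.init κ true o.2.1) ℓ x = F.eval ℓ x ∧
      P.evalPrefix κ false o.1 F.toShape o.2.2 ℓ x
        + P.evalPrefix κ true o.2.1 F.toShape o.2.2 ℓ x = F.eval ℓ x

/-- The real experiment: run `gen` and output the key `k_b` together with `pp`. -/
noncomputable def real (b : Bool) (κ : ℕ) (F : PointFn Γ) : PMF (P.View κ F.toShape) :=
  (P.gen κ F).map fun o => (bif b then o.2.1 else o.1, o.2.2)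

/-- Security: for each `b` there is a probabilistic polynomial-time simulator, which is given only
`(1^κ, (𝔾₁, …, 𝔾ₙ))`, such that for every sequence of all-prefix point functions of polynomial size
its output is indistinguishable from `(k_b, pp)`. -/
def IsSecure : Prop :=
  ∀ b : Bool, ∃ Sim : (∀ a : ℕ × Shape Γ, PMF (P.View a.1 a.2)),
    IsPPT (fun a : ℕ × Shape Γ => Data.list [Data.unary a.1, a.2.enc]) (fun _ v => P.encView v)
      Sim ∧
    ∀ F : ℕ → PointFn Γ, (∃ q : Polynomial ℕ, ∀ κ, (F κ).enc.size ≤ q.eval κ) →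
      CompIndist (B := fun κ => P.View κ (F κ).toShape) (fun _ v => P.encView v)
        (fun κ => P.real b κ (F κ)) (fun κ => Sim (κ, (F κ).toShape))

/-- A secure incremental DPF. -/
def IsSecureIDPF : Prop := P.IsEfficient ∧ P.IsCorrect ∧ P.IsSecure

end Scheme

/-! ### Algorithms with calls to the generator -/

/-- Algorithms that return a value of type `A` and may evaluate the generator
`{0,1}^κ → {0,1}^(2κ+2)`. -/
inductive PRGComp (κ : ℕ) (A : Type) : Type
  | pure : A → PRGComp κ A
  | call : Bits κ → (Bits (2 * κ + 2) → PRGComp κ A) → PRGComp κ A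

namespace PRGComp

variable {κ : ℕ} {A B : Type}

/-- Sequential composition. -/
def bind : PRGComp κ A → (A → PRGComp κ B) → PRGComp κ B
  | pure a, f => f a
  | call s k, f => call s fun y => bind (k y) f

instance : Monad (PRGComp κ) where
  pure := PRGComp.pure
  bind := PRGComp.bind

/-- One evaluation of the generator. -/
def eval (s : Bits κ) : PRGComp κ (Bits (2 * κ + 2)) := call s pure

/-- The result of the algorithm when the generator is `G`. -/
def run (G : Bits κ → Bits (2 * κ + 2)) : PRGComp κ A → A
  | pure a => a
  | call s k => run G (k (G s))

/-- The number of evaluations of the generator when it is `G`. -/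
def calls (G : Bits κ → Bits (2 * κ + 2)) : PRGComp κ A → ℕ
  | pure _ => 0
  | call s k => calls G (k (G s)) + 1

end PRGComp

/-! ### The construction -/

section Construction

variable {κ : ℕ}

/-- Bitwise addition. -/
def xorBits (s s' : Bits κ) : Bits κ := fun j => s j ^^ s' j

/-- The product `t · s` of a bit and a bit string. -/
def smulBits (t : Bool) (s : Bits κ) : Bits κ := fun j => t && s j

/-- The seed parts `s^L` (side `false`) and `s^R` (side `true`) of `s^L ‖ t^L ‖ s^R ‖ t^R`. -/
def seedPart (side : Bool) (y : Bits (2 * κ + 2)) : Bits κ := fun j =>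
  bif side then y ⟨κ + 1 + j, by omega⟩ else y ⟨j, by omega⟩

/-- The control bits `t^L` (side `false`) and `t^R` (side `true`) of `s^L ‖ t^L ‖ s^R ‖ t^R`. -/
def bitPart (side : Bool) (y : Bits (2 * κ + 2)) : Bool :=
  bif side then y ⟨2 * κ + 1, by omega⟩ else y ⟨κ, by omega⟩

/-- Stretching a seed by `k` evaluations of the generator to `κ + k κ` bits: each evaluation
replaces the current seed by `s^L` and emits `s^R`. The result is the last seed followed by the `k`
emitted blocks. -/
def stretch : ℕ → Bits κ → PRGComp κ (Bits κ × List Bool)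
  | 0, s => pure (s, [])
  | k + 1, s => do
      let y ← PRGComp.eval s
      let r ← stretch k (seedPart false y)
      pure (r.1, List.ofFn (seedPart true y) ++ r.2)

/-- The number of excess bits used in the reduction modulo `u`: none if `u` is a power of two (then
the reduction just selects the first bits), and otherwise `σ`. -/
noncomputable def slack (σ u : ℕ) : ℕ :=
  open Classical in if ∃ m : ℕ, u = 2 ^ m then 0 else σ

/-- The number `⌈(⌈log₂ u⌉ + slack) / κ⌉` of evaluations of the generator that are needed to convert
a seed into a seed and an element of a group of order `u`. -/
noncomputable def convertCalls (κ σ u : ℕ) : ℕ := (Nat.clog 2 u + slack σ u + κ - 1) / κ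

variable (Γ : GroupSystem)

/-- `Convert` into `{0,1}^κ × 𝔾`, for the group `𝔾` described by `d`: stretch the seed, keep the
first `κ` bits, and reduce the number formed by the remaining bits modulo the order of `𝔾`. -/
noncomputable def convert (σ : ℕ) (d : Γ.Desc) (s : Bits κ) : PRGComp κ (Bits κ × Γ.El d) := do
  let r ← stretch (convertCalls κ σ (Γ.order d)) s
  pure (r.1, Γ.elOfNat d (ofBits r.2))

/-- Correction words `s_CW ‖ t^L_CW ‖ t^R_CW ‖ W_CW`. -/
structure CW (κ : ℕ) (d : Γ.Desc) where
  s : Bits κ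
  tL : Bool
  tR : Bool
  W : Γ.El d

/-- The bit string `s_CW ‖ t^L_CW ‖ t^R_CW ‖ W_CW`. -/
def CW.toBits {Γ : GroupSystem} {d : Γ.Desc} (c : CW Γ κ d) : List Bool :=
  List.ofFn c.s ++ c.tL :: c.tR :: Γ.elBits c.W

/-- The states `s ‖ t` of the evaluation. -/
structure EvalState (κ : ℕ) where
  s : Bits κ
  t : Bool

/-- The bit string `s ‖ t`. -/
def EvalState.toBits (st : EvalState κ) : List Bool := List.ofFn st.s ++ [st.t]

/-- One level of the key generation: from the states of the two servers, the bit `a = α_ℓ` and the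
value `β_ℓ`, compute the correction word and the new states. -/
noncomputable def genLevel (σ : ℕ) (d : Γ.Desc) (a : Bool) (β : Γ.El d) (st₀ st₁ : EvalState κ) :
    PRGComp κ (CW Γ κ d × EvalState κ × EvalState κ) := do
  let y₀ ← PRGComp.eval st₀.s
  let y₁ ← PRGComp.eval st₁.s
  let keep := a
  let lose := !a
  let sCW := xorBits (seedPart lose y₀) (seedPart lose y₁)
  let tLCW := bitPart false y₀ ^^ bitPart false y₁ ^^ a ^^ true
  let tRCW := bitPart true y₀ ^^ bitPart true y₁ ^^ a
  let tKeepCW := bif keep then tRCW else tLCW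
  let t₀ := bitPart keep y₀ ^^ (st₀.t && tKeepCW)
  let t₁ := bitPart keep y₁ ^^ (st₁.t && tKeepCW)
  let r₀ ← convert Γ σ d (xorBits (seedPart keep y₀) (smulBits st₀.t sCW))
  let r₁ ← convert Γ σ d (xorBits (seedPart keep y₁) (smulBits st₁.t sCW))
  let WCW := bif t₁ then -(β - r₀.2 + r₁.2) else β - r₀.2 + r₁.2
  pure (⟨sCW, tLCW, tRCW, WCW⟩, ⟨r₀.1, t₀⟩, ⟨r₁.1, t₁⟩)

/-- The loop of the key generation over all levels. -/
noncomputable def genLoop (σ : ℕ) : ∀ (n : ℕ) (grp : Fin n → Γ.Desc) (_ : Fin n → Bool)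
    (_ : ∀ ℓ, Γ.El (grp ℓ)) (_ _ : EvalState κ), PRGComp κ (∀ ℓ, CW Γ κ (grp ℓ))
  | 0, _, _, _, _, _ => pure fun ℓ => ℓ.elim0
  | n + 1, grp, α, β, st₀, st₁ => do
      let r ← genLevel Γ σ (grp 0) (α 0) (β 0) st₀ st₁
      let cws ← genLoop σ n (fun ℓ => grp ℓ.succ) (fun ℓ => α ℓ.succ) (fun ℓ => β ℓ.succ)
        r.2.1 r.2.2
      pure (Fin.cons (α := fun ℓ => CW Γ κ (grp ℓ)) r.1 cws)

/-- The key generation for the sampled seeds `s₀` and `s₁`. -/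
noncomputable def genAlg (σ : ℕ) (F : PointFn Γ) (s₀ s₁ : Bits κ) :
    PRGComp κ (Bits κ × Bits κ × (∀ ℓ, CW Γ κ (F.grp ℓ))) := do
  let cws ← genLoop Γ σ F.n F.grp F.α F.β ⟨s₀, false⟩ ⟨s₁, true⟩
  pure (s₀, s₁, cws)

/-- The incremental evaluation of one further bit `x`. -/
noncomputable def evalNextAlg (σ : ℕ) (b : Bool) (st : EvalState κ) (d : Γ.Desc) (c : CW Γ κ d)
    (x : Bool) : PRGComp κ (EvalState κ × Γ.El d) := do
  let y ← PRGComp.eval st.s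
  let s := xorBits (seedPart x y) (smulBits st.t c.s)
  let t := bitPart x y ^^ (st.t && bif x then c.tR else c.tL)
  let r ← convert Γ σ d s
  let W := bif t then r.2 + c.W else r.2
  pure (⟨r.1, t⟩, bif b then -W else W)

/-- The evaluation loop, started in the state `st` and run through the levels `0, …, ℓ`. -/
noncomputable def evalLoop (σ : ℕ) (b : Bool) : ∀ (n : ℕ) (grp : Fin n → Γ.Desc)
    (_ : ∀ ℓ, CW Γ κ (grp ℓ)) (_ : EvalState κ) (ℓ : Fin n) (_ : Bits (ℓ + 1)),
    PRGComp κ (Γ.El (grp ℓ))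
  | _ + 1, grp, pp, st, ⟨0, h⟩, x => do
      let r ← evalNextAlg Γ σ b st (grp ⟨0, h⟩) (pp ⟨0, h⟩) (x 0)
      pure r.2
  | n + 1, grp, pp, st, ⟨ℓ + 1, h⟩, x => do
      let r ← evalNextAlg Γ σ b st (grp 0) (pp 0) (x 0)
      evalLoop σ b n (fun j => grp j.succ) (fun j => pp j.succ) r.1
        ⟨ℓ, Nat.lt_of_succ_lt_succ h⟩ (fun j => x j.succ)

/-- The evaluation of a prefix. -/
noncomputable def evalPrefixAlg (σ : ℕ) (b : Bool) (k : Bits κ) (S : Shape Γ)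
    (pp : ∀ ℓ, CW Γ κ (S.grp ℓ)) (ℓ : Fin S.n) (x : Bits (ℓ + 1)) : PRGComp κ (Γ.El (S.grp ℓ)) :=
  evalLoop Γ σ b S.n S.grp pp ⟨k, b⟩ ℓ x

end Construction

theorem lowBits_injOn {m v w : ℕ} (hv : v < 2 ^ m) (hw : w < 2 ^ m)
    (h : lowBits m v = lowBits m w) : v = w := by
  refine Nat.eq_of_testBit_eq fun i => ?_
  by_cases hi : i < m
  · exact congrFun (List.ofFn_injective h) ⟨i, hi⟩
  · have hp : 2 ^ m ≤ 2 ^ i := Nat.pow_le_pow_right (by norm_num) (not_lt.mp hi)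
    rw [Nat.testBit_lt_two_pow (hv.trans_le hp), Nat.testBit_lt_two_pow (hw.trans_le hp)]

theorem elBits_injective (Γ : GroupSystem) (d : Γ.Desc) :
    Function.Injective (fun x : Γ.El d => Γ.elBits x) := by
  intro x y h
  have hlt : ∀ z : Γ.El d, (Γ.index d z : ℕ) < 2 ^ Nat.clog 2 (Γ.order d) := fun z =>
    (Γ.index d z).isLt.trans_le (Nat.le_pow_clog (by norm_num) _)
  exact (Γ.index d).injective (Fin.ext (lowBits_injOn (hlt x) (hlt y) h))

theorem CW.toBits_injective (Γ : GroupSystem) (κ : ℕ) (d : Γ.Desc) :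
    Function.Injective (fun c : CW Γ κ d => c.toBits) := by
  rintro ⟨s, l, r, W⟩ ⟨s', l', r', W'⟩ h
  obtain ⟨h₁, h₂⟩ := List.append_inj h (by simp)
  obtain ⟨rfl, h₃⟩ := List.cons.inj h₂
  obtain ⟨rfl, h₄⟩ := List.cons.inj h₃
  obtain rfl : s = s' := List.ofFn_injective h₁
  obtain rfl : W = W' := elBits_injective Γ d h₄
  rfl

theorem EvalState.toBits_injective (κ : ℕ) :
    Function.Injective (fun st : EvalState κ => st.toBits) := by
  rintro ⟨s, t⟩ ⟨s', t'⟩ h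
  obtain ⟨h₁, h₂⟩ := List.append_inj h (by simp)
  obtain rfl : s = s' := List.ofFn_injective h₁
  obtain ⟨rfl, _⟩ := List.cons.inj h₂
  rfl

/-- The incremental DPF built from the generator `G`, where `σ κ` excess bits are used for
reductions modulo numbers that are not powers of two. -/
noncomputable def idpf (Γ : GroupSystem) (σ : ℕ → ℕ) (G : ∀ κ, Bits κ → Bits (2 * κ + 2)) :
    Scheme Γ where
  Key κ := Bits κ
  State κ := EvalState κ
  PubParam κ d := CW Γ κ d
  gen κ F := (PMF.uniformOfFintype (Bits κ × Bits κ)).map fun s =>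
    (genAlg Γ (σ κ) F s.1 s.2).run (G κ)
  init _ b k := ⟨k, b⟩
  evalNext κ b st d c x := (evalNextAlg Γ (σ κ) b st d c x).run (G κ)
  evalPrefix κ b k S pp ℓ x := (evalPrefixAlg Γ (σ κ) b k S pp ℓ x).run (G κ)
  keyBits k := List.ofFn k
  stateBits st := st.toBits
  ppBits c := c.toBits
  keyBits_injective _ := List.ofFn_injective
  stateBits_injective κ := EvalState.toBits_injective κ
  ppBits_injective κ d := CW.toBits_injective Γ κ d

/-- The number `1 + ⌈log₂ |𝔾| / κ⌉` of evaluations of the generator per level, for a group of order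
`u = |𝔾|`; if `u` is not a power of two, then `log₂ |𝔾|` is increased by the `σ` excess bits. -/
noncomputable def cost (κ σ u : ℕ) : ℕ :=
  1 + ⌈(Real.logb 2 u + slack σ u) / κ⌉₊

end IncDPF

open IncDPF

/-! Correctness rests on an invariant. As long as the input follows `α`, the two servers hold
opposite control bits, so exactly one of them applies each correction. On the kept side the
corrected bits are opposite again (`nextBit_keep`), and `W_CW` is chosen such that the shares add up
to `β` (`evalNextAlg_keep`). On the other side the correction cancels the difference of the two
states (`nextBit_lose`, `nextSeed_lose`): they become equal and stay equal, and equal states yield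
opposite shares (`evalLoop_add_of_eq`). Induction over the levels gives `evalLoop_genLoop_add`.

For security, fix the key of server `b`; the seed of the other server is uniform and independent of
it. First the output of the generator on that seed is replaced by a uniform string. The seed
correction, the two bit corrections and the seed that the other server converts are a bijective
image of this string, hence uniform and independent (`expect_corrections`). Then the rounds of that
conversion are replaced one by one (`abs_expect_stretch_sub_le`), which leaves a uniform new seed
and independent uniform emitted bits. Reducing these bits modulo the group order costs at most
`2^(-σ)`, and nothing for powers of two (`abs_expect_elOfNat_sub_le`); since `W_CW` depends
bijectively on the resulting group element (`valueFor_bijective`), it is uniform as well. So a level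
may be given a uniform correction word, after which the new seed of the other server is again fresh,
and the next level starts in the same situation (`abs_levelFor_sub_le`,
`abs_genLoopFor_sub_idealExp_le`). The limiting average `idealExp` depends only on the shape, so
running the key generation on a fixed function of the same shape is a simulator.

The hybrid steps need one negligible bound that is valid for all levels, all rounds and all values
of the randomness held fixed. `IsPRG.exists_bound` supplies it: a nearly worst choice of these data
has polynomial size and can be given to the distinguisher as advice.

Efficiency is a calculus of closure properties of `PolyTime`; its core is `PolyTime.foldl`, a loop
over a list whose states stay polynomially bounded. The same calculus shows that the reductions are
efficient, because whatever follows the challenge string is an honest polynomial-time computation.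
Key lengths and numbers of generator calls follow by structural computation. -/

namespace IncDPF

open scoped BigOperators

/-! ### Closure properties of polynomial time -/

theorem Data.exists_eq_cons {x : Data} (h : x ≠ Data.nil) : ∃ a b, x = Data.cons a b := by
  cases x with
  | nil => exact absurd rfl h
  | cons a b => exact ⟨a, b, rfl⟩

theorem Data.size_fst_le (x : Data) : x.fst.size ≤ x.size := by
  cases x <;> simp only [Data.fst, Data.size] <;> omega

theorem Data.size_snd_le (x : Data) : x.snd.size ≤ x.size := by
  cases x <;> simp only [Data.snd, Data.size] <;> omega

/-- Every instruction pays for the size of its input, so no node of the output comes for free. In a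
composition this bounds the input of the second program. -/
theorem Runs.size_le {p : Prog} {x y : Data} {t : ℕ} (h : Runs p x y t) : y.size ≤ t := by
  induction h with
  | nil x => simp [Data.size]
  | id x => omega
  | fst x => have := x.size_fst_le; omega
  | snd x => have := x.size_snd_le; omega
  | pair _ _ h₁ h₂ => simp only [Data.size]; omega
  | _ => omega

theorem eval_mono (q : Polynomial ℕ) {a b : ℕ} (h : a ≤ b) : q.eval a ≤ q.eval b := by
  induction q using Polynomial.induction_on' with
  | add p q hp hq => simp only [Polynomial.eval_add]; omega
  | monomial n c => simp only [Polynomial.eval_monomial]; gcongr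

/-- `n a` is bounded by a polynomial in the size of the input `inp a`. -/
def PolyBdd {A : Type} (inp : A → Data) (n : A → ℕ) : Prop :=
  ∃ q : Polynomial ℕ, ∀ a, n a ≤ q.eval (inp a).size

namespace PolyBdd

variable {A B : Type} {inp : A → Data} {n m : A → ℕ}

theorem mono (h : PolyBdd inp m) (hle : ∀ a, n a ≤ m a) : PolyBdd inp n :=
  h.imp fun _ hq a => (hle a).trans (hq a)

theorem const (k : ℕ) : PolyBdd inp fun _ => k :=
  ⟨Polynomial.C k, fun _ => by simp⟩

theorem size : PolyBdd inp fun a => (inp a).size :=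
  ⟨Polynomial.X, fun _ => by simp⟩

theorem add (hn : PolyBdd inp n) (hm : PolyBdd inp m) : PolyBdd inp fun a => n a + m a := by
  obtain ⟨p, hp⟩ := hn
  obtain ⟨q, hq⟩ := hm
  exact ⟨p + q, fun a => by rw [Polynomial.eval_add]; exact Nat.add_le_add (hp a) (hq a)⟩

theorem mul (hn : PolyBdd inp n) (hm : PolyBdd inp m) : PolyBdd inp fun a => n a * m a := by
  obtain ⟨p, hp⟩ := hn
  obtain ⟨q, hq⟩ := hm
  exact ⟨p * q, fun a => by rw [Polynomial.eval_mul]; exact Nat.mul_le_mul (hp a) (hq a)⟩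

theorem poly (hn : PolyBdd inp n) (q : Polynomial ℕ) : PolyBdd inp fun a => q.eval (n a) := by
  obtain ⟨p, hp⟩ := hn
  exact ⟨q.comp p, fun a => by rw [Polynomial.eval_comp]; exact eval_mono q (hp a)⟩

end PolyBdd

/-- A round costs at most `T` for the test, `T` for the body, and `T + 1` for the size of the state
and the step itself. The extra round is the final, failing test. -/
theorem Runs.while_iterate {c p : Prog} (T : ℕ) : ∀ (n : ℕ) (x : ℕ → Data)
    (_ : ∀ i < n, ∃ a b t, t ≤ T ∧ Runs c (x i) (Data.cons a b) t)
    (_ : ∃ t ≤ T, Runs c (x n) Data.nil t)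
    (_ : ∀ i < n, ∃ t ≤ T, Runs p (x i) (x (i + 1)) t)
    (_ : ∀ i ≤ n, (x i).size ≤ T),
    ∃ t ≤ (n + 1) * (3 * T + 1), Runs (.while c p) (x 0) (x n) t
  | 0, x, _, ⟨t, ht, hs⟩, _, hsz => by
      have := hsz 0 le_rfl
      exact ⟨_, by omega, Runs.while_stop hs⟩
  | n + 1, x, hc, hs, hp, hsz => by
      obtain ⟨a, b, t₁, ht₁, h₁⟩ := hc 0 n.succ_pos
      obtain ⟨t₂, ht₂, h₂⟩ := hp 0 n.succ_pos
      obtain ⟨t₃, ht₃, h₃⟩ := while_iterate T n (fun i => x (i + 1))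
        (fun i hi => hc (i + 1) (by omega)) hs (fun i hi => hp (i + 1) (by omega))
        (fun i hi => hsz (i + 1) (by omega))
      have := hsz 0 (by omega)
      refine ⟨_, ?_, Runs.while_step h₁ h₂ h₃⟩
      have : (n + 1 + 1) * (3 * T + 1) = (n + 1) * (3 * T + 1) + (3 * T + 1) := by ring
      omega

namespace PolyTime

variable {A B : Type} {inp f g : A → Data}

theorem of_bdd {p : Prog} {n : A → ℕ} (hn : PolyBdd inp n)
    (h : ∀ a, ∃ t ≤ n a, Runs p (inp a) (f a) t) : PolyTime inp f := by
  obtain ⟨q, hq⟩ := hn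
  exact ⟨p, q, fun a => (h a).imp fun t ht => ⟨ht.1.trans (hq a), ht.2⟩⟩

/-- The running time as a function of the input. -/
theorem exists_time (h : PolyTime inp f) : ∃ (p : Prog) (n : A → ℕ), PolyBdd inp n ∧
    ∀ a, ∃ t ≤ n a, Runs p (inp a) (f a) t := by
  obtain ⟨p, q, h⟩ := h
  exact ⟨p, fun a => q.eval (inp a).size, ⟨q, fun _ => le_rfl⟩, h⟩

theorem bdd (h : PolyTime inp f) : PolyBdd inp fun a => (f a).size := by
  obtain ⟨p, n, hn, h⟩ := h.exists_time
  exact hn.mono fun a => let ⟨_, ht, hr⟩ := h a; hr.size_le.trans ht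

theorem congr (h : PolyTime inp f) (hfg : ∀ a, f a = g a) : PolyTime inp g :=
  (funext hfg : f = g) ▸ h

/-- The machine sees only encodings, so the same program works and `φ` need not be computable. This
permits pattern matching on the index type, such as taking the head of a list known to be nonempty.
-/
theorem reindex {inp' f' : B → Data} (h : PolyTime inp f) (φ : B → A)
    (h₁ : ∀ b, inp (φ b) = inp' b) (h₂ : ∀ b, f (φ b) = f' b) : PolyTime inp' f' := by
  obtain ⟨p, q, h⟩ := h
  refine ⟨p, q, fun b => ?_⟩
  rw [← h₁, ← h₂]
  exact h (φ b)

protected theorem id : PolyTime inp inp :=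
  of_bdd (p := .id) (PolyBdd.size.add (PolyBdd.const 1)) fun _ => ⟨_, le_rfl, Runs.id _⟩

theorem nil : PolyTime inp fun _ => Data.nil :=
  of_bdd (p := .nil) (PolyBdd.size.add (PolyBdd.const 1)) fun _ => ⟨_, le_rfl, Runs.nil _⟩

theorem cons (hf : PolyTime inp f) (hg : PolyTime inp g) :
    PolyTime inp fun a => Data.cons (f a) (g a) := by
  obtain ⟨p, n, hn, hp⟩ := hf.exists_time
  obtain ⟨q, m, hm, hq⟩ := hg.exists_time
  refine of_bdd (p := .pair p q) (((hn.add hm).add .size).add (.const 1)) fun a => ?_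
  obtain ⟨t, ht, h₁⟩ := hp a
  obtain ⟨s, hs, h₂⟩ := hq a
  exact ⟨_, by omega, Runs.pair h₁ h₂⟩

/-- Composition: `outB` is polynomial time on inputs `inpB b`, and `inpB (φ a)` can be computed. -/
theorem comp {inpB outB : B → Data} (h : PolyTime inpB outB) (φ : A → B)
    (hφ : PolyTime inp fun a => inpB (φ a)) : PolyTime inp fun a => outB (φ a) := by
  obtain ⟨q, m, ⟨r, hm⟩, hq⟩ := h.exists_time
  have hb := hφ.bdd
  obtain ⟨p, n, hn, hp⟩ := hφ.exists_time
  refine of_bdd (p := .comp q p) (((hn.add (hb.poly r)).add .size).add (.const 1)) fun a => ?_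
  obtain ⟨t, ht, h₁⟩ := hp a
  obtain ⟨s, hs, h₂⟩ := hq (φ a)
  have := hm (φ a)
  exact ⟨_, by omega, Runs.comp h₁ h₂⟩

theorem fst (hf : PolyTime inp f) : PolyTime inp fun a => (f a).fst := by
  have : PolyTime (fun x : Data => x) (fun x => x.fst) :=
    of_bdd (p := .fst) (PolyBdd.size.add (.const 1)) fun _ => ⟨_, le_rfl, Runs.fst _⟩
  exact this.comp f hf

theorem snd (hf : PolyTime inp f) : PolyTime inp fun a => (f a).snd := by
  have : PolyTime (fun x : Data => x) (fun x => x.snd) :=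
    of_bdd (p := .snd) (PolyBdd.size.add (.const 1)) fun _ => ⟨_, le_rfl, Runs.snd _⟩
  exact this.comp f hf

/-- Case distinction; each branch needs to be computable only in its case. -/
theorem cases {c : A → Data} (hc : PolyTime inp c)
    (h₁ : PolyTime (fun a : {a // c a ≠ Data.nil} => inp a) fun a => f a)
    (h₂ : PolyTime (fun a : {a // c a = Data.nil} => inp a) fun a => f a) : PolyTime inp f := by
  obtain ⟨r, k, hk, hr⟩ := hc.exists_time
  obtain ⟨p, q, hp⟩ := h₁
  obtain ⟨p', q', hp'⟩ := h₂
  have hs : PolyBdd inp fun a => (inp a).size := .size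
  refine of_bdd (p := .ite r p p') ((((hk.add (hs.poly q)).add (hs.poly q')).add hs).add
    (.const 1)) fun a => ?_
  obtain ⟨t, ht, hrun⟩ := hr a
  by_cases h : c a = Data.nil
  · obtain ⟨s, hs, h'⟩ := hp' ⟨a, h⟩
    rw [h] at hrun
    exact ⟨_, by simp only at hs ⊢; omega, Runs.ite_false hrun h'⟩
  · obtain ⟨s, hs, h'⟩ := hp ⟨a, h⟩
    obtain ⟨x, y, hxy⟩ := Data.exists_eq_cons h
    rw [hxy] at hrun
    exact ⟨_, by simp only at hs ⊢; omega, Runs.ite_true hrun h'⟩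

theorem restrict {P : A → Prop} (hf : PolyTime inp f) :
    PolyTime (fun a : {a // P a} => inp a) fun a => f a :=
  hf.reindex Subtype.val (fun _ => rfl) fun _ => rfl

theorem cond {c : A → Bool} (hc : PolyTime inp fun a => Data.bool (c a)) (hf : PolyTime inp f)
    (hg : PolyTime inp g) : PolyTime inp fun a => bif c a then f a else g a := by
  refine cases hc ((hf.restrict).congr ?_) ((hg.restrict).congr ?_)
  · rintro ⟨a, h⟩
    cases hca : c a
    · simp [hca, Data.bool] at h
    · simp
  · rintro ⟨a, h⟩
    cases hca : c a
    · simp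
    · simp [hca, Data.bool] at h

/-- The length of a loop and the sizes of its states have to be bounded by polynomials. -/
theorem while_loop {inpB c : B → Data} {step : B → B} (hc : PolyTime inpB c)
    (hstep : PolyTime (fun b : {b // c b ≠ Data.nil} => inpB b) fun b => inpB (step b))
    {φ : A → B} (hφ : PolyTime inp fun a => inpB (φ a)) {n : A → ℕ} (hn : PolyBdd inp n)
    (hlt : ∀ a, ∀ i < n a, c (step^[i] (φ a)) ≠ Data.nil)
    (h_halt : ∀ a, c (step^[n a] (φ a)) = Data.nil) {m : A → ℕ} (hm : PolyBdd inp m)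
    (hsize : ∀ a, ∀ i ≤ n a, (inpB (step^[i] (φ a))).size ≤ m a) :
    PolyTime inp fun a => inpB (step^[n a] (φ a)) := by
  obtain ⟨r, u, hr⟩ := hc
  obtain ⟨p, v, hp⟩ := hstep
  obtain ⟨w, k, hk, hw⟩ := hφ.exists_time
  have hT : PolyBdd inp fun a => u.eval (m a) + v.eval (m a) + m a :=
    ((hm.poly u).add (hm.poly v)).add hm
  refine of_bdd (p := .comp (.while r p) w)
    (((hk.add ((hn.add (.const 1)).mul (((PolyBdd.const 3).mul hT).add (.const 1)))).add .size).add
      (.const 1)) fun a => ?_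
  obtain ⟨t, ht, h₁⟩ := hw a
  obtain ⟨s, hs, h₂⟩ := Runs.while_iterate (c := r) (p := p)
    (u.eval (m a) + v.eval (m a) + m a) (n a) (fun i => inpB (step^[i] (φ a)))
    (fun i hi => by
      obtain ⟨x, y, hxy⟩ := Data.exists_eq_cons (hlt a i hi)
      obtain ⟨t, ht, h⟩ := hr (step^[i] (φ a))
      have := eval_mono u (hsize a i hi.le)
      exact ⟨x, y, t, by omega, hxy ▸ h⟩)
    (by
      obtain ⟨t, ht, h⟩ := hr (step^[n a] (φ a))
      have := eval_mono u (hsize a _ le_rfl)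
      exact ⟨t, by omega, h_halt a ▸ h⟩)
    (fun i hi => by
      obtain ⟨t, ht, h⟩ := hp ⟨step^[i] (φ a), hlt a i hi⟩
      have := eval_mono v (hsize a i hi.le)
      rw [Function.iterate_succ_apply']
      exact ⟨t, by simp only at ht; omega, h⟩)
    (fun i hi => (hsize a i hi).trans (by omega))
  exact ⟨_, by omega, Runs.comp h₁ h₂⟩

/-- The loop state consists of the input, the accumulator and the list still to be processed, whose
emptiness ends the loop. An efficient step alone does not suffice, since iterating it may blow up
the accumulator; hence the bound `hsize` over all prefixes. The types may depend on `a`, so that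
invariants can be built into the accumulator. -/
theorem foldl {S E : A → Type} {encS : ∀ a, S a → Data} {encE : ∀ a, E a → Data}
    {step : ∀ a, S a → E a → S a}
    (hstep : PolyTime (fun x : (Σ a, S a × E a) =>
        Data.cons (inp x.1) (Data.cons (encS x.1 x.2.1) (encE x.1 x.2.2)))
      fun x => encS x.1 (step x.1 x.2.1 x.2.2))
    {l : ∀ a, List (E a)} (hl : PolyTime inp fun a => Data.list ((l a).map (encE a)))
    {s : ∀ a, S a} (hs : PolyTime inp fun a => encS a (s a)) {m : A → ℕ} (hm : PolyBdd inp m)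
    (hsize : ∀ a l', l' <+: l a → (encS a (l'.foldl (step a) (s a))).size ≤ m a) :
    PolyTime inp fun a => encS a ((l a).foldl (step a) (s a)) := by
  let B : Type := Σ a, S a × List (E a)
  let inpB : B → Data := fun b => Data.cons (inp b.1)
    (Data.cons (encS b.1 b.2.1) (Data.list (b.2.2.map (encE b.1))))
  let next : B → B := fun b => match b with
    | ⟨a, s, []⟩ => ⟨a, s, []⟩
    | ⟨a, s, e :: l⟩ => ⟨a, step a s e, l⟩
  have hid : PolyTime inpB inpB := .id
  have hnext : PolyTime (fun b : {b : B // Data.list (b.2.2.map (encE b.1)) ≠ Data.nil} => inpB b)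
      fun b => inpB (next b) := by
    have h : PolyTime (fun x : (Σ a, S a × E a × List (E a)) =>
        inpB ⟨x.1, x.2.1, x.2.2.1 :: x.2.2.2⟩)
        fun x => inpB ⟨x.1, step x.1 x.2.1 x.2.2.1, x.2.2.2⟩ := by
      have hi : PolyTime (fun x : (Σ a, S a × E a × List (E a)) =>
        inpB ⟨x.1, x.2.1, x.2.2.1 :: x.2.2.2⟩) (fun x =>
        inpB ⟨x.1, x.2.1, x.2.2.1 :: x.2.2.2⟩) := .id
      exact hi.fst.cons (((hstep.comp (fun x => ⟨x.1, x.2.1, x.2.2.1⟩)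
        (hi.fst.cons (hi.snd.fst.cons hi.snd.snd.fst)))).cons hi.snd.snd.snd)
    refine h.reindex (fun b => ⟨b.1.1, b.1.2.1, b.1.2.2.head ?_, b.1.2.2.tail⟩) ?_ ?_
    · intro h
      exact b.2 (by rw [h]; rfl)
    · rintro ⟨⟨a, s, l⟩, h⟩
      cases l with
      | nil => exact absurd rfl h
      | cons e l => rfl
    · rintro ⟨⟨a, s, l⟩, h⟩
      cases l with
      | nil => exact absurd rfl h
      | cons e l => rfl
  -- After `i` rounds the accumulator has absorbed the first `i` entries, which form the prefix to
  -- which `hsize` is applied below.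
  have hiter : ∀ (a : A) (i : ℕ) (s : S a) (l : List (E a)),
      next^[i] ⟨a, s, l⟩ = ⟨a, (l.take i).foldl (step a) s, l.drop i⟩ := by
    intro a i
    induction i with
    | zero => intro s l; simp
    | succ i ih =>
      intro s l
      rw [Function.iterate_succ_apply]
      cases l with
      | nil => exact (ih s []).trans (by simp)
      | cons e l => exact (ih _ l).trans (by simp)
  have hlen : ∀ L : List Data, L.length ≤ (Data.list L).size := by
    intro L
    induction L with
    | nil => simp
    | cons x L ih => simp only [Data.list, Data.size, List.length_cons]; omega
  have hdrop : ∀ (L : List Data) (i : ℕ), (Data.list (L.drop i)).size ≤ (Data.list L).size := by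
    intro L
    induction L with
    | nil => simp
    | cons x L ih =>
      intro i
      cases i with
      | zero => simp
      | succ i =>
        have := ih i
        simp only [Data.list, Data.size, List.drop_succ_cons]
        omega
  have := while_loop (inp := inp) (inpB := inpB) (c := fun b => Data.list (b.2.2.map (encE b.1)))
    (step := next) hid.snd.snd hnext (φ := fun a => ⟨a, s a, l a⟩)
    (PolyTime.id.cons (hs.cons hl)) (n := fun a => (l a).length)
    (hl.bdd.mono fun a => by simpa using hlen ((l a).map (encE a)))
    (fun a i hi => by
      rw [hiter]
      simp only [ne_eq, List.map_drop]
      rw [List.drop_eq_getElem_cons (by simpa using hi)]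
      simp [Data.list])
    (fun a => by rw [hiter]; simp [Data.list])
    (m := fun a => (inp a).size + (m a + (Data.list ((l a).map (encE a))).size + 1) + 1)
    ((PolyBdd.size.add ((hm.add hl.bdd).add (.const 1))).add (.const 1))
    (fun a i hi => by
      rw [hiter]
      have h₁ := hsize a ((l a).take i) (List.take_prefix _ _)
      have h₂ := hdrop ((l a).map (encE a)) i
      rw [← List.map_drop] at h₂
      simp only [inpB, Data.size]
      omega)
  refine (this.snd.fst).congr fun a => ?_
  rw [hiter]
  simp [inpB, Data.fst, Data.snd]

end PolyTime

/-! ### List operations in polynomial time -/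

namespace Data

@[simp] theorem list_nil : list [] = nil := rfl

@[simp] theorem list_cons (x : Data) (L : List Data) : list (x :: L) = cons x (list L) := rfl

@[simp] theorem size_list_cons (x : Data) (L : List Data) :
    (list (x :: L)).size = x.size + (list L).size + 1 := rfl

@[simp] theorem size_nil : nil.size = 1 := rfl

@[simp] theorem size_cons (x y : Data) : (cons x y).size = x.size + y.size + 1 := rfl

theorem list_eq_nil {L : List Data} : list L = nil ↔ L = [] := by
  cases L <;> simp

theorem size_list_append (L M : List Data) :
    (list (L ++ M)).size + 1 = (list L).size + (list M).size := by
  induction L with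
  | nil => simp; omega
  | cons x L ih => simp only [List.cons_append, size_list_cons]; omega

theorem size_list_reverse (L : List Data) : (list L.reverse).size = (list L).size := by
  induction L with
  | nil => rfl
  | cons x L ih =>
    have := size_list_append L.reverse [x]
    simp only [List.reverse_cons, size_list_cons, list_nil, size_nil] at this ⊢
    omega

theorem size_lt_of_mem {x : Data} {L : List Data} (h : x ∈ L) : x.size < (list L).size := by
  induction L with
  | nil => cases h
  | cons y L ih =>
    rcases List.mem_cons.1 h with rfl | h
    · simp only [size_list_cons]; omega
    · have := ih h; simp only [size_list_cons]; omega

theorem length_le_size_list (L : List Data) : L.length ≤ (list L).size := by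
  induction L with
  | nil => simp
  | cons x L ih => simp only [size_list_cons, List.length_cons]; omega

theorem size_list_le {L : List Data} {k : ℕ} (h : ∀ x ∈ L, x.size ≤ k) :
    (list L).size ≤ L.length * (k + 1) + 1 := by
  induction L with
  | nil => simp
  | cons x L ih =>
    have h₁ := h x (by simp)
    have h₂ := ih fun y hy => h y (by simp [hy])
    simp only [size_list_cons, List.length_cons, Nat.add_mul]
    omega

theorem size_list_sublist {L M : List Data} (h : L.Sublist M) :
    (list L).size ≤ (list M).size := by
  induction h with
  | slnil => simp
  | cons x _ ih => simp only [size_list_cons]; omega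
  | cons_cons x _ ih => simp only [size_list_cons]; omega

theorem size_bool_le (b : Bool) : (bool b).size ≤ 3 := by
  cases b <;> simp [bool]

theorem size_bits_le (l : List Bool) : (bits l).size ≤ 4 * l.length + 1 := by
  refine (size_list_le (k := 3) fun x hx => ?_).trans (by simp; omega)
  obtain ⟨b, _, rfl⟩ := List.mem_map.1 hx
  exact size_bool_le b

theorem length_le_size_bits (l : List Bool) : l.length ≤ (bits l).size := by
  have := length_le_size_list (l.map bool)
  rwa [List.length_map] at this

theorem unary_eq_list (k : ℕ) : unary k = list (List.replicate k (bool true)) := by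
  simp [unary, bits]

end Data

namespace PolyTime

variable {A B : Type} {inp : A → Data} {L M : A → List Data}

theorem const (d : Data) : PolyTime inp fun _ => d := by
  induction d with
  | nil => exact nil
  | cons x y hx hy => exact hx.cons hy

theorem reverse (h : PolyTime inp fun a => Data.list (L a)) :
    PolyTime inp fun a => Data.list (L a).reverse := by
  have := foldl (inp := inp) (S := fun _ => List Data) (E := fun _ => Data)
    (encS := fun _ => Data.list) (encE := fun _ x => x) (step := fun _ s x => x :: s)
    (PolyTime.id.snd.snd.cons PolyTime.id.snd.fst) (l := L) (by simpa using h) (s := fun _ => [])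
    nil h.bdd (fun a l' hl => by
      rw [List.foldl_flip_cons_eq_append', List.append_nil, Data.size_list_reverse]
      exact Data.size_list_sublist hl.sublist)
  simpa using this

theorem append (hL : PolyTime inp fun a => Data.list (L a))
    (hM : PolyTime inp fun a => Data.list (M a)) :
    PolyTime inp fun a => Data.list (L a ++ M a) := by
  have := foldl (inp := inp) (S := fun _ => List Data) (E := fun _ => Data)
    (encS := fun _ => Data.list) (encE := fun _ x => x) (step := fun _ s x => x :: s)
    (PolyTime.id.snd.snd.cons PolyTime.id.snd.fst) (l := fun a => (L a).reverse)
    (by simpa using hL.reverse) (s := M) hM (hL.bdd.add hM.bdd) (fun a l' hl => by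
      rw [List.foldl_flip_cons_eq_append']
      have h₁ := Data.size_list_append l'.reverse (M a)
      have h₂ := Data.size_list_sublist hl.sublist
      rw [Data.size_list_reverse] at h₁ h₂
      omega)
  simpa using this

/-- The outputs are collected in reverse order and reversed at the end. Each entry is smaller than
the encoded list, so one polynomial bounds every output, and the accumulator is at most the length
of the list times that bound. -/
theorem map {E : A → Type} {encE f : ∀ a, E a → Data}
    (hf : PolyTime (fun x : (Σ a, E a) => Data.cons (inp x.1) (encE x.1 x.2)) fun x => f x.1 x.2)
    {l : ∀ a, List (E a)} (hl : PolyTime inp fun a => Data.list ((l a).map (encE a))) :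
    PolyTime inp fun a => Data.list ((l a).map (f a)) := by
  obtain ⟨q, hq⟩ := hf.bdd
  have hi : PolyTime (fun x : (Σ a, List Data × E a) => Data.cons (inp x.1)
    (Data.cons (Data.list x.2.1) (encE x.1 x.2.2))) (fun x => Data.cons (inp x.1)
    (Data.cons (Data.list x.2.1) (encE x.1 x.2.2))) := .id
  have hf' : PolyTime (fun x : (Σ a, List Data × E a) => Data.cons (inp x.1)
      (Data.cons (Data.list x.2.1) (encE x.1 x.2.2))) fun x => f x.1 x.2.2 :=
    hf.comp (fun x : (Σ a, List Data × E a) => (⟨x.1, x.2.2⟩ : Σ a, E a)) (hi.fst.cons hi.snd.snd)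
  have := foldl (inp := inp) (S := fun _ => List Data) (E := E)
    (encS := fun _ => Data.list) (encE := encE) (step := fun a s e => f a e :: s)
    (hf'.cons hi.snd.fst)
    hl (s := fun _ => []) nil
    (m := fun a => (Data.list ((l a).map (encE a))).size *
      (q.eval ((inp a).size + (Data.list ((l a).map (encE a))).size + 1) + 1) + 1)
    ((hl.bdd.mul ((((PolyBdd.size.add hl.bdd).add (.const 1)).poly q).add (.const 1))).add
      (.const 1))
    (fun a l' hl' => by
      have hfold : ∀ (l' : List (E a)) (s : List Data), l'.foldl (fun s e => f a e :: s) s =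
          (l'.map (f a)).reverse ++ s := by
        intro l'
        induction l' with
        | nil => simp
        | cons e l ih => intro s; simp [ih]
      rw [hfold, List.append_nil, Data.size_list_reverse]
      refine (Data.size_list_le (k := q.eval ((inp a).size +
        (Data.list ((l a).map (encE a))).size + 1)) fun x hx => ?_).trans ?_
      · obtain ⟨e, he, rfl⟩ := List.mem_map.1 hx
        refine (hq ⟨a, e⟩).trans (eval_mono q ?_)
        have := Data.size_lt_of_mem (List.mem_map_of_mem (f := encE a) (hl'.subset he))
        simp only [Data.size_cons]
        omega
      · gcongr
        rw [List.length_map]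
        refine hl'.length_le.trans ?_
        simpa using Data.length_le_size_list ((l a).map (encE a)))
  refine this.reverse.congr fun a => ?_
  have hfold : ∀ (l' : List (E a)) (s : List Data), l'.foldl (fun s e => f a e :: s) s =
      (l'.map (f a)).reverse ++ s := by
    intro l'
    induction l' with
    | nil => simp
    | cons e l ih => intro s; simp [ih]
  simp [hfold]

theorem map_data {f : Data → Data} (hf : PolyTime (fun x => x) f)
    (h : PolyTime inp fun a => Data.list (L a)) :
    PolyTime inp fun a => Data.list ((L a).map f) :=
  map (E := fun _ => Data) (encE := fun _ x => x) (f := fun _ => f)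
    (hf.comp (fun x : (Σ _ : A, Data) => x.2) PolyTime.id.snd) (by simpa using h)

theorem isEmpty (h : PolyTime inp fun a => Data.list (L a)) :
    PolyTime inp fun a => Data.bool (L a).isEmpty := by
  refine cases h ((const (Data.bool false)).congr ?_) ((const (Data.bool true)).congr ?_)
  · rintro ⟨a, h⟩
    cases hL : L a with
    | nil => simp [hL] at h
    | cons => simp
  · rintro ⟨a, h⟩
    simp [Data.list_eq_nil.1 h]

/-- The fold runs over the first list and carries the unread part of the second one in its state;
once that part is empty, the remaining entries are skipped. -/
theorem zip (hL : PolyTime inp fun a => Data.list (L a))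
    (hM : PolyTime inp fun a => Data.list (M a)) :
    PolyTime inp fun a => Data.list (List.zipWith Data.cons (L a) (M a)) := by
  let step : List Data × List Data → Data → List Data × List Data := fun s x =>
    match s with
    | (acc, []) => (acc, [])
    | (acc, m :: M) => (Data.cons x m :: acc, M)
  let enc : List Data × List Data → Data := fun s => Data.cons (Data.list s.1) (Data.list s.2)
  have hfold : ∀ l m acc, l.foldl step (acc, m) =
      ((List.zipWith Data.cons l m).reverse ++ acc, m.drop l.length) := by
    intro l
    induction l with
    | nil => simp
    | cons x l ih =>
      intro m acc
      cases m with
      | nil => simp only [List.foldl_cons, step]; rw [ih]; simp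
      | cons y m => simp only [List.foldl_cons, step]; rw [ih]; simp
  let inp' : (Σ _ : A, (List Data × List Data) × Data) → Data :=
    fun x => Data.cons (inp x.1) (Data.cons (enc x.2.1) x.2.2)
  have hi : PolyTime inp' inp' := .id
  have hstep : PolyTime inp' fun x => enc (step x.2.1 x.2.2) := by
    refine cases (c := fun x => Data.list x.2.1.2) hi.snd.fst.snd
      ((((hi.snd.snd.cons hi.snd.fst.snd.fst).cons hi.snd.fst.fst).cons
        hi.snd.fst.snd.snd).restrict.congr ?_) (hi.snd.fst.restrict.congr ?_)
    · rintro ⟨⟨a, ⟨acc, m⟩, x⟩, h⟩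
      cases m with
      | nil => exact absurd rfl h
      | cons y m => rfl
    · rintro ⟨⟨a, ⟨acc, m⟩, x⟩, h⟩
      cases m with
      | nil => rfl
      | cons y m => cases h
  have hz : ∀ l m : List Data, (Data.list (List.zipWith Data.cons l m)).size ≤
      (Data.list l).size + (Data.list m).size := by
    intro l
    induction l with
    | nil => simp
    | cons x l ih =>
      intro m
      cases m with
      | nil => simp
      | cons y m =>
        have := ih m
        simp only [List.zipWith_cons_cons, Data.size_list_cons, Data.size_cons]
        omega
  have := foldl (inp := inp) (S := fun _ => List Data × List Data) (E := fun _ => Data)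
    (encS := fun _ => enc) (encE := fun _ x => x) (step := fun _ => step) hstep (l := L)
    (by simpa using hL) (s := fun a => ([], M a)) (nil.cons hM)
    (m := fun a => (Data.list (L a)).size + 2 * (Data.list (M a)).size + 1)
    ((hL.bdd.add ((PolyBdd.const 2).mul hM.bdd)).add (.const 1)) (fun a l' hl => by
      rw [hfold]
      have h₁ := hz l' (M a)
      have h₂ := Data.size_list_sublist (List.drop_sublist l'.length (M a))
      have h₃ := Data.size_list_sublist hl.sublist
      simp only [enc, Data.size_cons, List.append_nil, Data.size_list_reverse]
      omega)
  refine this.fst.reverse.congr fun a => ?_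
  rw [hfold]
  simp

/-- Dropping as many elements from `L a` as the list `M a` has. -/
theorem drop (hL : PolyTime inp fun a => Data.list (L a))
    (hM : PolyTime inp fun a => Data.list (M a)) :
    PolyTime inp fun a => Data.list ((L a).drop (M a).length) := by
  have hfold : ∀ m l : List Data, m.foldl (fun s _ => s.tail) l = l.drop m.length := by
    intro m
    induction m with
    | nil => simp
    | cons x m ih => intro l; simp [ih, List.drop_tail]
  have := foldl (inp := inp) (S := fun _ => List Data) (E := fun _ => Data)
    (encS := fun _ => Data.list) (encE := fun _ x => x) (step := fun _ s _ => s.tail)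
    (PolyTime.id.snd.fst.snd.congr fun x => by rcases x with ⟨a, _ | ⟨y, l⟩, x⟩ <;> rfl)
    (l := M) (by simpa using hM) (s := L) hL hL.bdd (fun a l' _ => by
      rw [hfold]
      exact Data.size_list_sublist (List.drop_sublist _ _))
  exact this.congr fun a => by rw [hfold]

/-- Taking as many elements from `L a` as the list `M a` has. -/
theorem take (hL : PolyTime inp fun a => Data.list (L a))
    (hM : PolyTime inp fun a => Data.list (M a)) :
    PolyTime inp fun a => Data.list ((L a).take (M a).length) := by
  -- Zipping with `M a` cuts `L a` to the right length; the first components give back its entries.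
  refine (map_data PolyTime.id.fst (hL.zip hM)).congr fun a => ?_
  congr 1
  generalize M a = m
  induction L a generalizing m with
  | nil => simp
  | cons x l ih =>
    cases m with
    | nil => simp
    | cons y m => simpa [Data.fst] using ih m

/-! ### Bits and unary numbers -/

theorem not {c : A → Bool} (h : PolyTime inp fun a => Data.bool (c a)) :
    PolyTime inp fun a => Data.bool (!c a) :=
  (h.cond (const (Data.bool false)) (const (Data.bool true))).congr fun a => by cases c a <;> rfl

theorem and {c d : A → Bool} (hc : PolyTime inp fun a => Data.bool (c a))
    (hd : PolyTime inp fun a => Data.bool (d a)) : PolyTime inp fun a => Data.bool (c a && d a) :=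
  (hc.cond hd (const (Data.bool false))).congr fun a => by cases c a <;> rfl

theorem or {c d : A → Bool} (hc : PolyTime inp fun a => Data.bool (c a))
    (hd : PolyTime inp fun a => Data.bool (d a)) : PolyTime inp fun a => Data.bool (c a || d a) :=
  (hc.cond (const (Data.bool true)) hd).congr fun a => by cases c a <;> rfl

theorem xor {c d : A → Bool} (hc : PolyTime inp fun a => Data.bool (c a))
    (hd : PolyTime inp fun a => Data.bool (d a)) : PolyTime inp fun a => Data.bool (c a ^^ d a) :=
  (hc.cond hd.not hd).congr fun a => by cases c a <;> simp

variable {l m : A → List Bool} {k n : A → ℕ}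

theorem bits_append (hl : PolyTime inp fun a => Data.bits (l a))
    (hm : PolyTime inp fun a => Data.bits (m a)) : PolyTime inp fun a => Data.bits (l a ++ m a) :=
  (PolyTime.append hl hm).congr fun a => by simp [Data.bits]

theorem bits_cons {c : A → Bool} (hc : PolyTime inp fun a => Data.bool (c a))
    (hl : PolyTime inp fun a => Data.bits (l a)) : PolyTime inp fun a => Data.bits (c a :: l a) :=
  hc.cons hl

theorem bits_reverse (hl : PolyTime inp fun a => Data.bits (l a)) :
    PolyTime inp fun a => Data.bits (l a).reverse :=
  (PolyTime.reverse hl).congr fun a => by simp [Data.bits]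

theorem bits_take (hl : PolyTime inp fun a => Data.bits (l a))
    (hk : PolyTime inp fun a => Data.unary (k a)) :
    PolyTime inp fun a => Data.bits ((l a).take (k a)) :=
  (PolyTime.take hl hk).congr fun a => by simp [Data.bits]

theorem bits_drop (hl : PolyTime inp fun a => Data.bits (l a))
    (hk : PolyTime inp fun a => Data.unary (k a)) :
    PolyTime inp fun a => Data.bits ((l a).drop (k a)) :=
  (PolyTime.drop hl hk).congr fun a => by simp [Data.bits]

/-- On an empty list the machine would return `nil`, that is `false`, whatever the default `b` is;
nonemptiness makes the default irrelevant. -/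
theorem bits_head {b : Bool} (hl : PolyTime inp fun a => Data.bits (l a)) (h : ∀ a, l a ≠ []) :
    PolyTime inp fun a => Data.bool ((l a).headD b) :=
  hl.fst.congr fun a => by
    cases hla : l a with
    | nil => exact absurd hla (h a)
    | cons => rfl

theorem bits_length_bdd (hl : PolyTime inp fun a => Data.bits (l a)) :
    PolyBdd inp fun a => (l a).length :=
  hl.bdd.mono fun _ => Data.length_le_size_bits _

theorem unary_bdd (hk : PolyTime inp fun a => Data.unary (k a)) : PolyBdd inp k :=
  (bits_length_bdd hk).mono fun a => by simp

theorem unary_length (hL : PolyTime inp fun a => Data.list (L a)) :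
    PolyTime inp fun a => Data.unary (L a).length :=
  (map_data (const (Data.bool true)) hL).congr fun a => by simp [Data.unary_eq_list]

theorem unary_bits_length (hl : PolyTime inp fun a => Data.bits (l a)) :
    PolyTime inp fun a => Data.unary (l a).length :=
  (unary_length hl).congr fun a => by simp

theorem unary_add (hk : PolyTime inp fun a => Data.unary (k a))
    (hn : PolyTime inp fun a => Data.unary (n a)) :
    PolyTime inp fun a => Data.unary (k a + n a) :=
  (bits_append hk hn).congr fun a => by simp [Data.unary]

theorem unary_pred (hk : PolyTime inp fun a => Data.unary (k a)) :
    PolyTime inp fun a => Data.unary (k a - 1) :=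
  hk.snd.congr fun a => by cases k a <;> rfl

theorem unary_succ (hk : PolyTime inp fun a => Data.unary (k a)) :
    PolyTime inp fun a => Data.unary (k a + 1) :=
  ((const (Data.bool true)).cons hk).congr fun _ => rfl

theorem unary_eq_zero (hk : PolyTime inp fun a => Data.unary (k a)) :
    PolyTime inp fun a => Data.bool (decide (k a = 0)) :=
  (isEmpty hk).congr fun a => by cases k a <;> simp [List.replicate_succ]

end PolyTime

/-! ### Binary numbers -/

theorem two_pow_eq_iff_clog {u : ℕ} : (∃ m, u = 2 ^ m) ↔ u = 2 ^ Nat.clog 2 u := by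
  constructor
  · rintro ⟨m, rfl⟩
    rw [Nat.clog_pow 2 m (by norm_num)]
  · exact fun h => ⟨_, h⟩

theorem ofBits_bits (u : ℕ) : ofBits u.bits = u := by
  induction u using Nat.binaryRec' with
  | zero => simp [ofBits]
  | bit b n h ih =>
    rw [Nat.bits_append_bit n b h]
    simp only [ofBits, ih, Nat.bit_val]
    omega

theorem ofBits_lt (l : List Bool) : ofBits l < 2 ^ l.length := by
  induction l with
  | nil => simp [ofBits]
  | cons b l ih =>
    have : b.toNat ≤ 1 := Bool.toNat_le b
    simp only [ofBits, List.length_cons, pow_succ]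
    omega

@[simp] theorem length_lowBits (m v : ℕ) : (lowBits m v).length = m := by simp [lowBits]

theorem lowBits_zero (m : ℕ) : lowBits m 0 = List.replicate m false := by
  simp [lowBits, List.ofFn_const]

theorem lowBits_succ (m v : ℕ) (b : Bool) :
    lowBits (m + 1) (b.toNat + 2 * v) = b :: lowBits m v := by
  have : b.toNat + 2 * v = Nat.bit b v := by rw [Nat.bit_val]; omega
  rw [this]
  simp [lowBits, List.ofFn_succ, Nat.testBit_bit_succ]

theorem lowBits_ofBits (l : List Bool) : lowBits l.length (ofBits l) = l := by
  induction l with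
  | nil => simp [lowBits]
  | cons b l ih => rw [List.length_cons, ofBits, lowBits_succ, ih]

theorem ofBits_lowBits {m v : ℕ} (h : v < 2 ^ m) : ofBits (lowBits m v) = v :=
  lowBits_injOn (m := m) (by simpa using ofBits_lt (lowBits m v)) h
    (by simpa using lowBits_ofBits (lowBits m v))

theorem eq_lowBits {l : List Bool} {m v : ℕ} (hl : l.length = m) (hv : ofBits l = v) :
    l = lowBits m v := by
  subst hl hv
  exact (lowBits_ofBits l).symm

theorem take_lowBits {m n : ℕ} (h : m ≤ n) (v : ℕ) : (lowBits n v).take m = lowBits m v := by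
  apply List.ext_getElem
  · simpa using h
  · intro i h₁ h₂
    simp [lowBits]

theorem ofBits_append (l m : List Bool) :
    ofBits (l ++ m) = ofBits l + 2 ^ l.length * ofBits m := by
  induction l with
  | nil => simp [ofBits]
  | cons b l ih => simp only [List.cons_append, ofBits, ih, List.length_cons, pow_succ]; ring

theorem lt_two_pow_bits_length (u : ℕ) : u < 2 ^ u.bits.length := by
  simpa [ofBits_bits] using ofBits_lt u.bits

theorem clog_le_bits_length (u : ℕ) : Nat.clog 2 u ≤ u.bits.length :=
  (Nat.clog_le_iff_le_pow (by norm_num)).2 (lt_two_pow_bits_length u).le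

theorem ofBits_eq_zero_iff {l : List Bool} : ofBits l = 0 ↔ l.filter id = [] := by
  induction l with
  | nil => simp [ofBits]
  | cons b l ih => cases b <;> simp [ofBits, ih]

/-- A lowest digit `0` halves the number and lowers the exponent by one. A lowest digit `1` makes
the number odd, so only `2 ^ 0` remains and all other digits vanish. The case distinction in `slack`
is thus decided by counting ones. -/
theorem ofBits_isPow_iff {l : List Bool} :
    (∃ m, ofBits l = 2 ^ m) ↔ (l.filter id).length = 1 := by
  induction l with
  | nil => simpa [ofBits] using fun m => (Nat.two_pow_pos m).ne
  | cons b l ih =>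
    cases b
    · simp only [ofBits, Bool.toNat_false, zero_add, id_eq, Bool.false_eq_true, not_false_eq_true,
        List.filter_cons_of_neg]
      rw [← ih]
      constructor
      · rintro ⟨m, hm⟩
        cases m with
        | zero => omega
        | succ m => exact ⟨m, by rw [pow_succ] at hm; omega⟩
      · rintro ⟨m, hm⟩
        exact ⟨m + 1, by rw [pow_succ, hm]; ring⟩
    · simp only [ofBits, Bool.toNat_true, id_eq, List.filter_cons_of_pos, List.length_cons,
        Nat.add_eq_right, List.length_eq_zero_iff]
      rw [← ofBits_eq_zero_iff]
      constructor
      · rintro ⟨m, hm⟩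
        cases m with
        | zero => omega
        | succ m => rw [pow_succ] at hm; omega
      · intro h
        exact ⟨0, by rw [h]; rfl⟩

theorem isPow_iff {u : ℕ} : (∃ m, u = 2 ^ m) ↔ (u.bits.filter id).length = 1 := by
  rw [← ofBits_isPow_iff, ofBits_bits]

theorem slack_eq (σ u : ℕ) :
    slack σ u = if (u.bits.filter id).length = 1 then 0 else σ := by
  simp only [slack, isPow_iff]

/-- The binary length is the least `m` with `u < 2 ^ m`, whereas the rounded-up logarithm asks for
`u ≤ 2 ^ m`; the two differ only at powers of two. -/
theorem clog_eq (u : ℕ) : Nat.clog 2 u =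
    if (u.bits.filter id).length = 1 then u.bits.length - 1 else u.bits.length := by
  split_ifs with h <;> rw [← isPow_iff] at h
  · obtain ⟨m, rfl⟩ := h
    rw [Nat.clog_pow 2 m (by norm_num), Nat.size_eq_bits_len, Nat.size_pow]
    rfl
  · refine le_antisymm (clog_le_bits_length u) ?_
    rw [Nat.size_eq_bits_len, Nat.size_le]
    refine (Nat.le_pow_clog (b := 2) (by norm_num) u).lt_of_ne fun hu => h ⟨_, hu⟩

/-- The step of the long division that counts the positions `i < m` that are multiples of `κ`. -/
def ceilStep (κ : ℕ) (s : ℕ × ℕ) : ℕ × ℕ :=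
  bif decide (s.1 = 0) then (κ - 1, s.2 + 1) else (s.1 - 1, s.2)

/-- The first component is the distance from position `m` to the next multiple of `κ` (zero at a
multiple). The two relations determine the second component as the quotient rounded up. -/
theorem ceilStep_iterate {κ : ℕ} (hκ : 0 < κ) (m : ℕ) :
    m + ((ceilStep κ)^[m] (0, 0)).1 = κ * ((ceilStep κ)^[m] (0, 0)).2 ∧
      ((ceilStep κ)^[m] (0, 0)).1 < κ := by
  induction m with
  | zero => simpa using hκ
  | succ m ih =>
    rw [Function.iterate_succ_apply']
    generalize (ceilStep κ)^[m] (0, 0) = s at ih ⊢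
    obtain ⟨r, q⟩ := s
    rcases r with _ | r
    · simp only [ceilStep, decide_true, cond_true, mul_add] at ih ⊢
      omega
    · simp only [ceilStep, Nat.add_eq_zero_iff, one_ne_zero, and_false, decide_false,
        cond_false] at ih ⊢
      omega

theorem ceilStep_snd {κ : ℕ} (hκ : 0 < κ) (m : ℕ) :
    ((ceilStep κ)^[m] (0, 0)).2 = (m + κ - 1) / κ := by
  obtain ⟨h₁, h₂⟩ := ceilStep_iterate hκ m
  symm
  refine Nat.div_eq_of_lt_le ?_ ?_
  · rw [mul_comm]; omega
  · rw [Nat.add_mul, mul_comm]; omega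

/-- One step of the schoolbook subtraction: the new borrow and the next digit. -/
def subStep (s : Bool × List Bool) (p : Bool × Bool) : Bool × List Bool :=
  ((!p.1 && (p.2 || s.1)) || (p.2 && s.1), (p.1 ^^ p.2 ^^ s.1) :: s.2)

/-- The identity is kept by each digit because the borrow is the carry of the rearranged sum `r + y
+ c = x + 2 c'`. Without a final borrow the digits are those of the difference; a final borrow shows
that the minuend was too small. -/
theorem foldl_subStep (l : List (Bool × Bool)) : ∀ (c : Bool) (acc : List Bool),
    ∃ (c' : Bool) (r : List Bool), l.foldl subStep (c, acc) = (c', r.reverse ++ acc) ∧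
      r.length = l.length ∧
      ofBits r + ofBits (l.map Prod.snd) + c.toNat =
        ofBits (l.map Prod.fst) + 2 ^ l.length * c'.toNat := by
  induction l with
  | nil => intro c acc; exact ⟨c, [], by simp [ofBits]⟩
  | cons p l ih =>
    intro c acc
    obtain ⟨x, y⟩ := p
    obtain ⟨c', r, h₁, h₂, h₃⟩ := ih ((!x && (y || c)) || (y && c)) ((x ^^ y ^^ c) :: acc)
    refine ⟨c', (x ^^ y ^^ c) :: r, ?_, by simp [h₂], ?_⟩
    · simp only [List.foldl_cons, subStep, h₁, List.reverse_cons, List.append_assoc,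
        List.singleton_append]
    · simp only [ofBits, List.map_cons, List.length_cons, pow_succ]
      have : 2 ^ l.length * 2 * c'.toNat = 2 * (2 ^ l.length * c'.toNat) := by ring
      rw [this]
      generalize 2 ^ l.length * c'.toNat = z at *
      cases x <;> cases y <;> cases c <;> simp at h₃ ⊢ <;> omega

/-- This is Horner's scheme with a reduction after every digit, so that intermediate values stay
below `u`. -/
theorem foldr_mod (u : ℕ) (l : List Bool) :
    l.foldr (fun b v => (b.toNat + 2 * v) % u) 0 = ofBits l % u := by
  induction l with
  | nil => simp [ofBits]
  | cons b l ih =>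
    rw [List.foldr_cons, ih, ofBits]
    simp [Nat.add_mod, Nat.mul_mod]

/-! ### Counting, rounded-up division and modular reduction in polynomial time -/

namespace PolyTime

variable {A : Type} {inp : A → Data} {l m : A → List Bool} {k n u : A → ℕ}

/-- A loop that is run `k a` times. -/
theorem iterate {S : A → Type} {encS : ∀ a, S a → Data} {step : ∀ a, S a → S a}
    (hstep : PolyTime (fun x : (Σ a, S a) => Data.cons (inp x.1) (encS x.1 x.2))
      fun x => encS x.1 (step x.1 x.2))
    (hk : PolyTime inp fun a => Data.unary (k a)) {s : ∀ a, S a}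
    (hs : PolyTime inp fun a => encS a (s a)) {b : A → ℕ} (hb : PolyBdd inp b)
    (hsize : ∀ a i, i ≤ k a → (encS a ((step a)^[i] (s a))).size ≤ b a) :
    PolyTime inp fun a => encS a ((step a)^[k a] (s a)) := by
  have hfold : ∀ a (l : List Bool) (s : S a), l.foldl (fun s _ => step a s) s =
      (step a)^[l.length] s := by
    intro a l
    induction l with
    | nil => simp
    | cons x l ih => intro s; simp [ih]
  have hi : PolyTime (fun x : (Σ a, S a × Bool) => Data.cons (inp x.1)
    (Data.cons (encS x.1 x.2.1) (Data.bool x.2.2))) (fun x => Data.cons (inp x.1)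
    (Data.cons (encS x.1 x.2.1) (Data.bool x.2.2))) := .id
  have := foldl (inp := inp) (S := S) (E := fun _ => Bool) (encS := encS)
    (encE := fun _ => Data.bool) (step := fun a s _ => step a s)
    (hstep.comp (fun x : (Σ a, S a × Bool) => (⟨x.1, x.2.1⟩ : Σ a, S a))
      (hi.fst.cons hi.snd.fst)) (l := fun a => List.replicate (k a) true) hk hs hb
    (fun a l' hl => by
      rw [hfold]
      exact hsize a _ (by simpa using hl.length_le))
  exact this.congr fun a => by rw [hfold]; simp

theorem unary_count (hl : PolyTime inp fun a => Data.bits (l a)) :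
    PolyTime inp fun a => Data.unary ((l a).filter id).length := by
  have hfold : ∀ (l : List Bool) (k : ℕ), l.foldl (fun k b => bif b then k + 1 else k) k =
      (l.filter id).length + k := by
    intro l
    induction l with
    | nil => simp
    | cons b l ih => intro k; cases b <;> simp [ih]; omega
  have hi : PolyTime (fun x : (Σ _ : A, ℕ × Bool) => Data.cons (inp x.1)
    (Data.cons (Data.unary x.2.1) (Data.bool x.2.2))) (fun x => Data.cons (inp x.1)
    (Data.cons (Data.unary x.2.1) (Data.bool x.2.2))) := .id
  have := foldl (inp := inp) (S := fun _ => ℕ) (E := fun _ => Bool)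
    (encS := fun _ => Data.unary) (encE := fun _ => Data.bool)
    (step := fun _ k b => bif b then k + 1 else k)
    ((cond hi.snd.snd (unary_succ hi.snd.fst) hi.snd.fst).congr fun x => by
      cases x.2.2 <;> rfl) (l := l) hl (s := fun _ => 0) (const (Data.unary 0))
    (m := fun a => 4 * (l a).length + 1)
    (((PolyBdd.const 4).mul (bits_length_bdd hl)).add (.const 1)) (fun a l' hl' => by
      rw [hfold]
      refine (Data.size_bits_le _).trans ?_
      have := hl'.length_le
      have := List.length_filter_le id l'
      simp only [add_zero, List.length_replicate]
      omega)
  exact this.congr fun a => by rw [hfold, add_zero]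

theorem unary_eq_one (hk : PolyTime inp fun a => Data.unary (k a)) :
    PolyTime inp fun a => Data.bool (decide (k a = 1)) :=
  ((unary_eq_zero hk).not.and (unary_eq_zero (unary_pred hk))).congr fun a => by
    congr 1
    rw [Bool.eq_iff_iff]
    simp
    omega

theorem slack (hσ : PolyTime inp fun a => Data.unary (k a))
    (hu : PolyTime inp fun a => Data.binary (u a)) :
    PolyTime inp fun a => Data.unary (slack (k a) (u a)) :=
  (cond (unary_eq_one (unary_count hu)) (const (Data.unary 0)) hσ).congr fun a => by
    rw [slack_eq]
    split_ifs with h <;> simp [h]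

theorem clog (hu : PolyTime inp fun a => Data.binary (u a)) :
    PolyTime inp fun a => Data.unary (Nat.clog 2 (u a)) :=
  (cond (unary_eq_one (unary_count hu)) (unary_pred (unary_bits_length hu))
    (unary_bits_length hu)).congr fun a => by
    rw [clog_eq]
    split_ifs with h <;> simp [h]

theorem ceil_div (hk : PolyTime inp fun a => Data.unary (k a))
    (hn : PolyTime inp fun a => Data.unary (n a)) :
    PolyTime inp fun a => Data.unary ((n a + k a - 1) / k a) := by
  let inp' : (Σ _ : A, ℕ × ℕ) → Data := fun x =>
    Data.cons (inp x.1) (Data.cons (Data.unary x.2.1) (Data.unary x.2.2))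
  have hi : PolyTime inp' inp' := .id
  have hk' : PolyTime inp' fun x => Data.unary (k x.1) := hk.comp Sigma.fst hi.fst
  have hstep : PolyTime inp' fun x => Data.cons (Data.unary (ceilStep (k x.1) x.2).1)
      (Data.unary (ceilStep (k x.1) x.2).2) :=
    (cond (unary_eq_zero hi.snd.fst) ((unary_pred hk').cons (unary_succ hi.snd.snd))
      ((unary_pred hi.snd.fst).cons hi.snd.snd)).congr fun x => by
      simp only [ceilStep]
      cases decide (x.2.1 = 0) <;> rfl
  -- This cruder bound on the loop states is also valid for `κ = 0`, where `ceilStep_iterate` does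
  -- not apply.
  have hbound : ∀ (κ i : ℕ), ((ceilStep κ)^[i] (0, 0)).1 ≤ κ ∧
      ((ceilStep κ)^[i] (0, 0)).2 ≤ i := by
    intro κ i
    induction i with
    | zero => simp
    | succ i ih =>
      rw [Function.iterate_succ_apply']
      generalize (ceilStep κ)^[i] (0, 0) = s at ih ⊢
      obtain ⟨r, q⟩ := s
      simp only [ceilStep] at ih ⊢
      cases decide (r = 0) <;> simp <;> omega
  have := iterate (inp := inp) (S := fun _ => ℕ × ℕ)
    (encS := fun _ s => Data.cons (Data.unary s.1) (Data.unary s.2))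
    (step := fun a => ceilStep (k a)) hstep hn (s := fun _ => (0, 0))
    (const (Data.cons (Data.unary 0) (Data.unary 0)))
    (b := fun a => (4 * k a + 1) + (4 * n a + 1) + 1)
    ((((PolyBdd.const 4).mul (unary_bdd hk)).add (.const 1)).add
      (((PolyBdd.const 4).mul (unary_bdd hn)).add (.const 1)) |>.add (.const 1))
    (fun a i hi => by
      have h := hbound (k a) i
      have h₁ := Data.size_bits_le (List.replicate ((ceilStep (k a))^[i] (0, 0)).1 true)
      have h₂ := Data.size_bits_le (List.replicate ((ceilStep (k a))^[i] (0, 0)).2 true)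
      rw [List.length_replicate] at h₁ h₂
      simp only [Data.size_cons, Data.unary]
      omega)
  -- Division by zero has the value `0` in `ℕ`, which the loop does not produce; it is treated
  -- separately.
  refine (cond (unary_eq_zero hk) (const (Data.unary 0)) this.snd).congr fun a => ?_
  rcases Nat.eq_zero_or_pos (k a) with h | h
  · simp [h]
  · simp [h.ne', Data.snd, ceilStep_snd h]

/-- Reduction of a binary number modulo `u`. -/
theorem lowBits_mod (hu : PolyTime inp fun a => Data.binary (u a)) (hpos : ∀ a, 0 < u a)
    (hl : PolyTime inp fun a => Data.bits (l a)) :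
    PolyTime inp fun a => Data.bits (lowBits (Nat.clog 2 (u a)) (ofBits (l a) % u a)) := by
  -- The accumulator is a residue; its bound is part of the type because the step is correct only
  -- for `v < u a`.
  let S : A → Type := fun a => {v : ℕ // v < u a}
  let step : ∀ a, S a → Bool → S a := fun a v b =>
    ⟨(b.toNat + 2 * v) % u a, Nat.mod_lt _ (hpos a)⟩
  let encS : ∀ a, S a → Data := fun a v => Data.bits (lowBits (u a).bits.length v)
  let inp' : (Σ a, S a × Bool) → Data := fun x =>
    Data.cons (inp x.1) (Data.cons (encS x.1 x.2.1) (Data.bool x.2.2))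
  have hi : PolyTime inp' inp' := .id
  have hu' : PolyTime inp' fun x => Data.bits (u x.1).bits := hu.comp Sigma.fst hi.fst
  -- `X` holds the digits of `b + 2 v`, one more than `u` has, and `Y` is `u` padded by a leading
  -- zero to the same width. As `b + 2 v < 2 u`, a single subtraction reduces it, and the final
  -- borrow of `R` tells whether the subtraction is needed.
  let X : (Σ a, S a × Bool) → List Bool := fun x => x.2.2 :: lowBits (u x.1).bits.length x.2.1
  let Y : (Σ a, S a × Bool) → List Bool := fun x => (u x.1).bits ++ [false]
  let R : (Σ a, S a × Bool) → Bool × List Bool :=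
    fun x => ((X x).zip (Y x)).foldl subStep (false, [])
  have hX : PolyTime inp' fun x => Data.bits (X x) := bits_cons hi.snd.snd hi.snd.fst
  have hY : PolyTime inp' fun x => Data.bits (Y x) := bits_append hu' (const (Data.bits [false]))
  have hzip : PolyTime inp' fun x => Data.list (((X x).zip (Y x)).map
      fun p => Data.cons (Data.bool p.1) (Data.bool p.2)) :=
    (PolyTime.zip hX hY).congr fun x => by
      rw [List.zip, List.map_zipWith, List.zipWith_map]
  have hR : PolyTime inp' fun x => Data.cons (Data.bool (R x).1) (Data.bits (R x).2) := by
    let inp'' : (Σ _ : (Σ a, S a × Bool), (Bool × List Bool) × (Bool × Bool)) → Data :=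
      fun x => Data.cons (inp' x.1) (Data.cons (Data.cons (Data.bool x.2.1.1)
        (Data.bits x.2.1.2)) (Data.cons (Data.bool x.2.2.1) (Data.bool x.2.2.2)))
    have hj : PolyTime inp'' inp'' := .id
    have hx : PolyTime inp'' fun x => Data.bool x.2.2.1 := hj.snd.snd.fst
    have hy : PolyTime inp'' fun x => Data.bool x.2.2.2 := hj.snd.snd.snd
    have hc : PolyTime inp'' fun x => Data.bool x.2.1.1 := hj.snd.fst.fst
    have hacc : PolyTime inp'' fun x => Data.bits x.2.1.2 := hj.snd.fst.snd
    refine foldl (inp := inp') (S := fun _ => Bool × List Bool) (E := fun _ => Bool × Bool)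
      (encS := fun _ s => Data.cons (Data.bool s.1) (Data.bits s.2))
      (encE := fun _ p => Data.cons (Data.bool p.1) (Data.bool p.2)) (step := fun _ => subStep)
      (((hx.not.and (hy.or hc)).or (hy.and hc)).cons (bits_cons (hx.xor (hy.xor hc)) hacc |>.congr
        fun x => by simp [subStep])) hzip
      (s := fun _ => (false, [])) (const (Data.cons (Data.bool false) (Data.bits [])))
      (m := fun x => 3 + (4 * (X x).length + 1) + 1)
      (((PolyBdd.const 3).add (((PolyBdd.const 4).mul (bits_length_bdd hX)).add (.const 1))).add
        (.const 1)) ?_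
    intro x l' hl'
    obtain ⟨c, r, h₁, h₂, -⟩ := foldl_subStep l' false []
    rw [h₁]
    have h₃ := Data.size_bool_le c
    have h₄ := Data.size_bits_le (r.reverse ++ [])
    have h₅ := hl'.length_le
    simp only [List.append_nil, List.length_reverse, List.length_zip] at h₄ h₅
    simp only [Data.size_cons, List.append_nil]
    omega
  have hstep : PolyTime inp' fun x => encS x.1 (step x.1 x.2.1 x.2.2) := by
    refine (bits_take (cond hR.fst hX (bits_reverse hR.snd) |>.congr
      (g := fun x => Data.bits (bif (R x).1 then X x else (R x).2.reverse)) fun x => by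
        cases (R x).1 <;> rfl) (unary_bits_length hu')).congr fun x => ?_
    obtain ⟨c, r, h₁, h₂, h₃⟩ := foldl_subStep ((X x).zip (Y x)) false []
    change R x = _ at h₁
    rw [h₁]
    obtain ⟨a, ⟨v, hv⟩, b⟩ := x
    have hlen : (X ⟨a, ⟨v, hv⟩, b⟩).length = (Y ⟨a, ⟨v, hv⟩, b⟩).length := by simp [X, Y]
    rw [List.map_fst_zip hlen.le, List.map_snd_zip hlen.ge] at h₃
    rw [List.length_zip, ← hlen, min_self] at h₂ h₃
    have hXv : X ⟨a, ⟨v, hv⟩, b⟩ = lowBits ((u a).bits.length + 1) (b.toNat + 2 * v) :=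
      (lowBits_succ _ _ _).symm
    have hb : b.toNat ≤ 1 := Bool.toNat_le b
    have hw := lt_two_pow_bits_length (u a)
    have hXo : ofBits (X ⟨a, ⟨v, hv⟩, b⟩) = b.toNat + 2 * v := by
      rw [hXv, ofBits_lowBits]
      rw [pow_succ]
      omega
    have hYo : ofBits (Y ⟨a, ⟨v, hv⟩, b⟩) = u a := by
      simp [Y, ofBits_append, ofBits_bits, ofBits]
    have hrlt := ofBits_lt r
    rw [hXo, hYo] at h₃
    rw [h₂] at hrlt
    simp only [Bool.toNat_false, add_zero] at h₃
    change _ = Data.bits (lowBits (u a).bits.length ((b.toNat + 2 * v) % u a))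
    congr 1
    cases c
    · simp only [Bool.toNat_false, mul_zero, add_zero] at h₃
      have hr : r = lowBits ((u a).bits.length + 1) (b.toNat + 2 * v - u a) :=
        eq_lowBits (by rw [h₂, hXv, length_lowBits]) (by omega)
      rw [cond_false, List.append_nil, List.reverse_reverse, hr,
        take_lowBits (Nat.le_succ _), Nat.mod_eq_sub_mod (by omega), Nat.mod_eq_of_lt]
      omega
    · simp only [Bool.toNat_true, mul_one] at h₃
      rw [cond_true, hXv, take_lowBits (Nat.le_succ _), Nat.mod_eq_of_lt]
      omega
  -- Horner's scheme starts at the most significant digit, which comes last in the list.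
  have hfold : ∀ a (l : List Bool), (l.reverse.foldl (step a) ⟨0, hpos a⟩).1 =
      ofBits l % u a := by
    intro a l
    rw [← foldr_mod, List.foldl_reverse]
    induction l with
    | nil => rfl
    | cons b l ih => rw [List.foldr_cons, List.foldr_cons, ← ih]
  have hwl : PolyTime inp fun a => Data.unary (u a).bits.length := unary_bits_length hu
  have := foldl (inp := inp) (S := S) (E := fun _ => Bool) (encS := encS)
    (encE := fun _ => Data.bool) (step := step) hstep (l := fun a => (l a).reverse)
    (bits_reverse hl) (s := fun a => ⟨0, hpos a⟩)
    ((map (E := fun _ => Bool) (encE := fun _ => Data.bool) (f := fun _ _ => Data.bool false)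
      (const _) (l := fun a => (u a).bits) hu).congr fun a => by
        simp [encS, lowBits_zero, Data.bits])
    (m := fun a => 4 * (u a).bits.length + 1)
    (((PolyBdd.const 4).mul (unary_bdd hwl)).add (.const 1)) (fun a l' _ => by
      refine (Data.size_bits_le _).trans ?_
      simp)
  -- The residue was kept at the binary length of `u`; a group element has one digit fewer when `u`
  -- is a power of two.
  refine (bits_take this (clog hu)).congr fun a => ?_
  rw [take_lowBits (clog_le_bits_length _), hfold]

end PolyTime

/-! ### Running the algorithms of the construction -/

namespace PRGComp

variable {κ : ℕ} {A B : Type} (G : Bits κ → Bits (2 * κ + 2))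

@[simp] theorem run_pure (a : A) : (Pure.pure a : PRGComp κ A).run G = a := rfl

@[simp] theorem run_eval (s : Bits κ) : (eval s).run G = G s := rfl

@[simp] theorem run_bind (m : PRGComp κ A) (f : A → PRGComp κ B) :
    (m >>= f).run G = (f (m.run G)).run G := by
  induction m with
  | pure a => rfl
  | call s k ih => exact ih (G s)

@[simp] theorem calls_pure (a : A) : (Pure.pure a : PRGComp κ A).calls G = 0 := rfl

@[simp] theorem calls_eval (s : Bits κ) : (eval s).calls G = 1 := rfl

@[simp] theorem calls_bind (m : PRGComp κ A) (f : A → PRGComp κ B) :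
    (m >>= f).calls G = m.calls G + (f (m.run G)).calls G := by
  induction m with
  | pure a => exact (Nat.zero_add _).symm
  | call s k ih =>
    change (Bind.bind (k (G s)) f).calls G + 1 = (k (G s)).calls G + 1 + _
    rw [ih (G s)]
    change _ = (k (G s)).calls G + 1 + (f ((k (G s)).run G)).calls G
    omega

end PRGComp

/-! ### The data flow of a level in closed form -/

section Pieces

variable {κ : ℕ}

/-- The seed correction of a level with the bit `a`. -/
def seedCW (a : Bool) (y₀ y₁ : Bits (2 * κ + 2)) : Bits κ :=
  xorBits (seedPart (!a) y₀) (seedPart (!a) y₁)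

/-- The left control bit correction of a level with the bit `a`. -/
def leftCW (a : Bool) (y₀ y₁ : Bits (2 * κ + 2)) : Bool :=
  bitPart false y₀ ^^ bitPart false y₁ ^^ a ^^ true

/-- The right control bit correction of a level with the bit `a`. -/
def rightCW (a : Bool) (y₀ y₁ : Bits (2 * κ + 2)) : Bool :=
  bitPart true y₀ ^^ bitPart true y₁ ^^ a

/-- The corrected control bit on the side `x`. -/
def nextBit (x : Bool) (y : Bits (2 * κ + 2)) (t tL tR : Bool) : Bool :=
  bitPart x y ^^ (t && bif x then tR else tL)

/-- The corrected seed on the side `x`. -/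
def nextSeed (x : Bool) (y : Bits (2 * κ + 2)) (t : Bool) (s : Bits κ) : Bits κ :=
  xorBits (seedPart x y) (smulBits t s)

/-- One round of `stretch`, with the emitted bits in an accumulator. -/
def stretchStep (G : Bits κ → Bits (2 * κ + 2)) (p : Bits κ × List Bool) : Bits κ × List Bool :=
  (seedPart false (G p.1), p.2 ++ List.ofFn (seedPart true (G p.1)))

/-- Concatenation is associative, so blocks may be appended to an accumulator instead of being
prepended by the recursion. The iterated form serves both as a loop with bounded states and as a
sequence of hybrids. -/
theorem stretchStep_iterate (G : Bits κ → Bits (2 * κ + 2)) (k : ℕ) (s : Bits κ)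
    (e : List Bool) : (stretchStep G)^[k] (s, e) =
      (((stretch k s).run G).1, e ++ ((stretch k s).run G).2) := by
  induction k generalizing s e with
  | zero => simp [stretch]
  | succ k ih =>
    rw [Function.iterate_succ_apply, stretchStep, ih]
    simp [stretch]

theorem length_stretch (G : Bits κ → Bits (2 * κ + 2)) (k : ℕ) (s : Bits κ) :
    ((stretch k s).run G).2.length = k * κ := by
  induction k generalizing s with
  | zero => simp [stretch]
  | succ k ih => simp [stretch, ih]; ring

variable (Γ : GroupSystem)

/-- The value of `W_CW`. -/
def valueCW {d : Γ.Desc} (β : Γ.El d) (t₁ : Bool) (W₀ W₁ : Γ.El d) : Γ.El d :=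
  bif t₁ then -(β - W₀ + W₁) else β - W₀ + W₁

/-- The end of a level of the key generation, after the conversion of the seeds. -/
def finishLevel {d : Γ.Desc} (β : Γ.El d) (sCW : Bits κ) (tL tR t₀ t₁ : Bool)
    (r₀ r₁ : Bits κ × Γ.El d) : CW Γ κ d × EvalState κ × EvalState κ :=
  (⟨sCW, tL, tR, valueCW Γ β t₁ r₀.2 r₁.2⟩, ⟨r₀.1, t₀⟩, ⟨r₁.1, t₁⟩)

/-- A level of the key generation from the outputs `y₀` and `y₁` of the generator. -/
noncomputable def levelFrom (G : Bits κ → Bits (2 * κ + 2)) (σ : ℕ) (d : Γ.Desc) (a : Bool)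
    (β : Γ.El d) (y₀ y₁ : Bits (2 * κ + 2)) (t₀ t₁ : Bool) : CW Γ κ d × EvalState κ × EvalState κ :=
  finishLevel Γ β (seedCW a y₀ y₁) (leftCW a y₀ y₁) (rightCW a y₀ y₁)
    (nextBit a y₀ t₀ (leftCW a y₀ y₁) (rightCW a y₀ y₁))
    (nextBit a y₁ t₁ (leftCW a y₀ y₁) (rightCW a y₀ y₁))
    ((convert Γ σ d (nextSeed a y₀ t₀ (seedCW a y₀ y₁))).run G)
    ((convert Γ σ d (nextSeed a y₁ t₁ (seedCW a y₀ y₁))).run G)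

/-- Beyond the conversions, the seeds enter a level only through the two generator outputs. Making
these outputs arguments separates them from the seeds and exposes where a uniform string can be
substituted. -/
theorem genLevel_run (G : Bits κ → Bits (2 * κ + 2)) (σ : ℕ) (d : Γ.Desc) (a : Bool)
    (β : Γ.El d) (st₀ st₁ : EvalState κ) : (genLevel Γ σ d a β st₀ st₁).run G =
      levelFrom Γ G σ d a β (G st₀.s) (G st₁.s) st₀.t st₁.t := by
  simp only [genLevel, PRGComp.run_bind, PRGComp.run_eval, PRGComp.run_pure]
  rfl

theorem genLoop_succ_run (G : Bits κ → Bits (2 * κ + 2)) (σ : ℕ) {n : ℕ}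
    (grp : Fin (n + 1) → Γ.Desc) (α : Fin (n + 1) → Bool) (β : ∀ ℓ, Γ.El (grp ℓ))
    (st₀ st₁ : EvalState κ) : (genLoop Γ σ (n + 1) grp α β st₀ st₁).run G =
      Fin.cons (α := fun ℓ => CW Γ κ (grp ℓ))
        ((genLevel Γ σ (grp 0) (α 0) (β 0) st₀ st₁).run G).1
        ((genLoop Γ σ n (fun ℓ => grp ℓ.succ) (fun ℓ => α ℓ.succ) (fun ℓ => β ℓ.succ)
          ((genLevel Γ σ (grp 0) (α 0) (β 0) st₀ st₁).run G).2.1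
          ((genLevel Γ σ (grp 0) (α 0) (β 0) st₀ st₁).run G).2.2).run G) := by
  simp only [genLoop, PRGComp.run_bind, PRGComp.run_pure]

theorem convert_run (G : Bits κ → Bits (2 * κ + 2)) (σ : ℕ) (d : Γ.Desc) (s : Bits κ) :
    (convert Γ σ d s).run G =
      (((stretch (convertCalls κ σ (Γ.order d)) s).run G).1,
        Γ.elOfNat d (ofBits ((stretch (convertCalls κ σ (Γ.order d)) s).run G).2)) := by
  simp [convert]

theorem elBits_elOfNat (d : Γ.Desc) (v : ℕ) :
    Γ.elBits (Γ.elOfNat d v) = lowBits (Nat.clog 2 (Γ.order d)) (v % Γ.order d) := by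
  simp [GroupSystem.elBits, GroupSystem.elOfNat]

theorem evalNextAlg_run (G : Bits κ → Bits (2 * κ + 2)) (σ : ℕ) (b : Bool) (st : EvalState κ)
    (d : Γ.Desc) (c : CW Γ κ d) (x : Bool) : (evalNextAlg Γ σ b st d c x).run G =
      (⟨((convert Γ σ d (nextSeed x (G st.s) st.t c.s)).run G).1,
          nextBit x (G st.s) st.t c.tL c.tR⟩,
        bif b then -(bif nextBit x (G st.s) st.t c.tL c.tR then
          ((convert Γ σ d (nextSeed x (G st.s) st.t c.s)).run G).2 + c.W else
          ((convert Γ σ d (nextSeed x (G st.s) st.t c.s)).run G).2) else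
        (bif nextBit x (G st.s) st.t c.tL c.tR then
          ((convert Γ σ d (nextSeed x (G st.s) st.t c.s)).run G).2 + c.W else
          ((convert Γ σ d (nextSeed x (G st.s) st.t c.s)).run G).2)) := by
  simp only [evalNextAlg, PRGComp.run_bind, PRGComp.run_eval, PRGComp.run_pure]
  rfl

end Pieces

/-! ### Efficiency of the pieces -/

theorem Bits.size_enc_le {κ : ℕ} (s : Bits κ) : s.enc.size ≤ 4 * κ + 1 := by
  have := Data.size_bits_le (List.ofFn s)
  rwa [List.length_ofFn] at this

namespace PolyTime

variable {A : Type} {inp : A → Data} {κ : A → ℕ}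

theorem unary_of_enc {s : ∀ a, Bits (κ a)} (hs : PolyTime inp fun a => (s a).enc) :
    PolyTime inp fun a => Data.unary (κ a) :=
  (unary_bits_length hs).congr fun a => by simp

theorem xorBits {s s' : ∀ a, Bits (κ a)} (hs : PolyTime inp fun a => (s a).enc)
    (hs' : PolyTime inp fun a => (s' a).enc) :
    PolyTime inp fun a => (xorBits (s a) (s' a)).enc := by
  have hi : PolyTime (fun x : (Σ _ : A, Bool × Bool) => Data.cons (inp x.1)
    (Data.cons (Data.bool x.2.1) (Data.bool x.2.2))) (fun x => Data.cons (inp x.1)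
    (Data.cons (Data.bool x.2.1) (Data.bool x.2.2))) := .id
  have hz : PolyTime inp fun a => Data.list (((List.ofFn (s a)).zip (List.ofFn (s' a))).map
      fun p => Data.cons (Data.bool p.1) (Data.bool p.2)) :=
    (PolyTime.zip hs hs').congr fun x => by
      rw [List.zip, List.map_zipWith, List.zipWith_map]
  refine (map (E := fun _ => Bool × Bool) (f := fun _ p => Data.bool (p.1 ^^ p.2))
    (hi.snd.fst.xor hi.snd.snd) hz).congr fun a => ?_
  rw [Bits.enc, Data.bits]
  congr 1
  apply List.ext_getElem <;> simp [IncDPF.xorBits]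

theorem smulBits {t : A → Bool} {s : ∀ a, Bits (κ a)} (ht : PolyTime inp fun a => Data.bool (t a))
    (hs : PolyTime inp fun a => (s a).enc) :
    PolyTime inp fun a => (smulBits (t a) (s a)).enc :=
  -- The zero string of the right length is obtained as `s ⊕ s`.
  (ht.cond hs (hs.xorBits hs)).congr fun a => by
    cases t a
    · rw [cond_false]; congr 1; funext j; simp [IncDPF.smulBits, IncDPF.xorBits]
    · rw [cond_true]; congr 1

theorem seedPart {y : ∀ a, Bits (2 * κ a + 2)} (hκ : PolyTime inp fun a => Data.unary (κ a))
    (hy : PolyTime inp fun a => (y a).enc) {c : A → Bool}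
    (hc : PolyTime inp fun a => Data.bool (c a)) :
    PolyTime inp fun a => (seedPart (c a) (y a)).enc :=
  (hc.cond (bits_take (bits_drop hy (unary_succ hκ)) hκ) (bits_take hy hκ)).congr fun a => by
    cases c a
    · simp only [Bits.enc, cond_false]
      congr 1
      apply List.ext_getElem
      · simp; omega
      · intros; simp [IncDPF.seedPart, -List.ofFn_succ]
    · simp only [Bits.enc, cond_true]
      congr 1
      apply List.ext_getElem
      · simp; omega
      · intros; simp [IncDPF.seedPart, -List.ofFn_succ]

theorem bitPart {y : ∀ a, Bits (2 * κ a + 2)} (hκ : PolyTime inp fun a => Data.unary (κ a))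
    (hy : PolyTime inp fun a => (y a).enc) {c : A → Bool}
    (hc : PolyTime inp fun a => Data.bool (c a)) :
    PolyTime inp fun a => Data.bool (bitPart (c a) (y a)) := by
  have h₁ := bits_head (b := false) (bits_drop hy hκ) fun a h => by
    rw [List.drop_eq_nil_iff] at h
    simp at h
    omega
  have h₂ := bits_head (b := false) (bits_drop hy (unary_succ (unary_add hκ hκ))) fun a h => by
    rw [List.drop_eq_nil_iff] at h
    simp at h
    omega
  refine (hc.cond h₂ h₁).congr fun a => ?_
  cases c a
  · rw [cond_false, List.drop_eq_getElem_cons (by simp; omega)]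
    simp [IncDPF.bitPart, -List.ofFn_succ]
  · rw [cond_true, List.drop_eq_getElem_cons (by simp; omega)]
    simp [IncDPF.bitPart, -List.ofFn_succ, two_mul]

end PolyTime

/-- The state of an evaluation as machine data. -/
def EvalState.enc {κ : ℕ} (st : EvalState κ) : Data := Data.cons st.s.enc (Data.bool st.t)

theorem EvalState.size_enc_le {κ : ℕ} (st : EvalState κ) : st.enc.size ≤ 4 * κ + 5 := by
  have h₁ := st.s.size_enc_le
  have h₂ := Data.size_bool_le st.t
  simp only [EvalState.enc, Data.size_cons]
  omega

theorem length_stretchStep_iterate {κ : ℕ} (G : Bits κ → Bits (2 * κ + 2)) (k : ℕ)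
    (p : Bits κ × List Bool) : ((stretchStep G)^[k] p).2.length = p.2.length + k * κ := by
  rw [stretchStep_iterate, List.length_append, length_stretch]

theorem CW.length_toBits {Γ : GroupSystem} {κ : ℕ} {d : Γ.Desc} (c : CW Γ κ d) :
    c.toBits.length = κ + 2 + Nat.clog 2 (Γ.order d) := by
  simp [CW.toBits, GroupSystem.elBits]
  omega

namespace PolyTime

variable {A : Type} {inp : A → Data} {κ : A → ℕ} {G : ∀ κ, Bits κ → Bits (2 * κ + 2)}

theorem generator (hG : PolyTime (fun s : (Σ κ, Bits κ) => s.2.enc) fun s => (G s.1 s.2).enc)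
    {s : ∀ a, Bits (κ a)} (hs : PolyTime inp fun a => (s a).enc) :
    PolyTime inp fun a => (G (κ a) (s a)).enc :=
  hG.comp (fun a => ⟨κ a, s a⟩) hs

theorem stretch (hG : PolyTime (fun s : (Σ κ, Bits κ) => s.2.enc) fun s => (G s.1 s.2).enc)
    {k : A → ℕ} (hk : PolyTime inp fun a => Data.unary (k a))
    {s : ∀ a, Bits (κ a)} (hs : PolyTime inp fun a => (s a).enc)
    {e : A → List Bool} (he : PolyTime inp fun a => Data.bits (e a)) :
    PolyTime inp fun a => Data.cons ((stretchStep (G (κ a)))^[k a] (s a, e a)).1.enc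
      (Data.bits ((stretchStep (G (κ a)))^[k a] (s a, e a)).2) := by
  let inp' : (Σ a : A, Bits (κ a) × List Bool) → Data := fun x =>
    Data.cons (inp x.1) (Data.cons x.2.1.enc (Data.bits x.2.2))
  have hi : PolyTime inp' inp' := .id
  have hy : PolyTime inp' fun x => (G (κ x.1) x.2.1).enc := generator hG hi.snd.fst
  have hκ : PolyTime inp' fun x => Data.unary (κ x.1) :=
    unary_of_enc (s := fun x : (Σ a : A, Bits (κ a) × List Bool) => x.2.1) hi.snd.fst
  refine iterate (inp := inp) (S := fun a => Bits (κ a) × List Bool)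
    (encS := fun _ p => Data.cons p.1.enc (Data.bits p.2)) (step := fun a => stretchStep (G (κ a)))
    ((seedPart hκ hy (const (Data.bool false))).cons
      (bits_append hi.snd.snd (seedPart hκ hy (const (Data.bool true))))) hk
    (s := fun a => (s a, e a)) (hs.cons he)
    (b := fun a => (4 * κ a + 1) + (4 * ((e a).length + k a * κ a) + 1) + 1)
    (((((PolyBdd.const 4).mul (unary_bdd (unary_of_enc hs))).add (.const 1)).add
      (((PolyBdd.const 4).mul ((bits_length_bdd he).add
        ((unary_bdd hk).mul (unary_bdd (unary_of_enc hs))))).add (.const 1))).add (.const 1)) ?_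
  intro a i hi
  have h₁ := Bits.size_enc_le ((stretchStep (G (κ a)))^[i] (s a, e a)).1
  have h₂ := Data.size_bits_le ((stretchStep (G (κ a)))^[i] (s a, e a)).2
  have h₃ := length_stretchStep_iterate (G (κ a)) i (s a, e a)
  have h₄ : i * κ a ≤ k a * κ a := Nat.mul_le_mul_right _ hi
  simp only [Data.size_cons] at h₃ ⊢
  omega

variable {Γ : GroupSystem} {d : A → Γ.Desc} {σ : A → ℕ}

theorem order (hd : PolyTime inp fun a => Γ.encDesc (d a)) :
    PolyTime inp fun a => Data.binary (Γ.order (d a)) :=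
  Γ.order_polyTime.comp d hd

theorem el_add {x y : ∀ a, Γ.El (d a)} (hd : PolyTime inp fun a => Γ.encDesc (d a))
    (hx : PolyTime inp fun a => Data.bits (Γ.elBits (x a)))
    (hy : PolyTime inp fun a => Data.bits (Γ.elBits (y a))) :
    PolyTime inp fun a => Data.bits (Γ.elBits (x a + y a)) :=
  Γ.add_polyTime.comp (fun a => ⟨d a, x a, y a⟩) (hd.cons (hx.cons (hy.cons nil)))

theorem el_neg {x : ∀ a, Γ.El (d a)} (hd : PolyTime inp fun a => Γ.encDesc (d a))
    (hx : PolyTime inp fun a => Data.bits (Γ.elBits (x a))) :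
    PolyTime inp fun a => Data.bits (Γ.elBits (-x a)) :=
  Γ.neg_polyTime.comp (fun a => ⟨d a, x a⟩) (hd.cons (hx.cons nil))

theorem elOfNat {e : A → List Bool} (hd : PolyTime inp fun a => Γ.encDesc (d a))
    (he : PolyTime inp fun a => Data.bits (e a)) :
    PolyTime inp fun a => Data.bits (Γ.elBits (Γ.elOfNat (d a) (ofBits (e a)))) :=
  (lowBits_mod (order hd) (fun a => Γ.order_pos _) he).congr fun a => by rw [elBits_elOfNat]

theorem convertCalls (hκ : PolyTime inp fun a => Data.unary (κ a))
    (hσ : PolyTime inp fun a => Data.unary (σ a)) (hd : PolyTime inp fun a => Γ.encDesc (d a)) :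
    PolyTime inp fun a => Data.unary (convertCalls (κ a) (σ a) (Γ.order (d a))) :=
  ceil_div hκ (unary_add (clog (order hd)) (slack hσ (order hd)))

theorem convert (hG : PolyTime (fun s : (Σ κ, Bits κ) => s.2.enc) fun s => (G s.1 s.2).enc)
    (hσ : PolyTime inp fun a => Data.unary (σ a)) (hd : PolyTime inp fun a => Γ.encDesc (d a))
    {s : ∀ a, Bits (κ a)} (hs : PolyTime inp fun a => (s a).enc) :
    PolyTime inp (fun a => ((convert Γ (σ a) (d a) (s a)).run (G (κ a))).1.enc) ∧
    PolyTime inp fun a =>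
      Data.bits (Γ.elBits ((convert Γ (σ a) (d a) (s a)).run (G (κ a))).2) := by
  have h := stretch hG (convertCalls (unary_of_enc hs) hσ hd) hs (e := fun _ => [])
    (const (Data.bits []))
  refine ⟨h.fst.congr fun a => ?_, (elOfNat hd h.snd).congr fun a => ?_⟩
  · rw [convert_run, stretchStep_iterate]; rfl
  · rw [convert_run, stretchStep_iterate]; rfl

theorem nextBit {x t tL tR : A → Bool} {y : ∀ a, Bits (2 * κ a + 2)}
    (hκ : PolyTime inp fun a => Data.unary (κ a))
    (hx : PolyTime inp fun a => Data.bool (x a)) (hy : PolyTime inp fun a => (y a).enc)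
    (ht : PolyTime inp fun a => Data.bool (t a)) (hL : PolyTime inp fun a => Data.bool (tL a))
    (hR : PolyTime inp fun a => Data.bool (tR a)) :
    PolyTime inp fun a => Data.bool (nextBit (x a) (y a) (t a) (tL a) (tR a)) :=
  (bitPart hκ hy hx).xor (ht.and ((hx.cond hR hL).congr
    (g := fun a => Data.bool (bif x a then tR a else tL a)) fun a => by cases x a <;> rfl))

theorem nextSeed {x t : A → Bool} {y : ∀ a, Bits (2 * κ a + 2)} {s : ∀ a, Bits (κ a)}
    (hκ : PolyTime inp fun a => Data.unary (κ a))
    (hx : PolyTime inp fun a => Data.bool (x a)) (hy : PolyTime inp fun a => (y a).enc)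
    (ht : PolyTime inp fun a => Data.bool (t a)) (hs : PolyTime inp fun a => (s a).enc) :
    PolyTime inp fun a => (nextSeed (x a) (y a) (t a) (s a)).enc :=
  (seedPart hκ hy hx).xorBits (ht.smulBits hs)

theorem cw {c : ∀ a, CW Γ (κ a) (d a)} (hs : PolyTime inp fun a => (c a).s.enc)
    (hL : PolyTime inp fun a => Data.bool (c a).tL) (hR : PolyTime inp fun a => Data.bool (c a).tR)
    (hW : PolyTime inp fun a => Data.bits (Γ.elBits (c a).W)) :
    PolyTime inp fun a => Data.bits (c a).toBits :=
  bits_append hs (bits_cons hL (bits_cons hR hW))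

theorem valueCW {β W₀ W₁ : ∀ a, Γ.El (d a)} {t : A → Bool}
    (hd : PolyTime inp fun a => Γ.encDesc (d a))
    (hβ : PolyTime inp fun a => Data.bits (Γ.elBits (β a)))
    (ht : PolyTime inp fun a => Data.bool (t a))
    (hW₀ : PolyTime inp fun a => Data.bits (Γ.elBits (W₀ a)))
    (hW₁ : PolyTime inp fun a => Data.bits (Γ.elBits (W₁ a))) :
    PolyTime inp fun a => Data.bits (Γ.elBits (valueCW Γ (β a) (t a) (W₀ a) (W₁ a))) := by
  have hv : PolyTime inp fun a => Data.bits (Γ.elBits (β a - W₀ a + W₁ a)) :=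
    (el_add hd (el_add hd hβ (el_neg hd hW₀)) hW₁).congr fun a => by rw [sub_eq_add_neg]
  refine (ht.cond (el_neg hd hv) hv).congr fun a => ?_
  simp only [IncDPF.valueCW]
  cases t a <;> rfl

section

variable {α : A → Bool} {y₀ y₁ : ∀ a, Bits (2 * κ a + 2)}

theorem seedCW (hκ : PolyTime inp fun a => Data.unary (κ a))
    (hα : PolyTime inp fun a => Data.bool (α a)) (hy₀ : PolyTime inp fun a => (y₀ a).enc)
    (hy₁ : PolyTime inp fun a => (y₁ a).enc) :
    PolyTime inp fun a => (seedCW (α a) (y₀ a) (y₁ a)).enc :=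
  (seedPart hκ hy₀ hα.not).xorBits (seedPart hκ hy₁ hα.not)

theorem leftCW (hκ : PolyTime inp fun a => Data.unary (κ a))
    (hα : PolyTime inp fun a => Data.bool (α a)) (hy₀ : PolyTime inp fun a => (y₀ a).enc)
    (hy₁ : PolyTime inp fun a => (y₁ a).enc) :
    PolyTime inp fun a => Data.bool (leftCW (α a) (y₀ a) (y₁ a)) :=
  (bitPart hκ hy₀ (const (Data.bool false))).xor ((bitPart hκ hy₁ (const (Data.bool false))).xor
    (hα.xor (const (Data.bool true)))) |>.congr fun a => by simp [IncDPF.leftCW]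

theorem rightCW (hκ : PolyTime inp fun a => Data.unary (κ a))
    (hα : PolyTime inp fun a => Data.bool (α a)) (hy₀ : PolyTime inp fun a => (y₀ a).enc)
    (hy₁ : PolyTime inp fun a => (y₁ a).enc) :
    PolyTime inp fun a => Data.bool (rightCW (α a) (y₀ a) (y₁ a)) :=
  (bitPart hκ hy₀ (const (Data.bool true))).xor ((bitPart hκ hy₁ (const (Data.bool true))).xor hα)
    |>.congr fun a => by simp [IncDPF.rightCW]

end

theorem finishLevel {β : ∀ a, Γ.El (d a)} {sCW : ∀ a, Bits (κ a)} {tL tR t₀ t₁ : A → Bool}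
    {r₀ r₁ : ∀ a, Bits (κ a) × Γ.El (d a)} (hd : PolyTime inp fun a => Γ.encDesc (d a))
    (hβ : PolyTime inp fun a => Data.bits (Γ.elBits (β a)))
    (hs : PolyTime inp fun a => (sCW a).enc) (hL : PolyTime inp fun a => Data.bool (tL a))
    (hR : PolyTime inp fun a => Data.bool (tR a)) (h₀ : PolyTime inp fun a => Data.bool (t₀ a))
    (h₁ : PolyTime inp fun a => Data.bool (t₁ a))
    (hs₀ : PolyTime inp fun a => (r₀ a).1.enc)
    (hW₀ : PolyTime inp fun a => Data.bits (Γ.elBits (r₀ a).2))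
    (hs₁ : PolyTime inp fun a => (r₁ a).1.enc)
    (hW₁ : PolyTime inp fun a => Data.bits (Γ.elBits (r₁ a).2)) :
    PolyTime inp (fun a => Data.bits (finishLevel Γ (β a) (sCW a) (tL a) (tR a) (t₀ a) (t₁ a)
      (r₀ a) (r₁ a)).1.toBits) ∧
    PolyTime inp (fun a => (finishLevel Γ (β a) (sCW a) (tL a) (tR a) (t₀ a) (t₁ a)
      (r₀ a) (r₁ a)).2.1.enc) ∧
    PolyTime inp (fun a => (finishLevel Γ (β a) (sCW a) (tL a) (tR a) (t₀ a) (t₁ a)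
      (r₀ a) (r₁ a)).2.2.enc) :=
  ⟨cw hs hL hR (valueCW hd hβ h₁ hW₀ hW₁), hs₀.cons h₀, hs₁.cons h₁⟩

theorem levelFrom (hG : PolyTime (fun s : (Σ κ, Bits κ) => s.2.enc) fun s => (G s.1 s.2).enc)
    (hκ : PolyTime inp fun a => Data.unary (κ a))
    (hσ : PolyTime inp fun a => Data.unary (σ a)) (hd : PolyTime inp fun a => Γ.encDesc (d a))
    {α : A → Bool} (hα : PolyTime inp fun a => Data.bool (α a)) {β : ∀ a, Γ.El (d a)}
    (hβ : PolyTime inp fun a => Data.bits (Γ.elBits (β a)))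
    {y₀ y₁ : ∀ a, Bits (2 * κ a + 2)} (hy₀ : PolyTime inp fun a => (y₀ a).enc)
    (hy₁ : PolyTime inp fun a => (y₁ a).enc) {t₀ t₁ : A → Bool}
    (h₀ : PolyTime inp fun a => Data.bool (t₀ a)) (h₁ : PolyTime inp fun a => Data.bool (t₁ a)) :
    PolyTime inp (fun a => Data.bits (levelFrom Γ (G (κ a)) (σ a) (d a) (α a) (β a) (y₀ a) (y₁ a)
      (t₀ a) (t₁ a)).1.toBits) ∧
    PolyTime inp (fun a => (levelFrom Γ (G (κ a)) (σ a) (d a) (α a) (β a) (y₀ a) (y₁ a)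
      (t₀ a) (t₁ a)).2.1.enc) ∧
    PolyTime inp (fun a => (levelFrom Γ (G (κ a)) (σ a) (d a) (α a) (β a) (y₀ a) (y₁ a)
      (t₀ a) (t₁ a)).2.2.enc) := by
  have hs := seedCW hκ hα hy₀ hy₁
  have hL := leftCW hκ hα hy₀ hy₁
  have hR := rightCW hκ hα hy₀ hy₁
  have hc₀ := convert hG hσ hd (nextSeed hκ hα hy₀ h₀ hs)
  have hc₁ := convert hG hσ hd (nextSeed hκ hα hy₁ h₁ hs)
  exact finishLevel hd hβ hs hL hR (nextBit hκ hα hy₀ h₀ hL hR) (nextBit hκ hα hy₁ h₁ hL hR)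
    hc₀.1 hc₀.2 hc₁.1 hc₁.2

end PolyTime

/-! ### The loops over the levels as folds -/

section

variable (Γ : GroupSystem)

/-- The data of one level of an all-prefix point function. -/
abbrev LevelItem : Type := Σ d : Γ.Desc, Bool × Γ.El d

variable {Γ}

/-- A level of an all-prefix point function as machine data. -/
def LevelItem.enc (e : LevelItem Γ) : Data :=
  Data.list [Data.bool e.2.1, Γ.encDesc e.1, Data.bits (Γ.elBits e.2.2)]

/-- The list of the levels of an all-prefix point function. -/
def levelItems {n : ℕ} (grp : Fin n → Γ.Desc) (α : Fin n → Bool) (β : ∀ ℓ, Γ.El (grp ℓ)) :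
    List (LevelItem Γ) :=
  List.ofFn fun ℓ => ⟨grp ℓ, α ℓ, β ℓ⟩

theorem PointFn.enc_eq (F : PointFn Γ) :
    F.enc = Data.list ((levelItems F.grp F.α F.β).map LevelItem.enc) := by
  rw [levelItems, List.map_ofFn]
  rfl

/-- The encoding contains a full-length group element. Hence the correction words, which carry
elements of the same groups, are polynomial in the size of the input. -/
theorem LevelItem.clog_le_size (e : LevelItem Γ) : Nat.clog 2 (Γ.order e.1) ≤ e.enc.size := by
  have := Data.length_le_size_bits (Γ.elBits e.2.2)
  simp only [GroupSystem.elBits, length_lowBits] at this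
  simp only [LevelItem.enc, Data.size_list_cons, GroupSystem.elBits]
  omega

section

variable {κ : ℕ} (G : Bits κ → Bits (2 * κ + 2)) (σ : ℕ)

/-- One level of the key generation as a step of a loop that collects the correction words. -/
noncomputable def genStep (s : EvalState κ × EvalState κ × List Data) (e : LevelItem Γ) :
    EvalState κ × EvalState κ × List Data :=
  ((levelFrom Γ G σ e.1 e.2.1 e.2.2 (G s.1.s) (G s.2.1.s) s.1.t s.2.1.t).2.1,
    (levelFrom Γ G σ e.1 e.2.1 e.2.2 (G s.1.s) (G s.2.1.s) s.1.t s.2.1.t).2.2,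
    s.2.2 ++ [Data.bits
      (levelFrom Γ G σ e.1 e.2.1 e.2.2 (G s.1.s) (G s.2.1.s) s.1.t s.2.1.t).1.toBits])

/-- Public parameters as a list of machine data. -/
def ppList {n : ℕ} {grp : Fin n → Γ.Desc} (pp : ∀ ℓ, CW Γ κ (grp ℓ)) : List Data :=
  List.ofFn fun ℓ => Data.bits (pp ℓ).toBits

theorem ppList_cons {n : ℕ} {grp : Fin (n + 1) → Γ.Desc} (c : CW Γ κ (grp 0))
    (pp : ∀ ℓ : Fin n, CW Γ κ (grp ℓ.succ)) :
    ppList (Fin.cons (α := fun ℓ => CW Γ κ (grp ℓ)) c pp) = Data.bits c.toBits :: ppList pp := by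
  simp [ppList, List.ofFn_succ]

/-- The types of the correction words vary with the level, so the loop collects their encodings,
which form an ordinary list. -/
theorem foldl_genStep {n : ℕ} (grp : Fin n → Γ.Desc) (α : Fin n → Bool)
    (β : ∀ ℓ, Γ.El (grp ℓ)) (st₀ st₁ : EvalState κ) (out : List Data) :
    ((levelItems grp α β).foldl (genStep G σ) (st₀, st₁, out)).2.2 =
      out ++ ppList ((genLoop Γ σ n grp α β st₀ st₁).run G) := by
  induction n generalizing st₀ st₁ out with
  | zero => simp [levelItems, ppList]
  | succ n ih =>
    have := ih (fun ℓ => grp ℓ.succ) (fun ℓ => α ℓ.succ) (fun ℓ => β ℓ.succ)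
    simp only [levelItems] at this ⊢
    rw [List.ofFn_succ, List.foldl_cons, genStep, this, genLoop_succ_run, ppList_cons,
      genLevel_run]
    simp

/-- Each level appends one word of at most `κ + 2 + C` bits. A bit takes at most four nodes, and the
two extra nodes are the end of the word and the list cell that holds it. -/
theorem size_foldl_genStep_le {C : ℕ} (l : List (LevelItem Γ))
    (h : ∀ e ∈ l, Nat.clog 2 (Γ.order e.1) ≤ C) (s : EvalState κ × EvalState κ × List Data) :
    (Data.list (l.foldl (genStep G σ) s).2.2).size ≤
      (Data.list s.2.2).size + l.length * (4 * (κ + 2 + C) + 2) := by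
  induction l generalizing s with
  | nil => simp
  | cons e l ih =>
    rw [List.foldl_cons]
    refine (ih (fun e he => h e (by simp [he])) _).trans ?_
    have h₁ := Data.size_bits_le
      (levelFrom Γ G σ e.1 e.2.1 e.2.2 (G s.1.s) (G s.2.1.s) s.1.t s.2.1.t).1.toBits
    rw [CW.length_toBits] at h₁
    have h₂ := h e (by simp)
    have h₃ := Data.size_list_append s.2.2 [Data.bits
      (levelFrom Γ G σ e.1 e.2.1 e.2.2 (G s.1.s) (G s.2.1.s) s.1.t s.2.1.t).1.toBits]
    simp only [Data.size_list_cons, Data.list_nil, Data.size_nil] at h₃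
    simp only [genStep, List.length_cons, Nat.add_mul]
    omega

/-- One level of the evaluation as a step of a loop that keeps the last share. -/
noncomputable def evalStep (b : Bool) (s : EvalState κ × List Bool)
    (e : Σ d : Γ.Desc, CW Γ κ d × Bool) : EvalState κ × List Bool :=
  (((evalNextAlg Γ σ b s.1 e.1 e.2.1 e.2.2).run G).1,
    Γ.elBits ((evalNextAlg Γ σ b s.1 e.1 e.2.1 e.2.2).run G).2)

/-- Every step overwrites the stored share, and at least one step is made, so the initial value `w`
leaves no trace. -/
theorem foldl_evalStep (b : Bool) : ∀ {n : ℕ} (grp : Fin n → Γ.Desc) (pp : ∀ ℓ, CW Γ κ (grp ℓ))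
    (st : EvalState κ) (w : List Bool) (ℓ : Fin n) (x : Bits (ℓ + 1)),
    ((List.ofFn fun j : Fin (ℓ + 1) => (⟨grp (j.castLE ℓ.isLt), pp (j.castLE ℓ.isLt), x j⟩ :
      Σ d : Γ.Desc, CW Γ κ d × Bool)).foldl (evalStep G σ b) (st, w)).2 =
      Γ.elBits ((evalLoop Γ σ b n grp pp st ℓ x).run G)
  | 0, _, _, _, _, ℓ, _ => ℓ.elim0
  | n + 1, grp, pp, st, w, ⟨0, h⟩, x => by
      simp [List.ofFn_succ, evalLoop, evalStep]
      rfl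
  | n + 1, grp, pp, st, w, ⟨ℓ + 1, h⟩, x => by
      rw [evalLoop, PRGComp.run_bind,
        ← foldl_evalStep b (fun j => grp j.succ) (fun j => pp j.succ) _
          (Γ.elBits ((evalNextAlg Γ σ b st (grp 0) (pp 0) (x 0)).run G).2)
          ⟨ℓ, Nat.lt_of_succ_lt_succ h⟩ (fun j => x j.succ), List.ofFn_succ, List.foldl_cons]
      rfl

end

namespace PolyTime

variable {A : Type} {inp : A → Data} {κ σ : A → ℕ} {G : ∀ κ, Bits κ → Bits (2 * κ + 2)}

theorem genLoop (hG : PolyTime (fun s : (Σ κ, Bits κ) => s.2.enc) fun s => (G s.1 s.2).enc)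
    (hκ : PolyTime inp fun a => Data.unary (κ a)) (hσ : PolyTime inp fun a => Data.unary (σ a))
    {F : A → PointFn Γ} (hF : PolyTime inp fun a => (F a).enc) {st₀ st₁ : ∀ a, EvalState (κ a)}
    (h₀ : PolyTime inp fun a => (st₀ a).enc) (h₁ : PolyTime inp fun a => (st₁ a).enc) :
    PolyTime inp fun a => Data.list (ppList ((genLoop Γ (σ a) (F a).n (F a).grp (F a).α (F a).β
      (st₀ a) (st₁ a)).run (G (κ a)))) := by
  let S : A → Type := fun a => EvalState (κ a) × EvalState (κ a) × List Data
  let encS : ∀ a, S a → Data := fun a s =>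
    Data.cons s.1.enc (Data.cons s.2.1.enc (Data.list s.2.2))
  let inp' : (Σ a, S a × LevelItem Γ) → Data := fun x =>
    Data.cons (inp x.1) (Data.cons (encS x.1 x.2.1) x.2.2.enc)
  have hi : PolyTime inp' inp' := .id
  have hlev := levelFrom (inp := inp') (κ := fun x => κ x.1) (σ := fun x => σ x.1)
    (d := fun x => x.2.2.1) (α := fun x => x.2.2.2.1) (β := fun x => x.2.2.2.2)
    (y₀ := fun x => G (κ x.1) x.2.1.1.s) (y₁ := fun x => G (κ x.1) x.2.1.2.1.s)
    (t₀ := fun x => x.2.1.1.t) (t₁ := fun x => x.2.1.2.1.t) hG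
    (hκ.comp Sigma.fst hi.fst) (hσ.comp Sigma.fst hi.fst) hi.snd.snd.snd.fst hi.snd.snd.fst
    hi.snd.snd.snd.snd.fst (generator hG hi.snd.fst.fst.fst) (generator hG hi.snd.fst.snd.fst.fst)
    hi.snd.fst.fst.snd hi.snd.fst.snd.fst.snd
  have hF' : PolyTime inp fun a => Data.list ((levelItems (F a).grp (F a).α (F a).β).map
      LevelItem.enc) := hF.congr fun a => (F a).enc_eq
  have := foldl (inp := inp) (S := S) (E := fun _ => LevelItem Γ) (encS := encS)
    (encE := fun _ => LevelItem.enc) (step := fun a => genStep (G (κ a)) (σ a))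
    (hlev.2.1.cons (hlev.2.2.cons (append hi.snd.fst.snd.snd (hlev.1.cons nil))))
    (l := fun a => levelItems (F a).grp (F a).α (F a).β) hF'
    (s := fun a => (st₀ a, st₁ a, [])) (h₀.cons (h₁.cons nil))
    (m := fun a => (4 * κ a + 5) + ((4 * κ a + 5) + (1 + (F a).enc.size *
      (4 * (κ a + 2 + (F a).enc.size) + 2)) + 1) + 1) ?_ ?_
  · exact this.snd.snd.congr fun a => congrArg Data.list ((foldl_genStep (G (κ a)) (σ a) (F a).grp
      (F a).α (F a).β (st₀ a) (st₁ a) []).trans (List.nil_append _))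
  · have h4 : PolyBdd inp fun a => 4 * κ a + 5 :=
      ((PolyBdd.const 4).mul (unary_bdd hκ)).add (.const 5)
    exact (h4.add ((h4.add ((PolyBdd.const 1).add (hF.bdd.mul (((PolyBdd.const 4).mul
      (((unary_bdd hκ).add (.const 2)).add hF.bdd)).add (.const 2))))).add (.const 1))).add
      (.const 1)
  · intro a l' hl'
    have hmem : ∀ e ∈ l', e.enc.size ≤ (F a).enc.size := fun e he => by
      rw [PointFn.enc_eq]
      exact (Data.size_lt_of_mem (List.mem_map_of_mem (hl'.subset he))).le
    have h := size_foldl_genStep_le (G (κ a)) (σ a) l'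
      (fun e he => e.clog_le_size.trans (hmem e he)) (st₀ a, st₁ a, [])
    have hlen : l'.length ≤ (F a).enc.size := by
      rw [PointFn.enc_eq]
      refine hl'.length_le.trans ?_
      simpa using Data.length_le_size_list
        ((levelItems (F a).grp (F a).α (F a).β).map LevelItem.enc)
    have h' := Nat.mul_le_mul_right (4 * (κ a + 2 + (F a).enc.size) + 2) hlen
    generalize l'.foldl (genStep (G (κ a)) (σ a)) (st₀ a, st₁ a, []) = r at h ⊢
    have h₂ := r.1.size_enc_le
    have h₃ := r.2.1.size_enc_le
    simp only [encS, Data.size_cons, Data.list_nil, Data.size_nil] at h ⊢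
    omega

theorem evalNext (hG : PolyTime (fun s : (Σ κ, Bits κ) => s.2.enc) fun s => (G s.1 s.2).enc)
    (hκ : PolyTime inp fun a => Data.unary (κ a)) (hσ : PolyTime inp fun a => Data.unary (σ a))
    {b : A → Bool} (hb : PolyTime inp fun a => Data.bool (b a)) {st : ∀ a, EvalState (κ a)}
    (hst : PolyTime inp fun a => (st a).enc) {d : A → Γ.Desc}
    (hd : PolyTime inp fun a => Γ.encDesc (d a)) {c : ∀ a, CW Γ (κ a) (d a)}
    (hc : PolyTime inp fun a => Data.bits (c a).toBits) {x : A → Bool}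
    (hx : PolyTime inp fun a => Data.bool (x a)) :
    PolyTime inp (fun a => ((evalNextAlg Γ (σ a) (b a) (st a) (d a) (c a) (x a)).run
      (G (κ a))).1.enc) ∧
    PolyTime inp fun a => Data.bits (Γ.elBits
      ((evalNextAlg Γ (σ a) (b a) (st a) (d a) (c a) (x a)).run (G (κ a))).2) := by
  -- The correction word is parsed by position: `κ` seed bits, two control bits, and then the group
  -- element.
  have hs : PolyTime inp fun a => (c a).s.enc :=
    (bits_take hc hκ).congr fun a => by
      rw [Bits.enc, CW.toBits, List.take_left' (by simp)]
  have hrest : PolyTime inp fun a => Data.bits ((c a).tL :: (c a).tR :: Γ.elBits (c a).W) :=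
    (bits_drop hc hκ).congr fun a => by
      rw [CW.toBits, List.drop_left' (by simp)]
  have hL : PolyTime inp fun a => Data.bool (c a).tL := hrest.fst
  have hR : PolyTime inp fun a => Data.bool (c a).tR := hrest.snd.fst
  have hW : PolyTime inp fun a => Data.bits (Γ.elBits (c a).W) := hrest.snd.snd
  have hy : PolyTime inp fun a => (G (κ a) (st a).s).enc := generator hG hst.fst
  have ht : PolyTime inp fun a => Data.bool (st a).t := hst.snd
  have hbit := nextBit hκ hx hy ht hL hR
  have hconv := convert hG hσ hd (nextSeed hκ hx hy ht hs)
  refine ⟨(hconv.1.cons hbit).congr fun a => ?_, ?_⟩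
  · rw [evalNextAlg_run]
    rfl
  · have hV := (hbit.cond (el_add hd hconv.2 hW) hconv.2).congr (g := fun a => Data.bits (Γ.elBits
      (bif IncDPF.nextBit (x a) (G (κ a) (st a).s) (st a).t (c a).tL (c a).tR then
          ((IncDPF.convert Γ (σ a) (d a) (IncDPF.nextSeed (x a) (G (κ a) (st a).s) (st a).t
            (c a).s)).run (G (κ a))).2 + (c a).W else
          ((IncDPF.convert Γ (σ a) (d a) (IncDPF.nextSeed (x a) (G (κ a) (st a).s) (st a).t
            (c a).s)).run (G (κ a))).2))) fun a => by
      cases IncDPF.nextBit (x a) (G (κ a) (st a).s) (st a).t (c a).tL (c a).tR <;> rfl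
    refine (hb.cond (el_neg hd hV) hV).congr fun a => ?_
    rw [evalNextAlg_run]
    cases b a <;> rfl

theorem evalLoop (hG : PolyTime (fun s : (Σ κ, Bits κ) => s.2.enc) fun s => (G s.1 s.2).enc)
    (hκ : PolyTime inp fun a => Data.unary (κ a)) (hσ : PolyTime inp fun a => Data.unary (σ a))
    {b : A → Bool} (hb : PolyTime inp fun a => Data.bool (b a)) {st : ∀ a, EvalState (κ a)}
    (hst : PolyTime inp fun a => (st a).enc) {S : A → Shape Γ}
    (hS : PolyTime inp fun a => (S a).enc) {pp : ∀ a ℓ, CW Γ (κ a) ((S a).grp ℓ)}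
    (hpp : PolyTime inp fun a => Data.list (ppList (pp a))) {ℓ : ∀ a, Fin (S a).n}
    {x : ∀ a, Bits (ℓ a + 1)} (hx : PolyTime inp fun a => (x a).enc) :
    PolyTime inp fun a => Data.bits (Γ.elBits
      ((evalLoop Γ (σ a) (b a) (S a).n (S a).grp (pp a) (st a) (ℓ a) (x a)).run (G (κ a)))) := by
  let E : A → Type := fun a => Σ d : Γ.Desc, CW Γ (κ a) d × Bool
  let encE : ∀ a, E a → Data := fun a e =>
    Data.cons (Data.cons (Γ.encDesc e.1) (Data.bits e.2.1.toBits)) (Data.bool e.2.2)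
  let l : ∀ a, List (E a) := fun a => List.ofFn fun j : Fin (ℓ a + 1) =>
    ⟨(S a).grp (j.castLE (ℓ a).isLt), pp a (j.castLE (ℓ a).isLt), x a j⟩
  have hl : PolyTime inp fun a => Data.list ((l a).map (encE a)) := by
    -- Zipping with the prefix discards the levels beyond its last bit.
    refine ((hS.zip hpp).zip hx).congr fun a => ?_
    congr 1
    have := (ℓ a).isLt
    apply List.ext_getElem
    · simp [l, ppList]
    · intros
      simp [l, ppList, encE, -List.ofFn_succ]
  let enc : ∀ a, EvalState (κ a) × List Bool → Data := fun a s =>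
    Data.cons s.1.enc (Data.bits s.2)
  let inp' : (Σ a, (EvalState (κ a) × List Bool) × E a) → Data := fun x =>
    Data.cons (inp x.1) (Data.cons (enc x.1 x.2.1) (encE x.1 x.2.2))
  have hi : PolyTime inp' inp' := .id
  have hnext := evalNext (inp := inp') (κ := fun x => κ x.1) (σ := fun x => σ x.1)
    (b := fun x => b x.1) (st := fun x => x.2.1.1) (d := fun x => x.2.2.1)
    (c := fun x => x.2.2.2.1) (x := fun x => x.2.2.2.2) hG (hκ.comp Sigma.fst hi.fst)
    (hσ.comp Sigma.fst hi.fst) (hb.comp Sigma.fst hi.fst) hi.snd.fst.fst hi.snd.snd.fst.fst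
    hi.snd.snd.fst.snd hi.snd.snd.snd
  have := foldl (inp := inp) (S := fun a => EvalState (κ a) × List Bool) (E := E) (encS := enc)
    (encE := encE) (step := fun a => evalStep (G (κ a)) (σ a) (b a)) (hnext.1.cons hnext.2)
    hl (s := fun a => (st a, [])) (hst.cons nil)
    (m := fun a => (4 * κ a + 5) + (4 * (Data.list (ppList (pp a))).size + 1) + 1) ?_ ?_
  · exact this.snd.congr fun a => congrArg Data.bits (foldl_evalStep (G (κ a)) (σ a) (b a)
      (S a).grp (pp a) (st a) [] (ℓ a) (x a))
  · exact ((((PolyBdd.const 4).mul (unary_bdd hκ)).add (.const 5)).add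
      (((PolyBdd.const 4).mul hpp.bdd).add (.const 1))).add (.const 1)
  · intro a l' hl'
    have h₁ := (l'.foldl (evalStep (G (κ a)) (σ a) (b a)) (st a, [])).1.size_enc_le
    -- The stored share belongs to the last group read, and the correction word of that level
    -- contains an element of the same group, so the share is no longer than the word.
    have h₂ : (l'.foldl (evalStep (G (κ a)) (σ a) (b a)) (st a, [])).2.length ≤
        (Data.list (ppList (pp a))).size := by
      rcases List.eq_nil_or_concat l' with rfl | ⟨l'', e, rfl⟩
      · simp
      · have he : e ∈ l a := hl'.subset (by simp)
        obtain ⟨j, rfl⟩ := List.mem_ofFn.1 he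
        rw [List.concat_eq_append, List.foldl_append, List.foldl_cons, List.foldl_nil]
        simp only [evalStep, GroupSystem.elBits, length_lowBits]
        have h₃ := (pp a (j.castLE (ℓ a).isLt)).length_toBits
        have h₄ := Data.length_le_size_bits (pp a (j.castLE (ℓ a).isLt)).toBits
        have h₅ : (Data.bits (pp a (j.castLE (ℓ a).isLt)).toBits).size <
            (Data.list (ppList (pp a))).size :=
          Data.size_lt_of_mem (List.mem_ofFn.2 ⟨_, rfl⟩)
        omega
    have h₃ := Data.size_bits_le (l'.foldl (evalStep (G (κ a)) (σ a) (b a)) (st a, [])).2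
    simp only [enc, Data.size_cons]
    omega

end PolyTime

end

/-! ### Random coins, encoded keys and the efficiency of the scheme -/

theorem uniformOfFintype_map_bijective {α β : Type} [Fintype α] [Nonempty α] [Fintype β]
    [Nonempty β] {f : α → β} (hf : Function.Bijective f) :
    (PMF.uniformOfFintype α).map f = PMF.uniformOfFintype β := by
  classical
  ext b
  obtain ⟨a, rfl⟩ := hf.2 b
  rw [PMF.map_apply, tsum_eq_single a]
  · simp [Fintype.card_of_bijective hf]
  · intro a' ha'
    rw [if_neg fun h => ha' (hf.1 h).symm]

theorem genAlg_run {Γ : GroupSystem} {κ : ℕ} (G : Bits κ → Bits (2 * κ + 2)) (σ : ℕ)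
    (F : PointFn Γ) (s₀ s₁ : Bits κ) : (genAlg Γ σ F s₀ s₁).run G =
      (s₀, s₁, (genLoop Γ σ F.n F.grp F.α F.β ⟨s₀, false⟩ ⟨s₁, true⟩).run G) := by
  simp only [genAlg, PRGComp.run_bind, PRGComp.run_pure]

namespace PolyTime

variable {Γ : GroupSystem} {A : Type} {inp : A → Data} {κ : A → ℕ} {σ : ℕ → ℕ}
  {G : ∀ κ, Bits κ → Bits (2 * κ + 2)}

theorem shape {F : A → PointFn Γ} (hF : PolyTime inp fun a => (F a).enc) :
    PolyTime inp fun a => (F a).toShape.enc :=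
  (map_data (f := fun x => x.snd.fst) PolyTime.id.snd.fst hF).congr fun a => by
    rw [List.map_ofFn]
    rfl

theorem encPP {S : A → Shape Γ} {pp : ∀ a ℓ, CW Γ (κ a) ((S a).grp ℓ)}
    (hκ : PolyTime inp fun a => Data.unary (κ a)) (hS : PolyTime inp fun a => (S a).enc)
    (hpp : PolyTime inp fun a => Data.list (ppList (pp a))) :
    PolyTime inp fun a => (idpf Γ σ G).encPP (κ := κ a) (S := S a) (pp a) :=
  hκ.cons (hS.cons (hpp.cons nil))

theorem encPP_genLoop (hG : PolyTime (fun s : (Σ κ, Bits κ) => s.2.enc) fun s => (G s.1 s.2).enc)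
    (hσ : PolyTime Data.unary fun κ => Data.unary (σ κ))
    (hκ : PolyTime inp fun a => Data.unary (κ a))
    {F : A → PointFn Γ} (hF : PolyTime inp fun a => (F a).enc) {s₀ s₁ : ∀ a, Bits (κ a)}
    (h₀ : PolyTime inp fun a => (s₀ a).enc) (h₁ : PolyTime inp fun a => (s₁ a).enc) :
    PolyTime inp fun a => (idpf Γ σ G).encPP (κ := κ a) (S := (F a).toShape)
      ((IncDPF.genLoop Γ (σ (κ a)) (F a).n (F a).grp (F a).α (F a).β ⟨s₀ a, false⟩
        ⟨s₁ a, true⟩).run (G (κ a))) :=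
  encPP hκ (shape hF) (genLoop hG hκ (hσ.comp κ hκ) hF
    (st₀ := fun a => ⟨s₀ a, false⟩) (st₁ := fun a => ⟨s₁ a, true⟩)
    (h₀.cons (const (Data.bool false))) (h₁.cons (const (Data.bool true))))

end PolyTime

section

variable (Γ : GroupSystem) (σ : ℕ → ℕ) (G : ∀ κ, Bits κ → Bits (2 * κ + 2))

/-- The two halves of a string of `κ + κ` coins. -/
def splitCoins {κ : ℕ} (c : Bits (κ + κ)) : Bits κ × Bits κ :=
  (fun j => c (Fin.castAdd κ j), fun j => c (Fin.natAdd κ j))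

theorem splitCoins_bijective (κ : ℕ) : Function.Bijective (splitCoins (κ := κ)) :=
  (Fin.appendEquiv κ κ).symm.bijective

theorem enc_splitCoins {A : Type} {inp : A → Data} {κ : A → ℕ} {c : ∀ a, Bits (κ a + κ a)}
    (hκ : PolyTime inp fun a => Data.unary (κ a)) (hc : PolyTime inp fun a => (c a).enc) :
    PolyTime inp (fun a => (splitCoins (c a)).1.enc) ∧
      PolyTime inp fun a => (splitCoins (c a)).2.enc := by
  have h : ∀ a, List.ofFn (c a) =
      List.ofFn (splitCoins (c a)).1 ++ List.ofFn (splitCoins (c a)).2 := fun a => by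
    rw [List.ofFn_add]
    rfl
  constructor
  · refine (PolyTime.bits_take hc hκ).congr fun a => ?_
    rw [h, List.take_left' (by simp), Bits.enc]
  · refine (PolyTime.bits_drop hc hκ).congr fun a => ?_
    rw [h, List.drop_left' (by simp), Bits.enc]

/-- A probabilistic algorithm draws one string of coins; cutting `κ + κ` coins in half is a
bijection onto pairs of seeds and so preserves uniformity. -/
theorem gen_eq_map (κ : ℕ) (F : PointFn Γ) : (idpf Γ σ G).gen κ F =
    (PMF.uniformOfFintype (Bits (κ + κ))).map fun c =>
      ((splitCoins c).1, (splitCoins c).2, (genLoop Γ (σ κ) F.n F.grp F.α F.β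
        ⟨(splitCoins c).1, false⟩ ⟨(splitCoins c).2, true⟩).run (G κ)) := by
  change (PMF.uniformOfFintype (Bits κ × Bits κ)).map _ = _
  rw [← uniformOfFintype_map_bijective (splitCoins_bijective κ), PMF.map_comp]
  congr 1
  funext c
  exact genAlg_run (G κ) (σ κ) F _ _

theorem idpf_isEfficient (hG : PolyTime (fun s : (Σ κ, Bits κ) => s.2.enc)
      fun s => (G s.1 s.2).enc) (hσ : PolyTime Data.unary fun κ => Data.unary (σ κ)) :
    (idpf Γ σ G).IsEfficient := by
  refine ⟨⟨fun a => a.1 + a.1, fun a c =>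
    ((splitCoins c).1, (splitCoins c).2, (genLoop Γ (σ a.1) a.2.n a.2.grp a.2.α a.2.β
      ⟨(splitCoins c).1, false⟩ ⟨(splitCoins c).2, true⟩).run (G a.1)), ?_, ?_, ?_⟩, ?_, ?_⟩
  · exact PolyTime.unary_add PolyTime.id.fst PolyTime.id.fst
  · let inp : (Σ a : ℕ × PointFn Γ, Bits (a.1 + a.1)) → Data := fun x =>
      Data.cons (Data.list [Data.unary x.1.1, x.1.2.enc]) x.2.enc
    have hi : PolyTime inp inp := .id
    have hs := enc_splitCoins (inp := inp) (κ := fun x => x.1.1) (c := fun x => x.2)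
      hi.fst.fst hi.snd
    exact hs.1.cons (hs.2.cons ((PolyTime.encPP_genLoop (σ := σ) (inp := inp) (κ := fun x => x.1.1)
      (F := fun x => x.1.2) hG hσ hi.fst.fst hi.fst.snd.fst hs.1 hs.2).cons .nil))
  · exact fun a => gen_eq_map Γ σ G a.1 a.2
  · let inp : (Σ κ, Bool × EvalState κ × (Σ d, CW Γ κ d) × Bool) → Data := fun a =>
      Data.list [Data.unary a.1, Data.bool a.2.1, Data.bits a.2.2.1.toBits,
        Γ.encDesc a.2.2.2.1.1, Data.bits a.2.2.2.1.2.toBits, Data.bool a.2.2.2.2]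
    have hi : PolyTime inp inp := .id
    have hκ : PolyTime inp fun a => Data.unary a.1 := hi.fst
    have hst : PolyTime inp fun a => Data.bits a.2.2.1.toBits := hi.snd.snd.fst
    have hs : PolyTime inp fun a => a.2.2.1.s.enc :=
      (PolyTime.bits_take hst hκ).congr fun a => by
        rw [EvalState.toBits, List.take_left' (by simp), Bits.enc]
    have ht : PolyTime inp fun a => Data.bits [a.2.2.1.t] :=
      (PolyTime.bits_drop hst hκ).congr fun a => by
        rw [EvalState.toBits, List.drop_left' (by simp)]
    have := PolyTime.evalNext (inp := inp) (κ := fun a => a.1) (σ := fun a => σ a.1)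
      (b := fun a => a.2.1) (st := fun a => a.2.2.1) (d := fun a => a.2.2.2.1.1)
      (c := fun a => a.2.2.2.1.2) (x := fun a => a.2.2.2.2) hG hκ (hσ.comp Sigma.fst hκ)
      hi.snd.fst (hs.cons ht.fst) hi.snd.snd.snd.fst hi.snd.snd.snd.snd.fst
      hi.snd.snd.snd.snd.snd.fst
    exact (PolyTime.bits_append this.1.fst (PolyTime.bits_cons this.1.snd .nil)).cons
      (this.2.cons .nil)
  · let inp : (Σ (κ : ℕ) (S : Shape Γ), Bool × (Bits κ × (∀ ℓ, CW Γ κ (S.grp ℓ))) ×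
        (Σ ℓ : Fin S.n, Bits (ℓ + 1))) → Data := fun a =>
      Data.list [Data.bool a.2.2.1, (idpf Γ σ G).encView (κ := a.1) (S := a.2.1) a.2.2.2.1,
        a.2.2.2.2.2.enc]
    have hi : PolyTime inp inp := .id
    exact PolyTime.evalLoop (inp := inp) (κ := fun a => a.1) (σ := fun a => σ a.1)
      (b := fun a => a.2.2.1) (st := fun a => ⟨a.2.2.2.1.1, a.2.2.1⟩) (S := fun a => a.2.1)
      (pp := fun a => a.2.2.2.1.2) (ℓ := fun a => a.2.2.2.2.1) (x := fun a => a.2.2.2.2.2) hG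
      hi.snd.fst.snd.fst (hσ.comp Sigma.fst hi.snd.fst.snd.fst) hi.fst
      (hi.snd.fst.fst.cons hi.fst) hi.snd.fst.snd.snd.fst hi.snd.fst.snd.snd.snd.fst
      hi.snd.snd.fst

end

/-! ### Correctness -/

section

variable {κ : ℕ} {Γ : GroupSystem} (G : Bits κ → Bits (2 * κ + 2)) (σ : ℕ)

/-- The correction on the kept side is the sum of the two raw bits plus `1`, and exactly one server
adds it, as the old bits are opposite. -/
theorem nextBit_keep (a : Bool) (y₀ y₁ : Bits (2 * κ + 2)) (t : Bool) :
    nextBit a y₁ (!t) (leftCW a y₀ y₁) (rightCW a y₀ y₁) =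
      !nextBit a y₀ t (leftCW a y₀ y₁) (rightCW a y₀ y₁) := by
  simp only [nextBit, leftCW, rightCW]
  cases a <;> cases t <;> cases bitPart false y₀ <;> cases bitPart false y₁ <;>
    cases bitPart true y₀ <;> cases bitPart true y₁ <;> rfl

/-- Here the correction is just the sum of the two raw bits; added by exactly one server, it cancels
their difference. -/
theorem nextBit_lose (a : Bool) (y₀ y₁ : Bits (2 * κ + 2)) (t : Bool) :
    nextBit (!a) y₁ (!t) (leftCW a y₀ y₁) (rightCW a y₀ y₁) =
      nextBit (!a) y₀ t (leftCW a y₀ y₁) (rightCW a y₀ y₁) := by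
  simp only [nextBit, leftCW, rightCW]
  cases a <;> simp only [Bool.not_false, Bool.not_true] <;> cases t <;>
    cases bitPart false y₀ <;> cases bitPart false y₁ <;> cases bitPart true y₀ <;> cases bitPart true y₁ <;> rfl

theorem nextSeed_lose (a : Bool) (y₀ y₁ : Bits (2 * κ + 2)) (t : Bool) :
    nextSeed (!a) y₁ (!t) (seedCW a y₀ y₁) = nextSeed (!a) y₀ t (seedCW a y₀ y₁) := by
  funext j
  simp only [nextSeed, seedCW, xorBits, smulBits]
  cases t <;> cases seedPart (!a) y₀ j <;> cases seedPart (!a) y₁ j <;> rfl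

theorem evalNextAlg_add_of_eq (st : EvalState κ) (d : Γ.Desc) (c : CW Γ κ d) (x : Bool) :
    ((evalNextAlg Γ σ false st d c x).run G).1 = ((evalNextAlg Γ σ true st d c x).run G).1 ∧
    ((evalNextAlg Γ σ false st d c x).run G).2 + ((evalNextAlg Γ σ true st d c x).run G).2 = 0 := by
  simp only [evalNextAlg_run, cond_false, cond_true, add_neg_cancel, and_self]

/-- The shares add up to `W₀ - W₁ + (t₀' - t₁') W_CW`. The new bits are opposite, so `t₀' - t₁' =
(-1)^(t₁')`, which cancels the sign in `W_CW` and leaves `W₀ - W₁ + (β - W₀ + W₁)`. -/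
theorem evalNextAlg_keep (d : Γ.Desc) (a : Bool) (β : Γ.El d) (s₀ s₁ : Bits κ) (t : Bool) :
    let r := levelFrom Γ G σ d a β (G s₀) (G s₁) t (!t)
    ((evalNextAlg Γ σ false ⟨s₀, t⟩ d r.1 a).run G).1 = r.2.1 ∧
    ((evalNextAlg Γ σ true ⟨s₁, !t⟩ d r.1 a).run G).1 = r.2.2 ∧
    ((evalNextAlg Γ σ false ⟨s₀, t⟩ d r.1 a).run G).2 +
      ((evalNextAlg Γ σ true ⟨s₁, !t⟩ d r.1 a).run G).2 = β := by
  simp only [evalNextAlg_run, levelFrom, finishLevel, true_and, valueCW, nextBit_keep]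
  cases nextBit a (G s₀) t (leftCW a (G s₀) (G s₁)) (rightCW a (G s₀) (G s₁)) <;>
    simp only [cond_false, cond_true, Bool.not_true, Bool.not_false] <;> abel

theorem evalNextAlg_lose (d : Γ.Desc) (a : Bool) (β : Γ.El d) (s₀ s₁ : Bits κ) (t : Bool) :
    let r := levelFrom Γ G σ d a β (G s₀) (G s₁) t (!t)
    ((evalNextAlg Γ σ false ⟨s₀, t⟩ d r.1 (!a)).run G).1 =
      ((evalNextAlg Γ σ true ⟨s₁, !t⟩ d r.1 (!a)).run G).1 ∧
    ((evalNextAlg Γ σ false ⟨s₀, t⟩ d r.1 (!a)).run G).2 +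
      ((evalNextAlg Γ σ true ⟨s₁, !t⟩ d r.1 (!a)).run G).2 = 0 := by
  simp only [evalNextAlg_run, levelFrom, finishLevel, nextBit_lose, nextSeed_lose, cond_false,
    cond_true, add_neg_cancel, and_self]

theorem levelFrom_bit (d : Γ.Desc) (a : Bool) (β : Γ.El d) (y₀ y₁ : Bits (2 * κ + 2)) (t : Bool) :
    (levelFrom Γ G σ d a β y₀ y₁ t (!t)).2.2.t = !(levelFrom Γ G σ d a β y₀ y₁ t (!t)).2.1.t := by
  simp only [levelFrom, finishLevel, nextBit_keep]

theorem evalLoop_add_of_eq : ∀ {n : ℕ} (grp : Fin n → Γ.Desc) (pp : ∀ ℓ, CW Γ κ (grp ℓ))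
    (st : EvalState κ) (ℓ : Fin n) (x : Bits (ℓ + 1)),
    (evalLoop Γ σ false n grp pp st ℓ x).run G + (evalLoop Γ σ true n grp pp st ℓ x).run G = 0
  | 0, _, _, _, ℓ, _ => ℓ.elim0
  | n + 1, grp, pp, st, ⟨0, h⟩, x => by
      simpa only [evalLoop, PRGComp.run_bind, PRGComp.run_pure] using
        (evalNextAlg_add_of_eq G σ st (grp ⟨0, h⟩) (pp ⟨0, h⟩) (x 0)).2
  | n + 1, grp, pp, st, ⟨ℓ + 1, h⟩, x => by
      simp only [evalLoop, PRGComp.run_bind]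
      rw [(evalNextAlg_add_of_eq G σ st (grp 0) (pp 0) (x 0)).1]
      exact evalLoop_add_of_eq (fun j => grp j.succ) (fun j => pp j.succ) _
        ⟨ℓ, Nat.lt_of_succ_lt_succ h⟩ (fun j => x j.succ)

/-- Opposite control bits are the whole invariant; the seeds are arbitrary. A bit equal to `α` hands
the invariant to the next level, and a different bit merges the two states, after which all shares
cancel. -/
theorem evalLoop_genLoop_add : ∀ {n : ℕ} (grp : Fin n → Γ.Desc) (α : Fin n → Bool)
    (β : ∀ ℓ, Γ.El (grp ℓ)) (st₀ st₁ : EvalState κ) (_ : st₁.t = !st₀.t) (ℓ : Fin n)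
    (x : Bits (ℓ + 1)),
    (evalLoop Γ σ false n grp ((genLoop Γ σ n grp α β st₀ st₁).run G) st₀ ℓ x).run G +
      (evalLoop Γ σ true n grp ((genLoop Γ σ n grp α β st₀ st₁).run G) st₁ ℓ x).run G =
      if ∀ j : Fin (ℓ + 1), x j = α (j.castLE ℓ.isLt) then β ℓ else 0
  | 0, _, _, _, _, _, _, ℓ, _ => ℓ.elim0
  | n + 1, grp, α, β, ⟨s₀, t⟩, ⟨s₁, t₁⟩, ht, ⟨0, h⟩, x => by
      obtain rfl : t₁ = !t := ht
      simp only [evalLoop, PRGComp.run_bind, PRGComp.run_pure, genLoop_succ_run, genLevel_run]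
      change ((evalNextAlg Γ σ false _ (grp 0) _ _).run G).2 +
        ((evalNextAlg Γ σ true _ (grp 0) _ _).run G).2 = _
      have hiff : (∀ j : Fin (0 + 1), x j = α (j.castLE h)) ↔ x 0 = α 0 := by
        constructor
        · exact fun h => h 0
        · intro h j
          obtain rfl : j = 0 := Fin.fin_one_eq_zero j
          exact h
      rw [if_congr hiff rfl rfl]
      split_ifs with hx
      · rw [hx]
        exact (evalNextAlg_keep G σ (grp 0) (α 0) (β 0) s₀ s₁ t).2.2
      · rw [Bool.eq_not.2 hx]
        exact (evalNextAlg_lose G σ (grp 0) (α 0) (β 0) s₀ s₁ t).2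
  | n + 1, grp, α, β, ⟨s₀, t⟩, ⟨s₁, t₁⟩, ht, ⟨ℓ + 1, h⟩, x => by
      obtain rfl : t₁ = !t := ht
      have hiff : (∀ j : Fin (ℓ + 1 + 1), x j = α (j.castLE h)) ↔
          x 0 = α 0 ∧ ∀ j : Fin (ℓ + 1), x j.succ =
            α (j.castLE (Nat.lt_of_succ_lt_succ h)).succ := by
        rw [Fin.forall_fin_succ]
        rfl
      rw [if_congr hiff rfl rfl]
      simp only [evalLoop, PRGComp.run_bind, genLoop_succ_run, genLevel_run, Fin.cons_zero,
        Fin.cons_succ]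
      by_cases hx : x 0 = α 0
      · rw [hx]
        obtain ⟨h₀, h₁, -⟩ := evalNextAlg_keep G σ (grp 0) (α 0) (β 0) s₀ s₁ t
        rw [h₀, h₁]
        have := evalLoop_genLoop_add (fun j => grp j.succ) (fun j => α j.succ) (fun j => β j.succ)
          _ _ (levelFrom_bit G σ (grp 0) (α 0) (β 0) (G s₀) (G s₁) t)
          ⟨ℓ, Nat.lt_of_succ_lt_succ h⟩ (fun j => x j.succ)
        refine this.trans ?_
        simp only [true_and]
        rfl
      · rw [if_neg fun h => hx h.1, Bool.eq_not.2 hx,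
          (evalNextAlg_lose G σ (grp 0) (α 0) (β 0) s₀ s₁ t).1]
        exact evalLoop_add_of_eq G σ (fun j => grp j.succ) _ _
          ⟨ℓ, Nat.lt_of_succ_lt_succ h⟩ (fun j => x j.succ)

end

section

variable (Γ : GroupSystem) (σ : ℕ → ℕ) (G : ∀ κ, Bits κ → Bits (2 * κ + 2))

theorem iterNext_eq (κ : ℕ) (b : Bool) : ∀ {n : ℕ} (grp : Fin n → Γ.Desc)
    (pp : ∀ ℓ, CW Γ κ (grp ℓ)) (st : EvalState κ) (ℓ : Fin n) (x : Bits (ℓ + 1)),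
    (idpf Γ σ G).iterNext κ b n grp pp st ℓ x = (evalLoop Γ (σ κ) b n grp pp st ℓ x).run (G κ)
  | 0, _, _, _, ℓ, _ => ℓ.elim0
  | n + 1, grp, pp, st, ⟨0, h⟩, x => by
      simp only [Scheme.iterNext, evalLoop, PRGComp.run_bind, PRGComp.run_pure]
      rfl
  | n + 1, grp, pp, st, ⟨ℓ + 1, h⟩, x => by
      simp only [Scheme.iterNext, evalLoop, PRGComp.run_bind]
      exact iterNext_eq κ b (fun j => grp j.succ) (fun j => pp j.succ) _
        ⟨ℓ, Nat.lt_of_succ_lt_succ h⟩ (fun j => x j.succ)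

theorem idpf_isCorrect : (idpf Γ σ G).IsCorrect := by
  intro κ F ℓ x o ho
  obtain ⟨s, -, rfl⟩ := (PMF.mem_support_map_iff _ _ _).1 ho
  rw [genAlg_run]
  have := evalLoop_genLoop_add (G κ) (σ κ) F.grp F.α F.β ⟨s.1, false⟩ ⟨s.2, true⟩ rfl ℓ x
  exact ⟨(congrArg₂ (· + ·) (iterNext_eq Γ σ G κ false F.grp _ _ ℓ x)
    (iterNext_eq Γ σ G κ true F.grp _ _ ℓ x)).trans this, this⟩

/-! ### Key sizes and numbers of evaluations of the generator -/

theorem length_viewBits (κ : ℕ) (S : Shape Γ) (v : (idpf Γ σ G).View κ S) :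
    ((idpf Γ σ G).viewBits v).length
      = κ + (κ + 2) * S.n + ∑ ℓ, ⌈Real.logb 2 (Γ.order (S.grp ℓ))⌉₊ := by
  have h : ∀ d : Γ.Desc, ⌈Real.logb 2 (Γ.order d)⌉₊ = Nat.clog 2 (Γ.order d) := fun d => by
    exact_mod_cast Real.natCeil_logb_natCast 2 (Γ.order d)
  have key : ∀ (k : Bits κ) (pp : ∀ ℓ, CW Γ κ (S.grp ℓ)),
      (List.ofFn k ++ (List.ofFn fun ℓ => (pp ℓ).toBits).flatten).length
        = κ + (κ + 2) * S.n + ∑ ℓ, ⌈Real.logb 2 (Γ.order (S.grp ℓ))⌉₊ := by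
    intro k pp
    simp only [List.length_append, List.length_ofFn, List.length_flatten, List.map_ofFn,
      List.sum_ofFn, h, Function.comp_apply, CW.length_toBits, Finset.sum_add_distrib,
      Finset.sum_const, Finset.card_univ, Fintype.card_fin, smul_eq_mul]
    ring
  exact key v.1 v.2

/-- Rounding the logarithm up before dividing does no harm: the slack and `j * κ` are integers, so
both sides have the same upper bounds `j`. The summand `1` is the evaluation that expands the state.
-/
theorem cost_eq {κ u : ℕ} (hκ : 0 < κ) (σ : ℕ) : cost κ σ u = 1 + convertCalls κ σ u := by
  rw [cost, convertCalls]
  congr 1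
  have hκ' : (0 : ℝ) < κ := by exact_mod_cast hκ
  refine eq_of_forall_ge_iff fun j => ?_
  have h : ⌈Real.logb 2 u⌉₊ = Nat.clog 2 u := by
    exact_mod_cast Real.natCeil_logb_natCast 2 u
  have h₁ : (Nat.clog 2 u + slack σ u + κ - 1) / κ ≤ j ↔ Nat.clog 2 u + slack σ u ≤ j * κ := by
    rw [← Nat.lt_succ_iff, Nat.div_lt_iff_lt_mul hκ, Nat.succ_mul]
    omega
  rw [h₁, ← h, Nat.ceil_le, div_le_iff₀ hκ']
  have hlog : 0 ≤ Real.logb 2 u := by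
    rcases Nat.eq_zero_or_pos u with rfl | hu
    · simp
    · exact Real.logb_nonneg (by norm_num) (by exact_mod_cast hu)
  rw [← Nat.cast_mul, ← Nat.ceil_le, Nat.ceil_add_natCast hlog]

variable {κ : ℕ} (g : Bits κ → Bits (2 * κ + 2))

theorem stretch_calls (k : ℕ) (s : Bits κ) : (stretch k s).calls g = k := by
  induction k generalizing s with
  | zero => simp [stretch]
  | succ k ih => simp [stretch, ih]; omega

theorem convert_calls (σ : ℕ) (d : Γ.Desc) (s : Bits κ) :
    (convert Γ σ d s).calls g = convertCalls κ σ (Γ.order d) := by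
  simp [convert, stretch_calls]

theorem genLoop_calls (hκ : 0 < κ) (σ : ℕ) {n : ℕ} (grp : Fin n → Γ.Desc) (α : Fin n → Bool)
    (β : ∀ ℓ, Γ.El (grp ℓ)) (st₀ st₁ : EvalState κ) :
    (genLoop Γ σ n grp α β st₀ st₁).calls g = 2 * ∑ ℓ, cost κ σ (Γ.order (grp ℓ)) := by
  induction n generalizing st₀ st₁ with
  | zero => simp [genLoop]
  | succ n ih =>
    simp only [genLoop, PRGComp.calls_bind, PRGComp.calls_pure, ih, Fin.sum_univ_succ]
    simp only [genLevel, PRGComp.calls_bind, PRGComp.calls_pure, PRGComp.calls_eval, convert_calls,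
      cost_eq hκ]
    ring

theorem genAlg_calls (hκ : 0 < κ) (σ : ℕ) (F : PointFn Γ) (s₀ s₁ : Bits κ) :
    (genAlg Γ σ F s₀ s₁).calls g = 2 * ∑ ℓ, cost κ σ (Γ.order (F.grp ℓ)) := by
  simp [genAlg, genLoop_calls Γ g hκ]

theorem evalNextAlg_calls (hκ : 0 < κ) (σ : ℕ) (b : Bool) (st : EvalState κ) (d : Γ.Desc)
    (c : CW Γ κ d) (x : Bool) :
    (evalNextAlg Γ σ b st d c x).calls g = cost κ σ (Γ.order d) := by
  simp [evalNextAlg, convert_calls, cost_eq hκ]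

theorem evalLoop_calls (hκ : 0 < κ) (σ : ℕ) (b : Bool) : ∀ {n : ℕ} (grp : Fin n → Γ.Desc)
    (pp : ∀ ℓ, CW Γ κ (grp ℓ)) (st : EvalState κ) (ℓ : Fin n) (x : Bits (ℓ + 1)),
    (evalLoop Γ σ b n grp pp st ℓ x).calls g =
      ∑ j ∈ Finset.Iic ℓ, cost κ σ (Γ.order (grp j))
  | 0, _, _, _, ℓ, _ => ℓ.elim0
  | n + 1, grp, pp, st, ⟨0, h⟩, x => by
      have : Finset.Iic (⟨0, h⟩ : Fin (n + 1)) = {0} := by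
        ext j
        simp
      simp only [evalLoop, PRGComp.calls_bind, PRGComp.calls_pure, evalNextAlg_calls Γ g hκ, this,
        Finset.sum_singleton]
      rfl
  | n + 1, grp, pp, st, ⟨ℓ + 1, h⟩, x => by
      have : Finset.Iic (⟨ℓ + 1, h⟩ : Fin (n + 1)) =
          Finset.cons 0 ((Finset.Iic (⟨ℓ, Nat.lt_of_succ_lt_succ h⟩ : Fin n)).map
            (Fin.succEmb n)) (by simp) := by
        ext j
        cases j using Fin.cases <;> simp [Fin.le_def]
      rw [this, Finset.sum_cons, Finset.sum_map]
      simp only [evalLoop, PRGComp.calls_bind, evalNextAlg_calls Γ g hκ]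
      rw [evalLoop_calls hκ σ b (fun j => grp j.succ)]
      rfl

end

/-! ### Averages over uniform bit strings -/

/-- The value `1` or `0` of a test. -/
def ind (b : Bool) : ℝ := bif b then 1 else 0

theorem ind_nonneg (b : Bool) : 0 ≤ ind b := by cases b <;> simp [ind]

theorem ind_le_one (b : Bool) : ind b ≤ 1 := by cases b <;> simp [ind]

/-- Acceptance probabilities become finite averages, so the hybrid arguments need no further measure
theory. -/
theorem toReal_uniform_map {α : Type} [Fintype α] [Nonempty α] (f : α → Bool) :
    (((PMF.uniformOfFintype α).map f) true).toReal = 𝔼 x, ind (f x) := by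
  classical
  rw [PMF.map_apply, tsum_fintype, ENNReal.toReal_sum, Fintype.expect_eq_sum_div_card,
    Finset.sum_div]
  · refine Finset.sum_congr rfl fun x _ => ?_
    rw [PMF.uniformOfFintype_apply]
    cases hx : f x <;> simp [ind]
  · intro x _
    split_ifs <;> simp

section

variable {α β γ : Type} [Fintype α] [Fintype β] [Fintype γ]

theorem expect_prod (f : α × β → ℝ) : 𝔼 x, f x = 𝔼 a, 𝔼 b, f (a, b) := by
  rw [← Finset.univ_product_univ, Finset.expect_product]

/-- By the triangle inequality, randomness that a hybrid step does not touch may be fixed. -/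
theorem abs_expect_sub_le [Nonempty α] {f g : α → ℝ} {c : ℝ} (h : ∀ x, |f x - g x| ≤ c) :
    |𝔼 x, f x - 𝔼 x, g x| ≤ c := by
  rw [← Finset.expect_sub_distrib]
  exact (Finset.abs_expect_le _ _).trans (Finset.expect_le Finset.univ_nonempty fun x _ => h x)

theorem expect_bijective {f : α → β} (hf : Function.Bijective f) (g : β → ℝ) :
    𝔼 x, g (f x) = 𝔼 y, g y :=
  Fintype.expect_bijective f hf _ _ fun _ => rfl

theorem abs_expect_ind_sub_le_one [Nonempty α] [Nonempty β] (f : α → Bool) (g : β → Bool) :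
    |𝔼 x, ind (f x) - 𝔼 y, ind (g y)| ≤ 1 := by
  have h₁ : 0 ≤ 𝔼 x, ind (f x) := Finset.expect_nonneg fun x _ => ind_nonneg _
  have h₂ : 0 ≤ 𝔼 y, ind (g y) := Finset.expect_nonneg fun x _ => ind_nonneg _
  have h₃ : 𝔼 x, ind (f x) ≤ 1 := Finset.expect_le Finset.univ_nonempty fun x _ => ind_le_one _
  have h₄ : 𝔼 y, ind (g y) ≤ 1 := Finset.expect_le Finset.univ_nonempty fun x _ => ind_le_one _
  rw [abs_le]
  constructor <;> linarith

end

theorem expect_bits_add (m n : ℕ) (f : List Bool → ℝ) :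
    𝔼 e : Bits (m + n), f (List.ofFn e) =
      𝔼 r : Bits m, 𝔼 e : Bits n, f (List.ofFn r ++ List.ofFn e) := by
  rw [← expect_bijective (Fin.appendEquiv m n).bijective, expect_prod]
  simp [Fin.appendEquiv, List.ofFn_fin_append]

theorem expect_bits_congr {m n : ℕ} (h : m = n) (f : List Bool → ℝ) :
    𝔼 e : Bits m, f (List.ofFn e) = 𝔼 e : Bits n, f (List.ofFn e) := by
  subst h
  rfl

theorem ofBits_bijective (m : ℕ) : Function.Bijective fun e : Bits m =>
    (⟨ofBits (List.ofFn e), by simpa using ofBits_lt (List.ofFn e)⟩ : Fin (2 ^ m)) := by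
  rw [Fintype.bijective_iff_injective_and_card]
  refine ⟨fun e e' h => ?_, by simp⟩
  have h₁ := lowBits_ofBits (List.ofFn e)
  have h₂ := lowBits_ofBits (List.ofFn e')
  rw [List.length_ofFn] at h₁ h₂
  rw [Fin.mk.injEq] at h
  rw [h, h₂] at h₁
  exact (List.ofFn_injective h₁).symm

/-- The sum of a periodic function. -/
theorem sum_range_mod (u q r : ℕ) (hr : r ≤ u) (g : ℕ → ℝ) :
    ∑ v ∈ Finset.range (q * u + r), g (v % u) =
      q * ∑ w ∈ Finset.range u, g w + ∑ w ∈ Finset.range r, g w := by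
  have h₀ : ∀ m ≤ u, ∀ q, ∑ x ∈ Finset.range m, g ((q * u + x) % u) =
      ∑ x ∈ Finset.range m, g x := by
    intro m hm q
    refine Finset.sum_congr rfl fun x hx => ?_
    rw [mul_comm, Nat.mul_add_mod, Nat.mod_eq_of_lt ((Finset.mem_range.1 hx).trans_le hm)]
  rw [Finset.sum_range_add, h₀ r hr]
  congr 1
  induction q with
  | zero => simp
  | succ q ih =>
    rw [Nat.succ_mul, Finset.sum_range_add, ih, h₀ u le_rfl]
    push_cast
    ring

/-- The bias of the reduction of a uniform number below `N` modulo `u`. -/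
theorem abs_expect_mod_sub_le {u N : ℕ} (hu : 0 < u) (hN : 0 < N) (g : ℕ → ℝ)
    (h₀ : ∀ w, 0 ≤ g w) (h₁ : ∀ w, g w ≤ 1) :
    |𝔼 v : Fin N, g (v % u) - 𝔼 w : Fin u, g w| ≤ (N % u : ℕ) / N := by
  have hr : N % u < u := Nat.mod_lt _ hu
  have hsum := sum_range_mod u (N / u) (N % u) hr.le g
  rw [Nat.div_add_mod'] at hsum
  have hNu : (N : ℝ) = (N / u : ℕ) * u + (N % u : ℕ) := by
    exact_mod_cast (Nat.div_add_mod' N u).symm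
  rw [Fintype.expect_eq_sum_div_card, Fintype.expect_eq_sum_div_card, Fintype.card_fin,
    Fintype.card_fin, Fin.sum_univ_eq_sum_range (fun v => g (v % u)), Fin.sum_univ_eq_sum_range,
    hsum]
  have hS₀ : 0 ≤ ∑ w ∈ Finset.range u, g w := Finset.sum_nonneg fun w _ => h₀ w
  have hS₁ : ∑ w ∈ Finset.range u, g w ≤ u := by
    simpa using Finset.sum_le_sum fun w (_ : w ∈ Finset.range u) => h₁ w
  have hR₀ : 0 ≤ ∑ w ∈ Finset.range (N % u), g w := Finset.sum_nonneg fun w _ => h₀ w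
  have hR₁ : ∑ w ∈ Finset.range (N % u), g w ≤ (N % u : ℕ) := by
    simpa using Finset.sum_le_sum fun w (_ : w ∈ Finset.range (N % u)) => h₁ w
  generalize ∑ w ∈ Finset.range u, g w = S at *
  generalize ∑ w ∈ Finset.range (N % u), g w = R at *
  have hu' : (0 : ℝ) < u := by exact_mod_cast hu
  have hN' : (0 : ℝ) < N := by exact_mod_cast hN
  generalize (N / u : ℕ) = q at *
  have hr₀ : (0 : ℝ) ≤ (N % u : ℕ) := Nat.cast_nonneg _
  generalize ((N % u : ℕ) : ℝ) = r at *
  -- With `N = q u + r`, the `q` full periods cancel up to the remainder. Then `0 ≤ S ≤ u` and `0 ≤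
  -- R ≤ r` bound the numerator by `r u`.
  have hdiff : (q * S + R) / N - S / u = (R * u - r * S) / (N * u) := by
    rw [div_sub_div _ _ hN'.ne' hu'.ne', hNu]
    ring
  rw [hdiff, abs_div, abs_of_pos (mul_pos hN' hu'), div_le_div_iff₀ (mul_pos hN' hu') hN']
  have : |R * u - r * S| ≤ r * u := by
    rw [abs_le]
    constructor <;> nlinarith
  nlinarith

/-! ### Conversion of a uniform string to a group element -/

/-- For `k` large enough, `k κ` uniform bits give an almost uniform group element. -/
theorem abs_expect_elOfNat_sub_le (Γ : GroupSystem) (d : Γ.Desc) {κ : ℕ} (hκ : 0 < κ) (σ : ℕ)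
    (f : Γ.El d → ℝ) (h₀ : ∀ w, 0 ≤ f w) (h₁ : ∀ w, f w ≤ 1) :
    |𝔼 e : Bits (convertCalls κ σ (Γ.order d) * κ), f (Γ.elOfNat d (ofBits (List.ofFn e))) -
      𝔼 w, f w| ≤ (1 / 2 : ℝ) ^ σ := by
  have hm : Nat.clog 2 (Γ.order d) + slack σ (Γ.order d) ≤
      convertCalls κ σ (Γ.order d) * κ := by
    have := Nat.div_add_mod' (Nat.clog 2 (Γ.order d) + slack σ (Γ.order d) + κ - 1) κ
    have := Nat.mod_lt (Nat.clog 2 (Γ.order d) + slack σ (Γ.order d) + κ - 1) hκ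
    rw [convertCalls]
    omega
  generalize convertCalls κ σ (Γ.order d) * κ = m at *
  have hu := Γ.order_pos d
  rw [expect_bijective (ofBits_bijective m) fun v => f (Γ.elOfNat d v)]
  have hel : 𝔼 w, f w = 𝔼 v : Fin (Γ.order d), f (Γ.elOfNat d v) := by
    rw [← expect_bijective (Γ.index d).symm.bijective]
    refine Finset.expect_congr rfl fun v _ => ?_
    simp only [GroupSystem.elOfNat]
    congr 2
    exact Fin.ext (Nat.mod_eq_of_lt v.isLt).symm
  have hmod : ∀ v, Γ.elOfNat d (v % Γ.order d) = Γ.elOfNat d v := fun v => by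
    simp [GroupSystem.elOfNat]
  have := abs_expect_mod_sub_le hu (N := 2 ^ m) (by positivity) (fun v => f (Γ.elOfNat d v))
    (fun _ => h₀ _) fun _ => h₁ _
  simp only [hmod] at this
  rw [hel]
  refine this.trans ?_
  -- A power of two divides `2 ^ m`, so there is no bias. Otherwise the remainder is below `2 ^
  -- ⌈log₂ u⌉`, while the slack makes `2 ^ m` larger by a factor of at least `2 ^ σ`.
  by_cases hpow : ∃ c, Γ.order d = 2 ^ c
  · have hc := two_pow_eq_iff_clog.1 hpow
    have : 2 ^ m % Γ.order d = 0 := by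
      rw [hc]
      exact Nat.mod_eq_zero_of_dvd (pow_dvd_pow 2 (by omega))
    rw [this]
    simp
  · rw [slack, if_neg hpow] at hm
    have hle : 2 ^ m % Γ.order d ≤ 2 ^ Nat.clog 2 (Γ.order d) :=
      (Nat.mod_lt _ hu).le.trans (Nat.le_pow_clog (by norm_num) _)
    have hle' : (2 : ℝ) ^ (Nat.clog 2 (Γ.order d) + σ) ≤ 2 ^ m :=
      pow_le_pow_right₀ (by norm_num) hm
    rw [pow_add] at hle'
    have hle₂ : ((2 ^ m % Γ.order d : ℕ) : ℝ) ≤ 2 ^ Nat.clog 2 (Γ.order d) := by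
      exact_mod_cast hle
    push_cast at hle₂ ⊢
    rw [div_pow, one_pow, div_le_div_iff₀ (by positivity) (by positivity)]
    nlinarith [pow_pos (two_pos : (0 : ℝ) < 2) σ]

/-! ### Uniform outputs of the generator -/

section

variable {κ : ℕ}

theorem bits_ext_of_parts {y y' : Bits (2 * κ + 2)} (a : Bool)
    (h₁ : seedPart a y = seedPart a y') (h₂ : seedPart (!a) y = seedPart (!a) y')
    (h₃ : bitPart false y = bitPart false y') (h₄ : bitPart true y = bitPart true y') :
    y = y' := by
  have hL : seedPart false y = seedPart false y' := by cases a <;> assumption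
  have hR : seedPart true y = seedPart true y' := by cases a <;> assumption
  funext ⟨j, hj⟩
  rcases lt_trichotomy j κ with h | rfl | h
  · exact congrFun hL ⟨j, h⟩
  · exact h₃
  · by_cases hj' : j = 2 * κ + 1
    · subst hj'
      exact h₄
    · have := congrFun hR ⟨j - (κ + 1), by omega⟩
      simpa [seedPart, show κ + 1 + (j - (κ + 1)) = j by omega] using this

/-- The four parts of a string determine it, and the numbers of bits agree; the two control bits are
averaged out. A round of `stretch` with a uniform output thus gives a uniform seed and an
independent uniform block. -/
theorem expect_seedParts (f : Bits κ → Bits κ → ℝ) :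
    𝔼 y : Bits (2 * κ + 2), f (seedPart false y) (seedPart true y) = 𝔼 l, 𝔼 r, f l r := by
  have hbij : Function.Bijective fun y : Bits (2 * κ + 2) =>
      ((seedPart false y, seedPart true y), (bitPart false y, bitPart true y)) := by
    rw [Fintype.bijective_iff_injective_and_card]
    refine ⟨fun y y' h => ?_, by simp [pow_add, two_mul]⟩
    simp only [Prod.mk.injEq] at h
    exact bits_ext_of_parts false h.1.1 h.1.2 h.2.1 h.2.2
  rw [expect_bijective hbij fun z => f z.1.1 z.1.2, expect_prod, expect_prod]
  simp only [Fintype.expect_const]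

/-- The correction words and the next seed computed from a uniform output of the generator of one
server are uniform and independent. -/
theorem expect_corrections (a : Bool) (y₀ : Bits (2 * κ + 2)) (t : Bool)
    (f : Bits κ → Bool → Bool → Bits κ → ℝ) :
    𝔼 y, f (seedCW a y₀ y) (leftCW a y₀ y) (rightCW a y₀ y) (nextSeed a y t (seedCW a y₀ y)) =
      𝔼 s, 𝔼 l, 𝔼 r, 𝔼 x, f s l r x := by
  -- With `y₀` fixed, the seed correction reveals the discarded seed part of `y`, and the bit
  -- corrections reveal its control bits. Once the seed correction is known, the next seed reveals
  -- the kept part. Both sides have `2 κ + 2` bits, so injectivity suffices.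
  have hbij : Function.Bijective fun y : Bits (2 * κ + 2) =>
      (seedCW a y₀ y, leftCW a y₀ y, rightCW a y₀ y, nextSeed a y t (seedCW a y₀ y)) := by
    rw [Fintype.bijective_iff_injective_and_card]
    refine ⟨fun y y' h => ?_, by simp [pow_add, two_mul]; ring⟩
    simp only [Prod.mk.injEq] at h
    obtain ⟨h₁, h₂, h₃, h₄⟩ := h
    rw [h₁] at h₄
    refine bits_ext_of_parts a ?_ ?_ ?_ ?_
    · funext j
      simpa [nextSeed, xorBits] using congrFun h₄ j
    · funext j
      simpa [seedCW, xorBits] using congrFun h₁ j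
    · simpa [leftCW] using h₂
    · simpa [rightCW] using h₃
  rw [expect_bijective hbij fun z => f z.1 z.2.1 z.2.2.1 z.2.2.2, expect_prod]
  simp only [expect_prod]

/-- The hybrid argument for `stretch`. -/
theorem abs_expect_stretch_sub_le (G : Bits κ → Bits (2 * κ + 2)) {ε : ℝ}
    (Ψ : Bits κ × List Bool → ℝ) (k : ℕ) (e : List Bool)
    (h : ∀ j < k, ∀ e' : List Bool, e'.length ≤ e.length + k * κ →
      |𝔼 s, Ψ ((stretchStep G)^[j] (stretchStep G (s, e'))) -
        𝔼 y : Bits (2 * κ + 2), Ψ ((stretchStep G)^[j]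
          (seedPart false y, e' ++ List.ofFn (seedPart true y)))| ≤ ε) :
    |𝔼 s, Ψ ((stretchStep G)^[k] (s, e)) -
      𝔼 r : Bits (k * κ), 𝔼 s, Ψ (s, e ++ List.ofFn r)| ≤ k * ε := by
  induction k generalizing e with
  | zero =>
    rw [expect_bits_congr (zero_mul κ) fun r => 𝔼 s, Ψ (s, e ++ r)]
    simp
  | succ k ih =>
    -- The first round is replaced while the `k` later ones still use the generator. Its uniform
    -- output is a fresh seed and a block; the block is fixed and moved into the accumulator, and
    -- the induction hypothesis treats the rest.
    have h₁ := h k (Nat.lt_succ_self k) e (by omega)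
    have h₂ : |𝔼 y : Bits (2 * κ + 2), Ψ ((stretchStep G)^[k]
          (seedPart false y, e ++ List.ofFn (seedPart true y))) -
        𝔼 r : Bits ((k + 1) * κ), 𝔼 s, Ψ (s, e ++ List.ofFn r)| ≤ k * ε := by
      rw [expect_seedParts fun l r => Ψ ((stretchStep G)^[k] (l, e ++ List.ofFn r)),
        Finset.expect_comm, expect_bits_congr (by ring : (k + 1) * κ = κ + k * κ)
        fun r => 𝔼 s, Ψ (s, e ++ r), expect_bits_add κ (k * κ) fun r => 𝔼 s, Ψ (s, e ++ r)]
      refine abs_expect_sub_le fun r => ?_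
      simp only [← List.append_assoc]
      refine ih (e ++ List.ofFn r) fun j hj e' he' => h j (by omega) e' ?_
      simp only [List.length_append, List.length_ofFn] at he'
      rw [Nat.succ_mul]
      omega
    calc _ ≤ ε + k * ε := (abs_sub_le _ _ _).trans (add_le_add h₁ h₂)
      _ = _ := by push_cast; ring

end

/-! ### Non-uniform distinguishers -/

theorem PolyBdd.exists_poly {f : ℕ → ℕ} (h : PolyBdd Data.unary f) :
    ∃ q : Polynomial ℕ, ∀ κ, f κ ≤ q.eval κ := by
  obtain ⟨q, hq⟩ := h
  refine ⟨q.comp (Polynomial.C 4 * Polynomial.X + 1), fun κ => (hq κ).trans ?_⟩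
  rw [Polynomial.eval_comp]
  refine eval_mono q ?_
  have := Data.size_bits_le (List.replicate κ true)
  simpa [Data.unary] using this

theorem PolyBdd.of_poly {f : ℕ → ℕ} (q : Polynomial ℕ) (h : ∀ κ, f κ ≤ q.eval κ) :
    PolyBdd Data.unary f :=
  ⟨q, fun κ => (h κ).trans (eval_mono q (by
    simpa [Data.unary] using Data.length_le_size_bits (List.replicate κ true)))⟩

/-- Regarding the advice as part of the input turns a distinguisher into an ordinary `PolyTime`
function, to which the closure properties apply. -/
theorem NonuniformPolyTime.exists_advice {B : ℕ → Type} {enc : ∀ κ, B κ → Data}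
    {D : ∀ κ, B κ → Bool} (h : NonuniformPolyTime enc D) :
    ∃ adv : ℕ → Data, PolyBdd Data.unary (fun κ => (adv κ).size) ∧
      PolyTime (fun x : (Σ κ, B κ) => Data.list [Data.unary x.1, adv x.1, enc x.1 x.2])
        fun x => Data.bool (D x.1 x.2) := by
  obtain ⟨p, adv, q, h⟩ := h
  refine ⟨adv, .of_poly q fun κ => (h κ).1, p, q, fun x => ?_⟩
  obtain ⟨t, ht, hr⟩ := (h x.1).2 x.2
  refine ⟨t, ht.trans (eval_mono q ?_), hr⟩
  have := Data.length_le_size_bits (List.replicate x.1 true)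
  simp only [List.length_replicate] at this
  simp only [Data.size_list_cons, Data.unary]
  omega

theorem NonuniformPolyTime.of_advice {B : ℕ → Type} {enc : ∀ κ, B κ → Data}
    {D : ∀ κ, B κ → Bool} {adv : ℕ → Data} (hadv : PolyBdd Data.unary fun κ => (adv κ).size)
    (h : PolyTime (fun x : (Σ κ, B κ) => Data.list [Data.unary x.1, adv x.1, enc x.1 x.2])
      fun x => Data.bool (D x.1 x.2)) : NonuniformPolyTime enc D := by
  obtain ⟨p, q, h⟩ := h
  obtain ⟨r, hr⟩ := hadv.exists_poly
  refine ⟨p, adv, r + q.comp (Polynomial.C 5 * Polynomial.X + r + 5), fun κ => ⟨?_, fun x => ?_⟩⟩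
  · rw [Polynomial.eval_add]
    exact (hr κ).trans (Nat.le_add_right _ _)
  · obtain ⟨t, ht, hrun⟩ := h ⟨κ, x⟩
    refine ⟨t, ht.trans ?_, hrun⟩
    rw [Polynomial.eval_add, Polynomial.eval_comp]
    refine le_trans (eval_mono q ?_) (Nat.le_add_left _ _)
    have h₁ := Data.size_bits_le (List.replicate κ true)
    have h₂ := (hr κ).trans (eval_mono r (Nat.le_add_right κ (enc κ x).size))
    have h₃ : (5 : Polynomial ℕ).eval (κ + (enc κ x).size) = 5 := Polynomial.eval_ofNat _ _
    simp only [List.length_replicate] at h₁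
    simp only [Data.size_list_cons, Data.unary, Data.list_nil, Data.size_nil, Polynomial.eval_add,
      Polynomial.eval_mul, Polynomial.eval_C, Polynomial.eval_X, h₃]
    omega

/-- No choice of a parameter of polynomial size helps to distinguish the output of the generator
from a uniform string. -/
theorem IsPRG.exists_bound {G : ∀ κ, Bits κ → Bits (2 * κ + 2)} (hG : IsPRG G) {Ξ : ℕ → Type}
    {encΞ : ∀ κ, Ξ κ → Data} {T : ∀ κ, Ξ κ → Bits (2 * κ + 2) → Bool}
    (hT : PolyTime (fun x : (Σ κ, Ξ κ × Bits (2 * κ + 2)) =>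
        Data.list [Data.unary x.1, encΞ x.1 x.2.1, x.2.2.enc])
      fun x => Data.bool (T x.1 x.2.1 x.2.2))
    {m : ℕ → ℕ} (hm : PolyBdd Data.unary m) (hsize : ∀ κ ξ, (encΞ κ ξ).size ≤ m κ) :
    ∃ ε : ℕ → ℝ, Negligible ε ∧ ∀ κ, 0 ≤ ε κ ∧ ∀ ξ,
      |𝔼 s, ind (T κ ξ (G κ s)) - 𝔼 y, ind (T κ ξ y)| ≤ ε κ := by
  -- The additional parameter `none`, with a constant test, makes a choice possible even if `Ξ κ` is
  -- empty or no parameter has any advantage.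
  let encO : ∀ κ, Option (Ξ κ) → Data := fun κ ξ => match ξ with
    | none => Data.nil
    | some ξ => Data.cons Data.nil (encΞ κ ξ)
  let TO : ∀ κ, Option (Ξ κ) → Bits (2 * κ + 2) → Bool := fun κ ξ y => match ξ with
    | none => false
    | some ξ => T κ ξ y
  let a : ∀ κ, Option (Ξ κ) → ℝ := fun κ ξ => |𝔼 s, ind (TO κ ξ (G κ s)) - 𝔼 y, ind (TO κ ξ y)|
  have ha₀ : ∀ κ ξ, 0 ≤ a κ ξ := fun κ ξ => abs_nonneg _
  -- The supremum of the advantages need not be attained, but half of a positive supremum is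
  -- exceeded; the factor `2` does not affect negligibility.
  have ha : ∀ κ, ∃ ξ₀ : Option (Ξ κ), ∀ ξ, a κ ξ ≤ 2 * a κ ξ₀ := by
    intro κ
    have hbdd : BddAbove (Set.range (a κ)) := ⟨1, by
      rintro _ ⟨ξ, rfl⟩
      exact abs_expect_ind_sub_le_one _ _⟩
    rcases le_or_gt (⨆ ξ, a κ ξ) 0 with h | h
    · exact ⟨none, fun ξ => ((le_ciSup hbdd ξ).trans h).trans (by have := ha₀ κ none; positivity)⟩
    · obtain ⟨ξ₀, hξ₀⟩ := exists_lt_of_lt_ciSup (half_lt_self h)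
      exact ⟨ξ₀, fun ξ => (le_ciSup hbdd ξ).trans (by linarith)⟩
  choose ξ₀ hξ₀ using ha
  have hTO : PolyTime (fun x : (Σ κ, Option (Ξ κ) × Bits (2 * κ + 2)) =>
        Data.list [Data.unary x.1, encO x.1 x.2.1, x.2.2.enc])
      fun x => Data.bool (TO x.1 x.2.1 x.2.2) := by
    refine PolyTime.cases (c := fun x => encO x.1 x.2.1) PolyTime.id.snd.fst ?_ ?_
    · have hsome : PolyTime (fun x : (Σ κ, Ξ κ × Bits (2 * κ + 2)) =>
          Data.list [Data.unary x.1, encO x.1 (some x.2.1), x.2.2.enc])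
          fun x => Data.bool (T x.1 x.2.1 x.2.2) := by
        have hi : PolyTime (fun x : (Σ κ, Ξ κ × Bits (2 * κ + 2)) =>
          Data.list [Data.unary x.1, encO x.1 (some x.2.1), x.2.2.enc]) (fun x =>
          Data.list [Data.unary x.1, encO x.1 (some x.2.1), x.2.2.enc]) := .id
        exact hT.comp (fun x => x) (hi.fst.cons (hi.snd.fst.snd.cons (hi.snd.snd.fst.cons .nil)))
      refine hsome.reindex (fun x => ⟨x.1.1, x.1.2.1.get ?_, x.1.2.2⟩) ?_ ?_
      · rcases x with ⟨⟨κ, _ | ξ, y⟩, h⟩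
        · exact absurd rfl h
        · rfl
      · rintro ⟨⟨κ, _ | ξ, y⟩, h⟩
        · exact absurd rfl h
        · rfl
      · rintro ⟨⟨κ, _ | ξ, y⟩, h⟩
        · exact absurd rfl h
        · rfl
    · refine (PolyTime.const (Data.bool false)).congr ?_
      rintro ⟨⟨κ, _ | ξ, y⟩, h⟩
      · rfl
      · cases h
  -- The nearly worst parameter is hard-wired as advice, which `hsize` keeps polynomial.
  have hD : NonuniformPolyTime (B := fun κ => Bits (2 * κ + 2)) (fun _ y => y.enc)
      fun κ y => TO κ (ξ₀ κ) y := by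
    refine .of_advice (adv := fun κ => encO κ (ξ₀ κ)) ((hm.add (.const 2)).mono fun κ => ?_)
      (hTO.reindex (fun x => ⟨x.1, ξ₀ x.1, x.2⟩) (fun _ => rfl) fun _ => rfl)
    cases ξ₀ κ with
    | none => simp [encO]
    | some ξ =>
      have := hsize κ ξ
      simp only [encO, Data.size_cons, Data.size_nil]
      omega
  have hneg := hG.2 _ hD
  simp only [PMF.map_comp, toReal_uniform_map] at hneg
  exact ⟨fun κ => 2 * a κ (ξ₀ κ), hneg.const_mul 2, fun κ =>
    ⟨mul_nonneg zero_le_two (ha₀ _ _), fun ξ => hξ₀ κ (some ξ)⟩⟩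

/-! ### The key generation as seen by one server -/

section

variable {Γ : GroupSystem} {κ : ℕ} (G : Bits κ → Bits (2 * κ + 2)) (σ : ℕ) (b : Bool)

/-- The loop of the key generation, from the state of server `b` and that of the other server. -/
noncomputable def genLoopFor (F : PointFn Γ) (st st' : EvalState κ) : ∀ ℓ, CW Γ κ (F.grp ℓ) :=
  (genLoop Γ σ F.n F.grp F.α F.β (bif b then st' else st) (bif b then st else st')).run G

/-- The value of `W_CW` in terms of the new control bit `t` of server `b`, if the other server has
the opposite bit. -/
def valueFor {d : Γ.Desc} (β : Γ.El d) (t : Bool) (W W' : Γ.El d) : Γ.El d :=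
  valueCW Γ β (bif b then t else !t) (bif b then W' else W) (bif b then W else W')

/-- The corrections are symmetric in the two servers, so one description of a level, from the
viewpoint of server `b`, covers both values of `b`. -/
theorem seedCW_comm (a : Bool) (y₀ y₁ : Bits (2 * κ + 2)) : seedCW a y₀ y₁ = seedCW a y₁ y₀ :=
  funext fun _ => Bool.xor_comm _ _

theorem leftCW_comm (a : Bool) (y₀ y₁ : Bits (2 * κ + 2)) : leftCW a y₀ y₁ = leftCW a y₁ y₀ := by
  simp only [leftCW, Bool.xor_comm (bitPart false y₀)]

theorem rightCW_comm (a : Bool) (y₀ y₁ : Bits (2 * κ + 2)) :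
    rightCW a y₀ y₁ = rightCW a y₁ y₀ := by
  simp only [rightCW, Bool.xor_comm (bitPart true y₀)]

/-- The remaining levels after a first one with given corrections and converted seeds. -/
noncomputable def finishFor (d : Γ.Desc) (β : Γ.El d) (F : PointFn Γ) (s : Bits κ)
    (tL tR t : Bool) (r r' : Bits κ × Γ.El d) : CW Γ κ d × ∀ ℓ, CW Γ κ (F.grp ℓ) :=
  (⟨s, tL, tR, valueFor b β t r.2 r'.2⟩, genLoopFor G σ b F ⟨r.1, t⟩ ⟨r'.1, !t⟩)

/-- A level, and the remaining ones, from the output `y` of the generator for server `b` and the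
output `y'` for the other server. -/
noncomputable def levelFor (d : Γ.Desc) (a : Bool) (β : Γ.El d) (F : PointFn Γ)
    (y y' : Bits (2 * κ + 2)) (t : Bool) : CW Γ κ d × ∀ ℓ, CW Γ κ (F.grp ℓ) :=
  finishFor G σ b d β F (seedCW a y y') (leftCW a y y') (rightCW a y y')
    (nextBit a y t (leftCW a y y') (rightCW a y y'))
    ((convert Γ σ d (nextSeed a y t (seedCW a y y'))).run G)
    ((convert Γ σ d (nextSeed a y' (!t) (seedCW a y y'))).run G)

theorem genLoopFor_succ {n : ℕ} (grp : Fin (n + 1) → Γ.Desc) (α : Fin (n + 1) → Bool)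
    (β : ∀ ℓ, Γ.El (grp ℓ)) (s s' : Bits κ) (t : Bool) :
    genLoopFor G σ b ⟨⟨n + 1, grp⟩, α, β⟩ ⟨s, t⟩ ⟨s', !t⟩ =
      Fin.cons (α := fun ℓ => CW Γ κ (grp ℓ))
        (levelFor G σ b (grp 0) (α 0) (β 0) ⟨⟨n, fun ℓ => grp ℓ.succ⟩, fun ℓ => α ℓ.succ,
          fun ℓ => β ℓ.succ⟩ (G s) (G s') t).1
        (levelFor G σ b (grp 0) (α 0) (β 0) ⟨⟨n, fun ℓ => grp ℓ.succ⟩, fun ℓ => α ℓ.succ,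
          fun ℓ => β ℓ.succ⟩ (G s) (G s') t).2 := by
  cases b
  · simp only [genLoopFor, cond_false, genLoop_succ_run, genLevel_run, levelFor, finishFor,
      levelFrom, finishLevel, valueFor, nextBit_keep]
  · simp only [genLoopFor, cond_true, genLoop_succ_run, genLevel_run, levelFor, finishFor,
      levelFrom, finishLevel, valueFor, nextBit_keep, seedCW_comm _ (G s') (G s),
      leftCW_comm _ (G s') (G s), rightCW_comm _ (G s') (G s)]

end

/-! ### The reductions -/

/-- A level of the key generation in the context of a full key of the shape `S`: the key of the
server, the public parameters `pre` of the previous levels and the remaining levels `rest`. -/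
structure LevelCtx (Γ : GroupSystem) (κ : ℕ) (S : Shape Γ) where
  key : Bits κ
  d : Γ.Desc
  α : Bool
  β : Γ.El d
  rest : PointFn Γ
  pre : List Data
  cont : CW Γ κ d → (∀ ℓ, CW Γ κ (rest.grp ℓ)) → ∀ ℓ, CW Γ κ (S.grp ℓ)
  ppList_cont : ∀ c pp, ppList (cont c pp) = pre ++ Data.bits c.toBits :: ppList pp

/-- The context of a level as machine data. -/
def LevelCtx.enc {Γ : GroupSystem} {κ : ℕ} {S : Shape Γ} (c : LevelCtx Γ κ S) : Data :=
  Data.list [c.key.enc, S.enc, Data.list c.pre, Γ.encDesc c.d, Data.bool c.α,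
    Data.bits (Γ.elBits c.β), c.rest.enc]

namespace PolyTime

variable {Γ : GroupSystem} {A : Type} {inp : A → Data} {κ : A → ℕ} {σ : ℕ → ℕ}
  {G : ∀ κ, Bits κ → Bits (2 * κ + 2)} {S : ℕ → Shape Γ}

theorem genLoopFor (hG : PolyTime (fun s : (Σ κ, Bits κ) => s.2.enc) fun s => (G s.1 s.2).enc)
    (hσ : PolyTime Data.unary fun κ => Data.unary (σ κ))
    (hκ : PolyTime inp fun a => Data.unary (κ a)) (b : Bool)
    {F : A → PointFn Γ} (hF : PolyTime inp fun a => (F a).enc) {st st' : ∀ a, EvalState (κ a)}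
    (h : PolyTime inp fun a => (st a).enc) (h' : PolyTime inp fun a => (st' a).enc) :
    PolyTime inp fun a => Data.list (ppList (genLoopFor (G (κ a)) (σ (κ a)) b (F a)
      (st a) (st' a))) := by
  cases b
  · exact genLoop hG hκ (hσ.comp κ hκ) hF h h'
  · exact genLoop hG hκ (hσ.comp κ hκ) hF h' h

theorem valueFor {d : A → Γ.Desc} (hd : PolyTime inp fun a => Γ.encDesc (d a)) (b : Bool)
    {β W W' : ∀ a, Γ.El (d a)} {t : A → Bool} (ht : PolyTime inp fun a => Data.bool (t a))
    (hβ : PolyTime inp fun a => Data.bits (Γ.elBits (β a)))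
    (hW : PolyTime inp fun a => Data.bits (Γ.elBits (W a)))
    (hW' : PolyTime inp fun a => Data.bits (Γ.elBits (W' a))) :
    PolyTime inp fun a => Data.bits (Γ.elBits (valueFor b (β a) (t a) (W a) (W' a))) := by
  cases b
  · exact valueCW hd hβ ht.not hW hW'
  · exact valueCW hd hβ ht hW' hW

/-- The full key of the server from the data of one level. -/
theorem finishFor (hG : PolyTime (fun s : (Σ κ, Bits κ) => s.2.enc) fun s => (G s.1 s.2).enc)
    (hσ : PolyTime Data.unary fun κ => Data.unary (σ κ))
    (hκ : PolyTime inp fun a => Data.unary (κ a)) (b : Bool) {c : ∀ a, LevelCtx Γ (κ a) (S (κ a))}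
    (hc : PolyTime inp fun a => (c a).enc) {s : ∀ a, Bits (κ a)} {tL tR t : A → Bool}
    {r r' : ∀ a, Bits (κ a) × Γ.El (c a).d} (hs : PolyTime inp fun a => (s a).enc)
    (hL : PolyTime inp fun a => Data.bool (tL a)) (hR : PolyTime inp fun a => Data.bool (tR a))
    (ht : PolyTime inp fun a => Data.bool (t a)) (hr₁ : PolyTime inp fun a => (r a).1.enc)
    (hr₂ : PolyTime inp fun a => Data.bits (Γ.elBits (r a).2))
    (hr₁' : PolyTime inp fun a => (r' a).1.enc)
    (hr₂' : PolyTime inp fun a => Data.bits (Γ.elBits (r' a).2)) :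
    PolyTime inp fun a => (idpf Γ σ G).encView (κ := κ a) (S := S (κ a)) ((c a).key,
      (fun p => (c a).cont p.1 p.2) (finishFor (G (κ a)) (σ (κ a)) b (c a).d (c a).β (c a).rest
        (s a) (tL a) (tR a) (t a) (r a) (r' a))) := by
  have hd : PolyTime inp fun a => Γ.encDesc (c a).d := hc.snd.snd.snd.fst
  have hβ : PolyTime inp fun a => Data.bits (Γ.elBits (c a).β) := hc.snd.snd.snd.snd.snd.fst
  have hrest : PolyTime inp fun a => (c a).rest.enc := hc.snd.snd.snd.snd.snd.snd.fst
  have hpre : PolyTime inp fun a => Data.list (c a).pre := hc.snd.snd.fst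
  have hlist : PolyTime inp fun a => Data.list (Data.bits (IncDPF.finishFor (G (κ a)) (σ (κ a)) b
      (c a).d (c a).β (c a).rest (s a) (tL a) (tR a) (t a) (r a) (r' a)).1.toBits ::
      ppList (IncDPF.finishFor (G (κ a)) (σ (κ a)) b (c a).d (c a).β (c a).rest (s a) (tL a)
        (tR a) (t a) (r a) (r' a)).2) :=
    (cw (c := fun a => (IncDPF.finishFor (G (κ a)) (σ (κ a)) b (c a).d (c a).β (c a).rest
        (s a) (tL a) (tR a) (t a) (r a) (r' a)).1) hs hL hR (valueFor hd b ht hβ hr₂ hr₂')).cons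
      (genLoopFor hG hσ hκ b hrest (st := fun a => ⟨(r a).1, t a⟩)
        (st' := fun a => ⟨(r' a).1, !t a⟩) (hr₁.cons ht) (hr₁'.cons ht.not))
  exact hc.fst.cons (encPP hκ hc.snd.fst ((hpre.append hlist).congr fun a =>
    congrArg Data.list ((c a).ppList_cont _ _).symm))

theorem levelFor (hG : PolyTime (fun s : (Σ κ, Bits κ) => s.2.enc) fun s => (G s.1 s.2).enc)
    (hσ : PolyTime Data.unary fun κ => Data.unary (σ κ))
    (hκ : PolyTime inp fun a => Data.unary (κ a)) (b : Bool) {c : ∀ a, LevelCtx Γ (κ a) (S (κ a))}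
    (hc : PolyTime inp fun a => (c a).enc) {y y' : ∀ a, Bits (2 * κ a + 2)} {t : A → Bool}
    (hy : PolyTime inp fun a => (y a).enc) (hy' : PolyTime inp fun a => (y' a).enc)
    (ht : PolyTime inp fun a => Data.bool (t a)) :
    PolyTime inp fun a => (idpf Γ σ G).encView (κ := κ a) (S := S (κ a)) ((c a).key,
      (fun p => (c a).cont p.1 p.2) (levelFor (G (κ a)) (σ (κ a)) b (c a).d (c a).α (c a).β
        (c a).rest (y a) (y' a) (t a))) := by
  have hd : PolyTime inp fun a => Γ.encDesc (c a).d := hc.snd.snd.snd.fst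
  have hα : PolyTime inp fun a => Data.bool (c a).α := hc.snd.snd.snd.snd.fst
  have hs := seedCW hκ hα hy hy'
  have hL := leftCW hκ hα hy hy'
  have hR := rightCW hκ hα hy hy'
  have h₁ := convert hG (hσ.comp κ hκ) hd (nextSeed hκ hα hy ht hs)
  have h₂ := convert hG (hσ.comp κ hκ) hd (nextSeed hκ hα hy' ht.not hs)
  exact finishFor hG hσ hκ b hc hs hL hR (nextBit hκ hα hy ht hL hR) h₁.1 h₁.2 h₂.1 h₂.2

end PolyTime

/-- The view of the server when `p` are the correction words of the level and of the remaining
ones. -/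
def LevelCtx.view {Γ : GroupSystem} {κ : ℕ} {S : Shape Γ} (c : LevelCtx Γ κ S)
    (p : CW Γ κ c.d × ∀ ℓ, CW Γ κ (c.rest.grp ℓ)) : Bits κ × ∀ ℓ, CW Γ κ (S.grp ℓ) :=
  (c.key, c.cont p.1 p.2)

theorem LevelCtx.clog_le_size {Γ : GroupSystem} {κ : ℕ} {S : Shape Γ} (c : LevelCtx Γ κ S) :
    Nat.clog 2 (Γ.order c.d) ≤ c.enc.size := by
  have := Data.length_le_size_bits (Γ.elBits c.β)
  simp only [GroupSystem.elBits, length_lowBits] at this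
  simp only [LevelCtx.enc, Data.size_list_cons, GroupSystem.elBits]
  omega

/-- The state of a conversion in progress for the seed of the other server, with the rest of the
level: the corrections, the new control bit and the converted seed `q` of the server, the bits `e`
that were emitted before the current round, and the number `j` of the rounds after it. -/
structure ConvertCtx (Γ : GroupSystem) (κ : ℕ) (S : Shape Γ) extends LevelCtx Γ κ S where
  s : Bits κ
  tL : Bool
  tR : Bool
  t : Bool
  q : Bits κ × Γ.El d
  e : List Bool
  j : ℕ

/-- The state of a conversion as machine data. -/
def ConvertCtx.enc {Γ : GroupSystem} {κ : ℕ} {S : Shape Γ} (c : ConvertCtx Γ κ S) : Data :=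
  Data.list [c.toLevelCtx.enc, c.s.enc, Data.bool c.tL, Data.bool c.tR, Data.bool c.t, c.q.1.enc,
    Data.bits (Γ.elBits c.q.2), Data.bits c.e, Data.unary c.j]

/-- The view of the server when the generator returns `y` in the current round of the conversion. -/
noncomputable def ConvertCtx.view {Γ : GroupSystem} {κ : ℕ} {S : Shape Γ} (c : ConvertCtx Γ κ S)
    (G : Bits κ → Bits (2 * κ + 2)) (σ : ℕ) (b : Bool) (y : Bits (2 * κ + 2)) :
    Bits κ × ∀ ℓ, CW Γ κ (S.grp ℓ) :=
  c.toLevelCtx.view (finishFor G σ b c.d c.β c.rest c.s c.tL c.tR c.t c.q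
    (((stretchStep G)^[c.j] (seedPart false y, c.e ++ List.ofFn (seedPart true y))).1,
      Γ.elOfNat c.d (ofBits
        ((stretchStep G)^[c.j] (seedPart false y, c.e ++ List.ofFn (seedPart true y))).2)))

section

variable {Γ : GroupSystem} {σ : ℕ → ℕ} {G : ∀ κ, Bits κ → Bits (2 * κ + 2)} {S : ℕ → Shape Γ}

/-- This is the reduction: the challenge `y` takes the place of one generator output, and the later
rounds and levels are computed honestly. -/
theorem PolyTime.convertCtx_view
    (hG : PolyTime (fun s : (Σ κ, Bits κ) => s.2.enc) fun s => (G s.1 s.2).enc)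
    (hσ : PolyTime Data.unary fun κ => Data.unary (σ κ)) {A : Type} {inp : A → Data} {κ : A → ℕ}
    (hκ : PolyTime inp fun a => Data.unary (κ a)) (b : Bool)
    {c : ∀ a, ConvertCtx Γ (κ a) (S (κ a))} (hc : PolyTime inp fun a => (c a).enc)
    {y : ∀ a, Bits (2 * κ a + 2)} (hy : PolyTime inp fun a => (y a).enc) :
    PolyTime inp fun a => (idpf Γ σ G).encView (κ := κ a) (S := S (κ a))
      ((c a).view (G (κ a)) (σ (κ a)) b (y a)) := by
  have hp := PolyTime.stretch hG (k := fun a => (c a).j)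
    (e := fun a => (c a).e ++ List.ofFn (IncDPF.seedPart true (y a)))
    hc.snd.snd.snd.snd.snd.snd.snd.snd.fst (seedPart hκ hy (const (Data.bool false)))
    (PolyTime.bits_append (m := fun a => List.ofFn (IncDPF.seedPart true (y a)))
      hc.snd.snd.snd.snd.snd.snd.snd.fst (seedPart hκ hy (const (Data.bool true))))
  have hd : PolyTime inp fun a => Γ.encDesc (c a).d := hc.fst.snd.snd.snd.fst
  exact finishFor hG hσ hκ b hc.fst (s := fun a => (c a).s) (tL := fun a => (c a).tL)
    (tR := fun a => (c a).tR) (t := fun a => (c a).t) (r := fun a => (c a).q)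
    (r' := fun a => (_, Γ.elOfNat (c a).d (ofBits _)))
    hc.snd.fst hc.snd.snd.fst hc.snd.snd.snd.fst hc.snd.snd.snd.snd.fst hc.snd.snd.snd.snd.snd.fst
    hc.snd.snd.snd.snd.snd.snd.fst hp.fst (elOfNat hd hp.snd)

/-- A uniform string in place of the output of the generator for the other server. -/
theorem exists_levelFor_bound (hG : IsPRG G)
    (hσ : PolyTime Data.unary fun κ => Data.unary (σ κ)) (b : Bool)
    {D : ∀ κ, Bits κ × (∀ ℓ, CW Γ κ ((S κ).grp ℓ)) → Bool}
    (hD : NonuniformPolyTime (B := fun κ => (idpf Γ σ G).View κ (S κ))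
      (fun _ v => (idpf Γ σ G).encView v) D) {m : ℕ → ℕ} (hm : PolyBdd Data.unary m) :
    ∃ ε : ℕ → ℝ, Negligible ε ∧ ∀ κ, 0 ≤ ε κ ∧ ∀ (c : LevelCtx Γ κ (S κ)) (st : EvalState κ),
      c.enc.size ≤ m κ →
      |𝔼 s', ind (D κ (c.view (levelFor (G κ) (σ κ) b c.d c.α c.β c.rest (G κ st.s) (G κ s')
          st.t))) -
        𝔼 y', ind (D κ (c.view (levelFor (G κ) (σ κ) b c.d c.α c.β c.rest (G κ st.s) y'
          st.t)))| ≤ ε κ := by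
  obtain ⟨adv, hadv, hD⟩ := hD.exists_advice
  let Ξ : ℕ → Type := fun κ => {x : LevelCtx Γ κ (S κ) × EvalState κ // x.1.enc.size ≤ m κ}
  -- The advice of the distinguisher `D` travels with the parameter, since the test has to run `D`.
  let encΞ : ∀ κ, Ξ κ → Data := fun κ ξ => Data.list [adv κ, ξ.1.1.enc, ξ.1.2.enc]
  let inp : (Σ κ, Ξ κ × Bits (2 * κ + 2)) → Data := fun x =>
    Data.list [Data.unary x.1, encΞ x.1 x.2.1, x.2.2.enc]
  have hi : PolyTime inp inp := .id
  have hκ : PolyTime inp fun x => Data.unary x.1 := hi.fst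
  have hst : PolyTime inp fun x => x.2.1.1.2.enc := hi.snd.fst.snd.snd.fst
  have hview := PolyTime.levelFor (inp := inp) (κ := fun x => x.1) (c := fun x => x.2.1.1.1)
    (y := fun x => G x.1 x.2.1.1.2.s) (y' := fun x => x.2.2) (t := fun x => x.2.1.1.2.t)
    hG.1 hσ hκ b hi.snd.fst.snd.fst (PolyTime.generator hG.1 hst.fst) hi.snd.snd.fst hst.snd
  obtain ⟨ε, hε, h⟩ := hG.exists_bound (encΞ := encΞ)
    (T := fun κ ξ y' => D κ (ξ.1.1.view (levelFor (G κ) (σ κ) b ξ.1.1.d ξ.1.1.α ξ.1.1.β ξ.1.1.rest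
      (G κ ξ.1.2.s) y' ξ.1.2.t)))
    (hD.comp (fun x : (Σ κ, Ξ κ × Bits (2 * κ + 2)) => (⟨x.1, x.2.1.1.1.view _⟩ :
      Σ κ, Bits κ × ∀ ℓ, CW Γ κ ((S κ).grp ℓ))) (hκ.cons (hi.snd.fst.fst.cons (hview.cons .nil))))
    (m := fun κ => (adv κ).size + m κ + 4 * κ + 9)
    (((hadv.add hm).add ((PolyBdd.const 4).mul (PolyTime.unary_bdd .id))).add (.const 9))
    (fun κ ξ => by
      have h₁ := ξ.2
      have h₂ := ξ.1.2.size_enc_le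
      simp only [encΞ, Data.size_list_cons, Data.list_nil, Data.size_nil]
      omega)
  exact ⟨ε, hε, fun κ => ⟨(h κ).1, fun c st hc => (h κ).2 ⟨(c, st), hc⟩⟩⟩

/-- A uniform string in place of the output of the generator in one round of a conversion. -/
theorem exists_convert_bound (hG : IsPRG G)
    (hσ : PolyTime Data.unary fun κ => Data.unary (σ κ)) (b : Bool)
    {D : ∀ κ, Bits κ × (∀ ℓ, CW Γ κ ((S κ).grp ℓ)) → Bool}
    (hD : NonuniformPolyTime (B := fun κ => (idpf Γ σ G).View κ (S κ))
      (fun _ v => (idpf Γ σ G).encView v) D) {m : ℕ → ℕ} (hm : PolyBdd Data.unary m) :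
    ∃ ε : ℕ → ℝ, Negligible ε ∧ ∀ κ, 0 ≤ ε κ ∧ ∀ c : ConvertCtx Γ κ (S κ),
      c.toLevelCtx.enc.size ≤ m κ → c.e.length ≤ m κ → c.j ≤ m κ →
      |𝔼 s, ind (D κ (c.view (G κ) (σ κ) b (G κ s))) - 𝔼 y, ind (D κ (c.view (G κ) (σ κ) b y))| ≤
        ε κ := by
  obtain ⟨adv, hadv, hD⟩ := hD.exists_advice
  let Ξ : ℕ → Type := fun κ => {c : ConvertCtx Γ κ (S κ) //
    c.toLevelCtx.enc.size ≤ m κ ∧ c.e.length ≤ m κ ∧ c.j ≤ m κ}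
  let encΞ : ∀ κ, Ξ κ → Data := fun κ ξ => Data.list [adv κ, ξ.1.enc]
  let inp : (Σ κ, Ξ κ × Bits (2 * κ + 2)) → Data := fun x =>
    Data.list [Data.unary x.1, encΞ x.1 x.2.1, x.2.2.enc]
  have hi : PolyTime inp inp := .id
  have hκ : PolyTime inp fun x => Data.unary x.1 := hi.fst
  have hview := PolyTime.convertCtx_view (inp := inp) (κ := fun x => x.1) (c := fun x => x.2.1.1)
    (y := fun x => x.2.2) hG.1 hσ hκ b hi.snd.fst.snd.fst hi.snd.snd.fst
  obtain ⟨ε, hε, h⟩ := hG.exists_bound (encΞ := encΞ)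
    (T := fun κ ξ y => D κ (ξ.1.view (G κ) (σ κ) b y))
    (hD.comp (fun x : (Σ κ, Ξ κ × Bits (2 * κ + 2)) => (⟨x.1, x.2.1.1.view _ _ b x.2.2⟩ :
      Σ κ, Bits κ × ∀ ℓ, CW Γ κ ((S κ).grp ℓ))) (hκ.cons (hi.snd.fst.fst.cons (hview.cons .nil))))
    (m := fun κ => (adv κ).size + 13 * m κ + 8 * κ + 30)
    (((hadv.add ((PolyBdd.const 13).mul hm)).add
      ((PolyBdd.const 8).mul (PolyTime.unary_bdd .id))).add (.const 30))
    (fun κ ξ => by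
      obtain ⟨c, h₁, h₂, h₃⟩ := ξ
      have h₄ := c.s.size_enc_le
      have h₅ := c.q.1.size_enc_le
      have h₆ := Data.size_bits_le (Γ.elBits c.q.2)
      have h₇ := Data.size_bits_le c.e
      have h₈ := Data.size_bits_le (List.replicate c.j true)
      have h₉ := c.toLevelCtx.clog_le_size
      have hL := Data.size_bool_le c.tL
      have hR := Data.size_bool_le c.tR
      have ht := Data.size_bool_le c.t
      simp only [GroupSystem.elBits, length_lowBits, List.length_replicate] at h₆ h₈
      simp only [encΞ, ConvertCtx.enc, Data.size_list_cons, Data.list_nil, Data.size_nil,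
        Data.unary, GroupSystem.elBits]
      omega)
  exact ⟨ε, hε, fun κ => ⟨(h κ).1, fun c h₁ h₂ h₃ => (h κ).2 ⟨c, h₁, h₂, h₃⟩⟩⟩

end

/-! ### Hybrids within a level and over the levels -/

section

variable {Γ : GroupSystem} {κ : ℕ} (G : Bits κ → Bits (2 * κ + 2)) (σ : ℕ) (b : Bool)

/-- In `W'` this is a translation up to sign. A uniform group element of the other server therefore
hides `β`. -/
theorem valueFor_bijective {d : Γ.Desc} (β : Γ.El d) (t : Bool) (W : Γ.El d) :
    Function.Bijective fun W' => valueFor b β t W W' := by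
  rw [Fintype.bijective_iff_injective_and_card]
  refine ⟨fun W₁ W₂ h => ?_, rfl⟩
  revert h
  cases b <;> cases t <;> simp [valueFor, valueCW]

/-- Up to the bounds for the replacement of the generator by uniform strings, the correction word of
a level is uniform, and the new seed of the other server is independent of it and uniform. -/
theorem abs_levelFor_sub_le (hκ : 0 < κ) (d : Γ.Desc) (a : Bool) (β : Γ.El d) (F : PointFn Γ)
    (st : EvalState κ) (f : (CW Γ κ d × ∀ ℓ, CW Γ κ (F.grp ℓ)) → ℝ) (hf₀ : ∀ p, 0 ≤ f p)
    (hf₁ : ∀ p, f p ≤ 1) {ε₁ ε₂ : ℝ}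
    (h₁ : |𝔼 s', f (levelFor G σ b d a β F (G st.s) (G s') st.t) -
      𝔼 y', f (levelFor G σ b d a β F (G st.s) y' st.t)| ≤ ε₁)
    (h₂ : ∀ (s : Bits κ) (tL tR t : Bool) (q : Bits κ × Γ.El d) (e : List Bool) (j : ℕ),
      e.length ≤ convertCalls κ σ (Γ.order d) * κ → j < convertCalls κ σ (Γ.order d) →
      |𝔼 x, f (finishFor G σ b d β F s tL tR t q
          (((stretchStep G)^[j] (stretchStep G (x, e))).1,
            Γ.elOfNat d (ofBits ((stretchStep G)^[j] (stretchStep G (x, e))).2))) -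
        𝔼 y, f (finishFor G σ b d β F s tL tR t q
          (((stretchStep G)^[j] (seedPart false y, e ++ List.ofFn (seedPart true y))).1,
            Γ.elOfNat d (ofBits ((stretchStep G)^[j]
              (seedPart false y, e ++ List.ofFn (seedPart true y))).2)))| ≤ ε₂) :
    |𝔼 s', f (levelFor G σ b d a β F (G st.s) (G s') st.t) -
      𝔼 s, 𝔼 l, 𝔼 r, 𝔼 W, 𝔼 s', f (⟨s, l, r, W⟩, genLoopFor G σ b F
        ⟨((convert Γ σ d (nextSeed a (G st.s) st.t s)).run G).1, nextBit a (G st.s) st.t l r⟩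
        ⟨s', !nextBit a (G st.s) st.t l r⟩)| ≤
      ε₁ + (convertCalls κ σ (Γ.order d) * ε₂ + (1 / 2 : ℝ) ^ σ) := by
  refine (abs_sub_le _ _ _).trans (add_le_add h₁ ?_)
  -- The variable `x` is the corrected seed that the other server, whose control bit is `!st.t`,
  -- feeds into its conversion; it is independent of the published corrections.
  have hcorr := expect_corrections a (G st.s) (!st.t) fun s l r x =>
    f (finishFor G σ b d β F s l r (nextBit a (G st.s) st.t l r)
      ((convert Γ σ d (nextSeed a (G st.s) st.t s)).run G) ((convert Γ σ d x).run G))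
  have hcorr' : 𝔼 y', f (levelFor G σ b d a β F (G st.s) y' st.t) = _ := hcorr
  rw [hcorr']
  refine abs_expect_sub_le fun s => abs_expect_sub_le fun l => abs_expect_sub_le fun r => ?_
  generalize nextBit a (G st.s) st.t l r = t
  generalize (convert Γ σ d (nextSeed a (G st.s) st.t s)).run G = q
  have hconv : ∀ x, (convert Γ σ d x).run G =
      (((stretchStep G)^[convertCalls κ σ (Γ.order d)] (x, [])).1, Γ.elOfNat d (ofBits
        ((stretchStep G)^[convertCalls κ σ (Γ.order d)] (x, [])).2)) := fun x => by
    rw [convert_run, stretchStep_iterate, List.nil_append]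
  have h₃ := abs_expect_stretch_sub_le G (fun p => f (finishFor G σ b d β F s l r t q
    (p.1, Γ.elOfNat d (ofBits p.2)))) (convertCalls κ σ (Γ.order d)) [] (ε := ε₂)
    fun j hj e he => h₂ s l r t q e j (by simpa using he) hj
  simp only [hconv]
  refine (abs_sub_le _ _ _).trans (add_le_add h₃ ?_)
  -- The new seed `x` is moved outside and fixed. Replacing the uniform `W_CW` by a uniform `W'`
  -- leaves only the bias of the modular reduction.
  rw [Finset.expect_comm, Finset.expect_comm (s := Finset.univ (α := Γ.El d))]
  refine abs_expect_sub_le fun x => ?_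
  rw [← expect_bijective (valueFor_bijective b β t q.2)]
  exact abs_expect_elOfNat_sub_le Γ d hκ σ (fun W' => f (finishFor G σ b d β F s l r t q (x, W')))
    (fun _ => hf₀ _) fun _ => hf₁ _

end

/-- The average over uniform correction words. -/
noncomputable def idealExp {Γ : GroupSystem} {κ : ℕ} : ∀ (n : ℕ) (grp : Fin n → Γ.Desc)
    (_ : (∀ ℓ, CW Γ κ (grp ℓ)) → ℝ), ℝ
  | 0, _, f => f fun ℓ => ℓ.elim0
  | n + 1, grp, f => 𝔼 s, 𝔼 l, 𝔼 r, 𝔼 W, idealExp n (fun ℓ => grp ℓ.succ) fun pp =>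
      f (Fin.cons (α := fun ℓ => CW Γ κ (grp ℓ)) ⟨s, l, r, W⟩ pp)

theorem convertCalls_le {κ : ℕ} (hκ : 0 < κ) (σ u : ℕ) :
    convertCalls κ σ u ≤ Nat.clog 2 u + σ := by
  have hs : slack σ u ≤ σ := by
    rw [slack_eq]
    split_ifs <;> omega
  rw [convertCalls]
  refine (Nat.div_le_div_right (c := κ) (Nat.sub_le_sub_right (Nat.add_le_add_right
    (Nat.add_le_add_left hs _) κ) 1)).trans ?_
  generalize Nat.clog 2 u + σ = x
  refine Nat.le_of_lt_succ ((Nat.div_lt_iff_lt_mul hκ).2 ?_)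
  have := Nat.le_mul_of_pos_right x hκ
  rw [Nat.succ_mul]
  omega

/-- The hybrid argument over the levels, for a fixed key of the server. -/
theorem abs_genLoopFor_sub_idealExp_le {Γ : GroupSystem} {κ : ℕ} (hκ : 0 < κ)
    (G : Bits κ → Bits (2 * κ + 2)) (σ : ℕ) (b : Bool) {S : Shape Γ}
    (D : Bits κ × (∀ ℓ, CW Γ κ (S.grp ℓ)) → Bool) {m P : ℕ} {ε₁ ε₂ : ℝ}
    (hε₂ : 0 ≤ ε₂)
    (h₁ : ∀ (c : LevelCtx Γ κ S) (st : EvalState κ), c.enc.size ≤ m →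
      |𝔼 s', ind (D (c.view (levelFor G σ b c.d c.α c.β c.rest (G st.s) (G s') st.t))) -
        𝔼 y', ind (D (c.view (levelFor G σ b c.d c.α c.β c.rest (G st.s) y' st.t)))| ≤ ε₁)
    (h₂ : ∀ c : ConvertCtx Γ κ S, c.toLevelCtx.enc.size ≤ m → c.e.length ≤ m → c.j ≤ m →
      |𝔼 s, ind (D (c.view G σ b (G s))) - 𝔼 y, ind (D (c.view G σ b y))| ≤ ε₂)
    (hm : S.enc.size + 4 * κ + 20 + P ≤ m) (hm' : (P + σ) * κ ≤ m) (key : Bits κ) {n : ℕ}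
    (grp : Fin n → Γ.Desc) (α : Fin n → Bool) (β : ∀ ℓ, Γ.El (grp ℓ)) (s : Bits κ) (t : Bool)
    (pre : List Data) (cont : (∀ ℓ, CW Γ κ (grp ℓ)) → ∀ ℓ, CW Γ κ (S.grp ℓ))
    (hcont : ∀ pp, ppList (cont pp) = pre ++ ppList pp)
    (hP : (Data.list pre).size + (4 * κ + 10) * (PointFn.mk ⟨n, grp⟩ α β).enc.size ≤ P) :
    |𝔼 s', ind (D (key, cont (genLoopFor G σ b ⟨⟨n, grp⟩, α, β⟩ ⟨s, t⟩ ⟨s', !t⟩))) -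
      idealExp n grp fun pp => ind (D (key, cont pp))| ≤
      n * (ε₁ + ((P + σ : ℕ) * ε₂ + (1 / 2 : ℝ) ^ σ)) := by
  induction n generalizing s t pre with
  | zero =>
    have : ∀ p q : (∀ ℓ, CW Γ κ (grp ℓ)), p = q := fun p q => funext fun ℓ => ℓ.elim0
    simp only [idealExp, this _ fun ℓ => ℓ.elim0]
    simp
  | succ n ih =>
    let F' : PointFn Γ := ⟨⟨n, fun ℓ => grp ℓ.succ⟩, fun ℓ => α ℓ.succ, fun ℓ => β ℓ.succ⟩
    let c : LevelCtx Γ κ S := ⟨key, grp 0, α 0, β 0, F', pre,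
      fun w pp => cont (Fin.cons (α := fun ℓ => CW Γ κ (grp ℓ)) w pp), fun w pp => by
        rw [hcont, ppList_cons]⟩
    let item : LevelItem Γ := ⟨grp 0, α 0, β 0⟩
    have henc : (PointFn.mk ⟨n + 1, grp⟩ α β).enc.size = item.enc.size + F'.enc.size + 1 := by
      simp only [PointFn.enc, List.ofFn_succ, Data.size_list_cons]
      rfl
    -- The left-hand side of `hP` is a potential that does not grow: passing a level adds at most `4
    -- κ + 10 + 4 ⌈log₂ |𝔾|⌉` to the size of `pre`. The list cell of the removed level pays for the
    -- first two terms and its item for the last.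
    rw [henc, Nat.mul_add, Nat.mul_add] at hP
    have hclog : Nat.clog 2 (Γ.order (grp 0)) ≤ item.enc.size := item.clog_le_size
    have hmul : 4 * item.enc.size ≤ (4 * κ + 10) * item.enc.size :=
      Nat.mul_le_mul_right _ (by omega)
    have hmul' : F'.enc.size ≤ (4 * κ + 10) * F'.enc.size := Nat.le_mul_of_pos_left _ (by omega)
    have hc : c.enc.size ≤ m := by
      have h₃ := key.size_enc_le
      have h₄ : c.enc.size + 2 = key.enc.size + S.enc.size + (Data.list pre).size +
          item.enc.size + F'.enc.size + 6 := by
        simp only [LevelItem.enc, LevelCtx.enc, Data.size_list_cons, Data.list_nil, Data.size_nil,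
          item, c]
        ring
      omega
    have hk : convertCalls κ σ (Γ.order (grp 0)) ≤ P + σ := by
      refine (convertCalls_le hκ σ _).trans (Nat.add_le_add_right ?_ σ)
      omega
    have hkκ : convertCalls κ σ (Γ.order (grp 0)) * κ ≤ m := (Nat.mul_le_mul_right κ hk).trans hm'
    have hlevel := abs_levelFor_sub_le G σ b hκ c.d c.α c.β c.rest ⟨s, t⟩
      (fun p => ind (D (c.view p))) (fun _ => ind_nonneg _) (fun _ => ind_le_one _)
      (h₁ c ⟨s, t⟩ hc) fun s tL tR t q e j he hj =>
        h₂ ⟨c, s, tL, tR, t, q, e, j⟩ hc (he.trans hkκ)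
          (hj.le.trans ((Nat.le_mul_of_pos_right _ hκ).trans hkκ))
    have hstep : ∀ s', cont (genLoopFor G σ b ⟨⟨n + 1, grp⟩, α, β⟩ ⟨s, t⟩ ⟨s', !t⟩) =
        (c.view (levelFor G σ b c.d c.α c.β c.rest (G s) (G s') t)).2 := fun s' => by
      rw [genLoopFor_succ]
      rfl
    simp only [hstep]
    have hn : ((n + 1 : ℕ) : ℝ) * (ε₁ + ((P + σ : ℕ) * ε₂ + (1 / 2 : ℝ) ^ σ)) =
        (ε₁ + ((P + σ : ℕ) * ε₂ + (1 / 2 : ℝ) ^ σ)) +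
          n * (ε₁ + ((P + σ : ℕ) * ε₂ + (1 / 2 : ℝ) ^ σ)) := by
      push_cast
      ring
    rw [hn]
    -- One error term is spent on idealizing this level. Its correction word is then fixed and
    -- appended to `pre`; the other seed is still averaged uniformly, as the induction hypothesis
    -- requires.
    refine (abs_sub_le _ _ _).trans (add_le_add (hlevel.trans ?_) ?_)
    · gcongr
    · refine abs_expect_sub_le fun x => abs_expect_sub_le fun l => abs_expect_sub_le fun r =>
        abs_expect_sub_le fun W => ?_
      refine ih (fun ℓ => grp ℓ.succ) (fun ℓ => α ℓ.succ) (fun ℓ => β ℓ.succ) _ _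
        (pre ++ [Data.bits (CW.mk x l r W).toBits])
        (fun pp => cont (Fin.cons (α := fun ℓ => CW Γ κ (grp ℓ)) ⟨x, l, r, W⟩ pp)) (fun pp => ?_) ?_
      · rw [hcont, ppList_cons, List.append_assoc]
        rfl
      · have h₃ := Data.size_list_append pre [Data.bits (CW.mk x l r W).toBits]
        have h₄ := Data.size_bits_le (CW.mk x l r W).toBits
        rw [CW.length_toBits, show Γ.order c.d = Γ.order (grp 0) from rfl] at h₄
        simp only [Data.size_list_cons, Data.list_nil, Data.size_nil] at h₃
        change _ + (4 * κ + 10) * F'.enc.size ≤ P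
        omega

theorem Negligible.poly_mul {ε : ℕ → ℝ} (h : Negligible ε) (q : Polynomial ℕ) :
    Negligible fun κ => (q.eval κ : ℕ) * ε κ :=
  (Asymptotics.SuperpolynomialDecay.polynomial_mul h (q.map (Nat.castRingHom ℝ))).congr fun κ => by
    rw [Polynomial.eval_natCast_map]
    simp

/-! ### From the hybrids to the simulator -/

section

variable {Γ : GroupSystem} {σ : ℕ → ℕ} {G : ∀ κ, Bits κ → Bits (2 * κ + 2)}

theorem toReal_real_map (b : Bool) (κ : ℕ) (F : PointFn Γ)
    (D : Bits κ × (∀ ℓ, CW Γ κ (F.grp ℓ)) → Bool) :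
    ((((idpf Γ σ G).real b κ F).map D) true).toReal =
      𝔼 key, 𝔼 s', ind (D (key, genLoopFor (G κ) (σ κ) b F ⟨key, b⟩ ⟨s', !b⟩)) := by
  change (((((PMF.uniformOfFintype (Bits κ × Bits κ)).map fun s =>
    (genAlg Γ (σ κ) F s.1 s.2).run (G κ)).map
      fun o => ((bif b then o.2.1 else o.1, o.2.2) : Bits κ × ∀ ℓ, CW Γ κ (F.grp ℓ))).map D)
        true).toReal = _
  rw [PMF.map_comp, PMF.map_comp, toReal_uniform_map, expect_prod]
  cases b
  · simp only [Function.comp_apply, genAlg_run]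
    rfl
  · rw [Finset.expect_comm]
    simp only [Function.comp_apply, genAlg_run]
    rfl

/-- The number of levels and the number of rounds per conversion are polynomial, so the accumulated
error is a polynomial combination of negligible terms. Shapes are separated from `α` and `β` so that
one distinguisher can be applied to two functions of the same shape. -/
theorem exists_real_bound (hG : IsPRG G) (hσ : PolyTime Data.unary fun κ => Data.unary (σ κ))
    (hσ' : Negligible fun κ => (1 / 2 : ℝ) ^ σ κ) (b : Bool) {S : ℕ → Shape Γ}
    (α : ∀ κ, Fin (S κ).n → Bool) (β : ∀ κ ℓ, Γ.El ((S κ).grp ℓ))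
    (hF : PolyBdd Data.unary fun κ => (PointFn.mk (S κ) (α κ) (β κ)).enc.size)
    {D : ∀ κ, Bits κ × (∀ ℓ, CW Γ κ ((S κ).grp ℓ)) → Bool}
    (hD : NonuniformPolyTime (B := fun κ => (idpf Γ σ G).View κ (S κ))
      (fun _ v => (idpf Γ σ G).encView v) D) :
    ∃ δ : ℕ → ℝ, Negligible δ ∧ ∀ κ, 0 < κ →
      |((((idpf Γ σ G).real b κ ⟨S κ, α κ, β κ⟩).map (D κ)) true).toReal -
        𝔼 key, idealExp (S κ).n (S κ).grp fun pp => ind (D κ (key, pp))| ≤ δ κ := by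
  let B : ℕ → ℕ := fun κ => (PointFn.mk (S κ) (α κ) (β κ)).enc.size
  -- This is the initial potential: the empty list of earlier levels has size `1`.
  let P : ℕ → ℕ := fun κ => 1 + (4 * κ + 10) * B κ
  have hκ : PolyBdd Data.unary fun κ => κ := PolyTime.unary_bdd .id
  have hS : PolyBdd Data.unary fun κ => (S κ).enc.size := by
    obtain ⟨q, hq⟩ := (PolyTime.shape (inp := PointFn.enc) (F := fun F : PointFn Γ => F) .id).bdd
    exact (hF.poly q).mono fun κ => hq (PointFn.mk (S κ) (α κ) (β κ))
  have hP : PolyBdd Data.unary P :=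
    (PolyBdd.const 1).add ((((PolyBdd.const 4).mul hκ).add (.const 10)).mul hF)
  have hPσ : PolyBdd Data.unary fun κ => P κ + σ κ := hP.add hσ.unary_bdd
  have hm : PolyBdd Data.unary fun κ =>
      (S κ).enc.size + 4 * κ + 20 + P κ + (P κ + σ κ) * κ :=
    (((hS.add ((PolyBdd.const 4).mul hκ)).add (.const 20)).add hP).add (hPσ.mul hκ)
  obtain ⟨ε₁, hε₁, h₁⟩ := exists_levelFor_bound hG hσ b hD hm
  obtain ⟨ε₂, hε₂, h₂⟩ := exists_convert_bound hG hσ b hD hm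
  obtain ⟨q₁, hq₁⟩ := PolyBdd.exists_poly (f := B) hF
  obtain ⟨q₂, hq₂⟩ := hPσ.exists_poly
  refine ⟨_, Negligible.poly_mul (hε₁.add ((hε₂.poly_mul q₂).add hσ')) q₁, fun κ hpos => ?_⟩
  refine (congrArg (fun z : ℝ => |z - _|) (toReal_real_map (σ := σ) (G := G) b κ
    ⟨S κ, α κ, β κ⟩ (D κ))).trans_le ?_
  refine abs_expect_sub_le fun key => ?_
  refine (abs_genLoopFor_sub_idealExp_le hpos (G κ) (σ κ) b (D κ) (h₂ κ).1 (h₁ κ).2 (h₂ κ).2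
    (Nat.le_add_right _ _) (Nat.le_add_left _ _) key (S κ).grp (α κ) (β κ) key b [] (fun pp => pp)
    (fun _ => rfl) le_rfl).trans ?_
  have hn : (S κ).n ≤ B κ := by
    have := Data.length_le_size_list (List.ofFn fun ℓ => Data.list [Data.bool (α κ ℓ),
      Γ.encDesc ((S κ).grp ℓ), Data.bits (Γ.elBits (β κ ℓ))])
    rwa [List.length_ofFn] at this
  have h₁₀ := (h₁ κ).1
  have h₂₀ := (h₂ κ).1
  simp only [Pi.add_apply]
  gcongr
  · exact hn.trans (hq₁ κ)
  · exact hq₂ κ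

/-- An all-prefix point function of a given shape, with fixed `α` and values with number `0`. -/
noncomputable def Shape.trivialFn (S : Shape Γ) : PointFn Γ :=
  ⟨S, fun _ => false, fun ℓ => Γ.elOfNat (S.grp ℓ) 0⟩

theorem PolyTime.trivialFn {A : Type} {inp : A → Data} {S : A → Shape Γ}
    (hS : PolyTime inp fun a => (S a).enc) : PolyTime inp fun a => (S a).trivialFn.enc := by
  let inp' : (Σ _ : A, Γ.Desc) → Data := fun x => Data.cons (inp x.1) (Γ.encDesc x.2)
  have hi : PolyTime inp' inp' := .id
  -- The element with number `0` is computed by reducing the empty bit string modulo the group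
  -- order.
  have h := PolyTime.map (inp := inp) (E := fun _ => Γ.Desc) (encE := fun _ => Γ.encDesc)
    (f := fun _ d => Data.list [Data.bool false, Γ.encDesc d,
      Data.bits (Γ.elBits (Γ.elOfNat d (ofBits [])))])
    ((const (Data.bool false)).cons (hi.snd.cons ((elOfNat
      (d := fun x : (Σ _ : A, Γ.Desc) => x.2) (e := fun _ => []) hi.snd .nil).cons .nil)))
    (l := fun a => List.ofFn (S a).grp) (hS.congr fun a => by rw [List.map_ofFn]; rfl)
  refine h.congr fun a => ?_
  rw [List.map_ofFn]
  rfl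

/-- Two functions of the same shape have the same ideal average, so their real views are both close
to it. Simulating by key generation for a fixed function avoids sampling exactly uniform group
elements, which finitely many coins cannot do unless the order is a power of two. -/
theorem idpf_isSecure (hG : IsPRG G) (hσ : PolyTime Data.unary fun κ => Data.unary (σ κ))
    (hσ' : Negligible fun κ => (1 / 2 : ℝ) ^ σ κ) : (idpf Γ σ G).IsSecure := by
  intro b
  refine ⟨fun a => (idpf Γ σ G).real b a.1 a.2.trivialFn, ?_, fun F ⟨q, hq⟩ D hD => ?_⟩
  · refine ⟨fun a => a.1 + a.1, fun a c =>
      (bif b then (splitCoins c).2 else (splitCoins c).1, (genLoop Γ (σ a.1) a.2.trivialFn.n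
        a.2.trivialFn.grp a.2.trivialFn.α a.2.trivialFn.β ⟨(splitCoins c).1, false⟩
        ⟨(splitCoins c).2, true⟩).run (G a.1)),
      PolyTime.unary_add PolyTime.id.fst PolyTime.id.fst, ?_, fun a => ?_⟩
    · let inp : (Σ a : ℕ × Shape Γ, Bits (a.1 + a.1)) → Data := fun x =>
        Data.cons (Data.list [Data.unary x.1.1, x.1.2.enc]) x.2.enc
      have hi : PolyTime inp inp := .id
      have hs := enc_splitCoins (inp := inp) (κ := fun x => x.1.1) (c := fun x => x.2)
        hi.fst.fst hi.snd
      have hpp := PolyTime.encPP_genLoop (σ := σ) (inp := inp) (κ := fun x => x.1.1)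
        (F := fun x => x.1.2.trivialFn) hG.1 hσ hi.fst.fst (PolyTime.trivialFn hi.fst.snd.fst)
        hs.1 hs.2
      cases b
      · exact hs.1.cons hpp
      · exact hs.2.cons hpp
    · change ((idpf Γ σ G).gen a.1 a.2.trivialFn).map _ = _
      rw [gen_eq_map]
      exact PMF.map_comp _ _ _
  · have hF : PolyBdd Data.unary fun κ => (F κ).enc.size := .of_poly q hq
    have hF₀ : PolyBdd Data.unary fun κ => (F κ).toShape.trivialFn.enc.size := by
      obtain ⟨q, hq⟩ := (PolyTime.trivialFn (PolyTime.shape (inp := PointFn.enc)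
        (F := fun F : PointFn Γ => F) .id)).bdd
      exact (hF.poly q).mono fun κ => hq (F κ)
    obtain ⟨δ₁, hδ₁, h₁⟩ := exists_real_bound hG hσ hσ' b (S := fun κ => (F κ).toShape)
      (fun κ => (F κ).α) (fun κ => (F κ).β) hF hD
    obtain ⟨δ₂, hδ₂, h₂⟩ := exists_real_bound hG hσ hσ' b (S := fun κ => (F κ).toShape)
      (fun κ => (F κ).toShape.trivialFn.α) (fun κ => (F κ).toShape.trivialFn.β) hF₀ hD
    refine (hδ₁.add hδ₂).trans_eventually_abs_le ?_
    -- Negligibility concerns large `κ` only, so `κ = 0`, where the bounds are not available, can be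
    -- dropped.
    filter_upwards [Filter.eventually_gt_atTop 0] with κ hκ
    have h := (abs_sub_le _ _ _).trans
      (add_le_add (h₁ κ hκ) ((abs_sub_comm _ _).trans_le (h₂ κ hκ)))
    simp only [Function.comp_apply, Pi.add_apply, abs_abs]
    exact h.trans (le_abs_self _)

end

end IncDPF

theorem proposition1 (Γ : GroupSystem) (σ : ℕ → ℕ)
    (hσ : PolyTime Data.unary (fun κ => Data.unary (σ κ)))
    (hσ' : Negligible fun κ => (1 / 2 : ℝ) ^ σ κ)
    (G : ∀ κ, Bits κ → Bits (2 * κ + 2)) (hG : IsPRG G) :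
    -- the construction is a secure incremental DPF
    (idpf Γ σ G).IsSecureIDPF ∧
    -- key size
    (∀ (κ : ℕ) (S : Shape Γ) (v : (idpf Γ σ G).View κ S),
      ((idpf Γ σ G).viewBits v).length
        = κ + (κ + 2) * S.n + ∑ ℓ, ⌈Real.logb 2 (Γ.order (S.grp ℓ))⌉₊) ∧
    -- number of evaluations of the generator in the key generation
    (∀ (κ : ℕ), 0 < κ → ∀ (F : PointFn Γ) (s₀ s₁ : Bits κ),
      (genAlg Γ (σ κ) F s₀ s₁).calls (G κ)
        = 2 * ∑ ℓ, cost κ (σ κ) (Γ.order (F.grp ℓ))) ∧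
    -- number of evaluations of the generator in the evaluation of a prefix
    (∀ (κ : ℕ), 0 < κ → ∀ (b : Bool) (k : Bits κ) (S : Shape Γ) (pp : ∀ ℓ, CW Γ κ (S.grp ℓ))
      (ℓ : Fin S.n) (x : Bits (ℓ + 1)),
      (evalPrefixAlg Γ (σ κ) b k S pp ℓ x).calls (G κ)
        = ∑ j ∈ Finset.Iic ℓ, cost κ (σ κ) (Γ.order (S.grp j))) :=
  ⟨⟨idpf_isEfficient Γ σ G hG.1 hσ, idpf_isCorrect Γ σ G, idpf_isSecure hG hσ hσ'⟩,
    fun κ S v => length_viewBits Γ σ G κ S v,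
    fun κ hκ F s₀ s₁ => genAlg_calls Γ (G κ) hκ (σ κ) F s₀ s₁,
    fun κ hκ b k S pp ℓ x => evalLoop_calls Γ (G κ) hκ (σ κ) b S.grp pp ⟨k, b⟩ ℓ x⟩
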